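/- **Setting.** Let $k$ be an algebraically closed field of characteristic $0$ and let $n\ge 3$ be odd. Write $a\wedge b=\tfrac12(a\otimes b-b\otimes a)$, let $e_{ij}$ be the elementary $n\times n$ matrices, and let $\mathfrak{sl}_n\wedge\mathfrak{sl}_n$ be the span of all $a\wedge b$ with $a,b\in\mathfrak{sl}_n$. Elements of $\mathfrak{gl}_n\otimes\mathfrak{gl}_n$ are viewed as operators on $k^n\otimes k^n$, and $k^n\otimes k^n$ is identified with the span $P_n\subset k[x_1^{\pm1},x_2^{\pm1}]$ of the monomials $x_1^{j-1}x_2^{l-1}$, $1\le j,l\le n$, via $e_j\otimes e_l\leftrightarrow x_1^{j-1}x_2^{l-1}$. An element $r\in\mathfrak{sl}_n\wedge\mathfrak{sl}_n$ is a triangular $r$-matrix if $[r_{12},r_{13}]+[r_{12},r_{23}]+[r_{13},r_{23}]=0$. *The Cremmer–Gervais $r$-matrix.* For coprime $m<n$ let $\alpha_1,\dots,\alpha_{n-1}$ be the simple roots of $\mathfrak{sl}_n$, let $\zeta$ be the map $\alpha_s\mapsto\alpha_{s+m \bmod n}$ for $s\ne n-m$, extended additively to the positive roots that are sums of the $\alpha_s$,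 $s\neq n-m$, and write $\rho\prec\mu$ if $\zeta^N(\rho)=\mu$ for some $N\ge1$. Let $e_{\pm\rho}$ be the elementary matrix of the root $\pm\rho$. Put $$r_{m,n}=2\sum_{\rho\prec\mu}e_\rho\wedge e_{-\mu}+\sum_{j<l}\Bigl(-1+\tfrac2n\bigl[(j-l)m^{-1}\bmod n\bigr]\Bigr)e_{jj}\wedge e_{ll}+\sum_{j<l}e_{jl}\wedge e_{lj}.$$ *Operators.* On $k[x_1^{\pm1},x_2^{\pm1}]$ let $\sigma$ exchange $x_1$ and $x_2$, let $\xi_i$ send $x_i\mapsto -x_i$ and fix the other variable, let $\partial_i=\partial/\partial x_i$, and let $\Delta=\frac{x_1+x_2}{x_1-x_2}(1-\sigma)$. Put $$\begin{aligned} E_1&=\tfrac12(x_1^{-1}\partial_1+x_2^{-1}\partial_2)-\tfrac14\bigl(x_1^{-2}(1-\xi_1)+x_2^{-2}(1-\xi_2)\bigr),\qquad E_2=\tfrac12(x_1+x_2-x_1\xi_1-x_2\xi_2),\\ v_1&=\tfrac14(x_1x_2)^{-1}(\Delta-\xi_1\Delta\xi_2+\xi_1-\xi_2)-\tfrac1{4n}\bigl(2(x_1^{-1}\partial_1-x_2^{-1}\partial_2)-x_1^{-2}(1-\xi_1)+x_2^{-2}(1-\xi_2)\bigr),\\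 v_2&=\tfrac14\bigl(x_2\xi_1-x_1\xi_2+(x_1-x_2)\xi_1\xi_2+\tfrac1n(x_1(1-\xi_1)-x_2(1-\xi_2))\bigr),\\ v_3&=\tfrac12(x_1x_2)^{-1}\bigl(x_1\xi_1-x_2\xi_2-(x_1-x_2)\xi_1\xi_2+\tfrac1n(x_2(1-\xi_1)-x_1(1-\xi_2))\bigr),\\ v_4&=\tfrac12\Bigl(\frac{x_2}{x_1}-\frac{x_1}{x_2}\Bigr)(1-\xi_1-\xi_2+\xi_1\xi_2),\\ b_{CG}(u,t)&=u\,v_1+t\,v_2+tu\,v_3+\tfrac12t^2u\,v_4\qquad(u,t\in k). \end{aligned}$$ **Theorem.** $E_1$ and $E_2$ preserve $P_n$ and act on $P_n\cong k^n\otimes k^n$ as $X\otimes1+1\otimes X$ with, respectively, $X=\sum_{j=1}^{n-2}\lfloor\frac{j+1}2\rfloor e_{j,j+2}$ and $X=e_{32}+e_{54}+\dots+e_{n,n-1}$ in $\mathfrak{sl}_n$; let these elements of $\mathfrak{sl}_n$ (again written $E_1,E_2$) act on $\mathfrak{gl}_n\otimes\mathfrak{gl}_n$ by the adjoint action. For all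 $u,t\in k$ the operator $b_{CG}(u,t)$ preserves $P_n$, and viewed as an operator on $k^n\otimes k^n$ it has the following properties. 1. $uE_1$ and $tE_2$ act nilpotently, and $$e^{tE_2}e^{uE_1}.\,r_{n-2,n}=r_{n-2,n}+b_{CG}(u,t).$$ Moreover $b_{CG}(u,t)\in\mathfrak{sl}_n\wedge\mathfrak{sl}_n$ is a triangular $r$-matrix. If $(u,t)\ne(0,0)$, then $b_{CG}(u,t)\neq0$ and the point $[b_{CG}(u,t)]$ of projective space lies in the Zariski boundary $\overline{O}\setminus O$ of the orbit $O=SL_n\cdot[r_{n-2,n}]$. 2. If $u,t\ne0$, the carrier of $b_{CG}(u,t)$, i.e. the span of all $(\xi\otimes1)\,b_{CG}(u,t)$ with $\xi$ a linear functional, is the maximal parabolic subalgebra $\mathfrak p_{n-2,n}$ of $\mathfrak{sl}_n$, consisting of the traceless matrices in the span of the $e_{jl}$ with $j\le n-2$ or $l>n-2$. 3. If $u,t\neq0$, then $$\varphi=u^{-1}\bigl(e_{13}^*+e_{24}^*+\dots+e_{n-2,n}^*\bigr)-t^{-1}e_{n,n-1}^*+t\,e_{n-1,n}^*+2\,(e_{n-1,n-1}-e_{nn})^*\in\mathfrak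 p_{n-2,n}^*$$ (dual basis vectors for the basis of all $e_{jl}\in\mathfrak p_{n-2,n}$, $j\ne l$, and all $e_{jj}-e_{j+1,j+1}$) is a Frobenius functional associated to $b_{CG}(u,t)$: the form $(X,Y)\mapsto\varphi([X,Y])$ on $\mathfrak p_{n-2,n}$ is nondegenerate, the map $\check r:\xi\mapsto(\xi\otimes1)\,b_{CG}(u,t)$ is a linear isomorphism $\mathfrak p_{n-2,n}^*\to\mathfrak p_{n-2,n}$, and $\varphi([X,Y])=\langle\check r^{-1}X,Y\rangle$ for all $X,Y\in\mathfrak p_{n-2,n}$. -/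

import Mathlib

open scoped Kronecker

attribute [local instance 100] LieRing.ofAssociativeRing

noncomputable section

namespace CremmerGervais

variable {k : Type*} [Field k]

/- ### Operators on `k[x₁^{±1}, x₂^{±1}]` -/

/-- Laurent polynomials in two variables, as the vector space on the monomials `x₁^j x₂^l`
(`j, l` integers). -/
abbrev Laurent (k : Type*) [Field k] : Type _ := (ℤ × ℤ) →₀ k

/-- The monomial `x₁^j x₂^l`. -/
def mono (j l : ℤ) : Laurent k := Finsupp.single (j, l) 1

/-- The linear operator with prescribed values on the monomials. -/
def ofMono (f : ℤ → ℤ → Laurent k) : Module.End k (Laurent k) :=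
  Finsupp.linearCombination k (fun p : ℤ × ℤ => f p.1 p.2)

/-- Multiplication by `x₁^a x₂^b`. -/
def mulX (a b : ℤ) : Module.End k (Laurent k) := ofMono fun j l => mono (j + a) (l + b)

/-- The operator exchanging `x₁` and `x₂`. -/
def sigma : Module.End k (Laurent k) := ofMono fun j l => mono l j

/-- `ξ₁ : x₁ ↦ -x₁`. -/
def xi₁ : Module.End k (Laurent k) := ofMono fun j l => ((-1 : k) ^ j) • mono j l

/-- `ξ₂ : x₂ ↦ -x₂`. -/
def xi₂ : Module.End k (Laurent k) := ofMono fun j l => ((-1 : k) ^ l) • mono j l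

/-- The partial derivative in `x₁`. -/
def pd₁ : Module.End k (Laurent k) := ofMono fun j l => (j : k) • mono (j - 1) l

/-- The partial derivative in `x₂`. -/
def pd₂ : Module.End k (Laurent k) := ofMono fun j l => (l : k) • mono j (l - 1)

/-- The divided difference operator `Δ = (x₁ + x₂) / (x₁ - x₂) (1 - σ)`, written out on monomials;
see `divDiff_spec`, which determines it because `x₁ - x₂` is not a zero divisor. -/
def divDiff : Module.End k (Laurent k) := ofMono fun j l =>
  ∑ N ∈ Finset.range (j - l).toNat, (mono (j - N) (l + N) + mono (j - 1 - N) (l + 1 + N))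
  - ∑ N ∈ Finset.range (l - j).toNat, (mono (l - N) (j + N) + mono (l - 1 - N) (j + 1 + N))

theorem ofMono_mono (f : ℤ → ℤ → Laurent k) (j l : ℤ) : ofMono f (mono j l) = f j l := by
  simp [ofMono, mono]

theorem divDiff_aux (j l : ℤ) (d : ℕ) :
    (mulX 1 0 - mulX 0 1 : Module.End k (Laurent k))
      (∑ N ∈ Finset.range d, (mono (j - N) (l + N) + mono (j - 1 - N) (l + 1 + N)))
      = mono (j + 1) l + mono j (l + 1) - mono (j - d + 1) (l + d) - mono (j - d) (l + d + 1) := by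
  induction d with
  | zero => simp
  | succ d ih =>
    rw [Finset.sum_range_succ, map_add, ih]
    simp only [mulX, LinearMap.sub_apply, map_add, ofMono_mono]
    push_cast
    have e1 : j - 1 - (d : ℤ) + 1 = j - d := by ring
    have e3 : j - ((d : ℤ) + 1) = j - 1 - d := by ring
    have e4 : l + 1 + (d : ℤ) = l + d + 1 := by ring
    have e5 : l + ((d : ℤ) + 1) = l + d + 1 := by ring
    simp only [e1, e3, e4, e5, add_zero]
    abel

theorem divDiff_spec :
    (mulX 1 0 - mulX 0 1) * divDiff
      = (mulX 1 0 + mulX 0 1) * (1 - sigma : Module.End k (Laurent k)) := by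
  refine Finsupp.lhom_ext' fun p => LinearMap.ext_ring ?_
  obtain ⟨j, l⟩ := p
  change (mulX 1 0 - mulX 0 1 : Module.End k (Laurent k)) (divDiff (mono j l))
    = (mulX 1 0 + mulX 0 1 : Module.End k (Laurent k)) ((1 - sigma : Module.End k _) (mono j l))
  have hR : (mulX 1 0 + mulX 0 1 : Module.End k (Laurent k))
      ((1 - sigma : Module.End k _) (mono j l))
      = mono (j + 1) l + mono j (l + 1) - mono (l + 1) j - mono l (j + 1) := by
    simp only [sigma, mulX, LinearMap.sub_apply, LinearMap.add_apply, Module.End.one_apply,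
      ofMono_mono, map_sub, add_zero]
    abel
  rw [hR, divDiff, ofMono_mono, map_sub, divDiff_aux, divDiff_aux]
  rcases le_total l j with h | h
  · have h1 : ((j - l).toNat : ℤ) = j - l := Int.toNat_of_nonneg (by omega)
    have h2 : (l - j).toNat = 0 := by omega
    rw [h1, h2]
    have e1 : j - (j - l) = l := by ring
    have e2 : l + (j - l) = j := by ring
    simp only [e1, e2, Nat.cast_zero, sub_zero, add_zero]
    abel
  · have h1 : ((l - j).toNat : ℤ) = l - j := Int.toNat_of_nonneg (by omega)
    have h2 : (j - l).toNat = 0 := by omega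
    rw [h1, h2]
    have e1 : l - (l - j) = j := by ring
    have e2 : j + (l - j) = l := by ring
    simp only [e1, e2, Nat.cast_zero, sub_zero, add_zero]
    abel

/-- `E₁ = ½ (x₁⁻¹ ∂₁ + x₂⁻¹ ∂₂) - ¼ (x₁⁻² (1 - ξ₁) + x₂⁻² (1 - ξ₂))`. -/
def opE₁ : Module.End k (Laurent k) :=
  (1 / 2 : k) • (mulX (-1) 0 * pd₁ + mulX 0 (-1) * pd₂)
  - (1 / 4 : k) • (mulX (-2) 0 * (1 - xi₁) + mulX 0 (-2) * (1 - xi₂))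

/-- `E₂ = ½ (x₁ + x₂ - x₁ ξ₁ - x₂ ξ₂)`. -/
def opE₂ : Module.End k (Laurent k) :=
  (1 / 2 : k) • (mulX 1 0 + mulX 0 1 - mulX 1 0 * xi₁ - mulX 0 1 * xi₂)

/-- `v₁ = ¼ (x₁x₂)⁻¹ (Δ - ξ₁Δξ₂ + ξ₁ - ξ₂)
  - 1/(4n) (2 (x₁⁻¹∂₁ - x₂⁻¹∂₂) - x₁⁻² (1 - ξ₁) + x₂⁻² (1 - ξ₂))`. -/
def opV₁ (n : ℕ) : Module.End k (Laurent k) :=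
  (1 / 4 : k) • (mulX (-1) (-1) * (divDiff - xi₁ * divDiff * xi₂ + xi₁ - xi₂))
  - (1 / (4 * n) : k) • ((2 : k) • (mulX (-1) 0 * pd₁ - mulX 0 (-1) * pd₂)
      - mulX (-2) 0 * (1 - xi₁) + mulX 0 (-2) * (1 - xi₂))

/-- `v₂ = ¼ (x₂ξ₁ - x₁ξ₂ + (x₁ - x₂) ξ₁ξ₂ + 1/n (x₁ (1 - ξ₁) - x₂ (1 - ξ₂)))`. -/
def opV₂ (n : ℕ) : Module.End k (Laurent k) :=
  (1 / 4 : k) • (mulX 0 1 * xi₁ - mulX 1 0 * xi₂ + (mulX 1 0 - mulX 0 1) * xi₁ * xi₂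
    + (1 / n : k) • (mulX 1 0 * (1 - xi₁) - mulX 0 1 * (1 - xi₂)))

/-- `v₃ = ½ (x₁x₂)⁻¹ (x₁ξ₁ - x₂ξ₂ - (x₁ - x₂) ξ₁ξ₂ + 1/n (x₂ (1 - ξ₁) - x₁ (1 - ξ₂)))`. -/
def opV₃ (n : ℕ) : Module.End k (Laurent k) :=
  (1 / 2 : k) • (mulX (-1) (-1) * (mulX 1 0 * xi₁ - mulX 0 1 * xi₂
    - (mulX 1 0 - mulX 0 1) * xi₁ * xi₂
    + (1 / n : k) • (mulX 0 1 * (1 - xi₁) - mulX 1 0 * (1 - xi₂))))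

/-- `v₄ = ½ (x₂/x₁ - x₁/x₂) (1 - ξ₁ - ξ₂ + ξ₁ξ₂)`. -/
def opV₄ : Module.End k (Laurent k) :=
  (1 / 2 : k) • ((mulX (-1) 1 - mulX 1 (-1)) * (1 - xi₁ - xi₂ + xi₁ * xi₂))

/-- `b_CG(u,t) = u v₁ + t v₂ + t u v₃ + ½ t² u v₄`. -/
def opB (n : ℕ) (u t : k) : Module.End k (Laurent k) :=
  u • opV₁ n + t • opV₂ n + (t * u) • opV₃ n + (1 / 2 * t ^ 2 * u) • opV₄

/-- The span of the monomials `x₁^j x₂^l` with `0 ≤ j, l < n`. -/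
def truncPol (k : Type*) [Field k] (n : ℕ) : Submodule k (Laurent k) :=
  Finsupp.supported k k {p : ℤ × ℤ | (0 ≤ p.1 ∧ p.1 < n) ∧ (0 ≤ p.2 ∧ p.2 < n)}

/- ### Tensors over `gl_n` as operators on `kⁿ ⊗ kⁿ`

An element of `gl_n ⊗ gl_n` is represented by the matrix of the corresponding operator on
`kⁿ ⊗ kⁿ`; the elementary tensor `A ⊗ B` is the Kronecker product `A ⊗ₖ B`, and its entry at row
`(a, b)` and column `(j, l)` is the coefficient of `e_a ⊗ e_b` in the image of `e_j ⊗ e_l`.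
Indices run through `0, …, n - 1`. -/

/-- The `n × n` matrices. -/
abbrev Mat (k : Type*) [Field k] (n : ℕ) : Type _ := Matrix (Fin n) (Fin n) k

/-- Operators on `kⁿ ⊗ kⁿ`. -/
abbrev Mat₂ (k : Type*) [Field k] (n : ℕ) : Type _ :=
  Matrix (Fin n × Fin n) (Fin n × Fin n) k

/-- Operators on `kⁿ ⊗ kⁿ ⊗ kⁿ`. -/
abbrev Mat₃ (k : Type*) [Field k] (n : ℕ) : Type _ :=
  Matrix (Fin n × Fin n × Fin n) (Fin n × Fin n × Fin n) k

/-- The matrix of an operator preserving `truncPol k n`, under the identification of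
`x₁^j x₂^l` with `e_j ⊗ e_l` (`0 ≤ j, l < n`). -/
def truncMatrix (n : ℕ) (T : Module.End k (Laurent k)) : Mat₂ k n :=
  Matrix.of fun ab jl => T (mono (jl.1 : ℕ) (jl.2 : ℕ)) ((ab.1 : ℕ), (ab.2 : ℕ))

/-- `b_CG(u,t)` as an operator on `kⁿ ⊗ kⁿ`. -/
def bCG (n : ℕ) (u t : k) : Mat₂ k n := truncMatrix n (opB n u t)

/-- `a ∧ b = ½ (a ⊗ b - b ⊗ a)`. -/
def wedge {n : ℕ} (A B : Mat k n) : Mat₂ k n := (1 / 2 : k) • (A ⊗ₖ B - B ⊗ₖ A)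

/-- The subspace `sl_n ∧ sl_n`. -/
def slWedge (k : Type*) [Field k] (n : ℕ) : Submodule k (Mat₂ k n) :=
  Submodule.span k {R | ∃ A ∈ LieAlgebra.SpecialLinear.sl (Fin n) k,
    ∃ B ∈ LieAlgebra.SpecialLinear.sl (Fin n) k, R = wedge A B}

/- ### The classical Yang–Baxter equation -/

/-- `τ₁₂`. -/
def leg₁₂ {n : ℕ} (R : Mat₂ k n) : Mat₃ k n := Matrix.of fun p q =>
  if p.2.2 = q.2.2 then R (p.1, p.2.1) (q.1, q.2.1) else 0

/-- `τ₁₃`. -/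
def leg₁₃ {n : ℕ} (R : Mat₂ k n) : Mat₃ k n := Matrix.of fun p q =>
  if p.2.1 = q.2.1 then R (p.1, p.2.2) (q.1, q.2.2) else 0

/-- `τ₂₃`. -/
def leg₂₃ {n : ℕ} (R : Mat₂ k n) : Mat₃ k n := Matrix.of fun p q =>
  if p.1 = q.1 then R (p.2.1, p.2.2) (q.2.1, q.2.2) else 0

/-- The operator `u ⊗ v ⊗ w ↦ w ⊗ u ⊗ v - v ⊗ w ⊗ u`. -/
def cycZ (k : Type*) [Field k] (n : ℕ) : Mat₃ k n := Matrix.of fun p q =>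
  (if p = (q.2.2, q.1, q.2.1) then 1 else 0) - (if p = (q.2.1, q.2.2, q.1) then 1 else 0)

/-- The classical Yang–Baxter map
`CYB_c(τ) = [τ₁₂, τ₁₃] + [τ₁₂, τ₂₃] + [τ₁₃, τ₂₃] - c Z`. -/
def CYB {n : ℕ} (c : k) (R : Mat₂ k n) : Mat₃ k n :=
  ⁅leg₁₂ R, leg₁₃ R⁆ + ⁅leg₁₂ R, leg₂₃ R⁆ + ⁅leg₁₃ R, leg₂₃ R⁆ - c • cycZ k n

/-- Triangular `r`-matrices for `sl_n`. -/
def IsTriangular {n : ℕ} (R : Mat₂ k n) : Prop := R ∈ slWedge k n ∧ CYB 0 R = 0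

/- ### The Cremmer–Gervais `r`-matrices -/

/-- The positive root `ε_i - ε_j` (`i < j`, indices from `0`) is the sum of the simple roots
`α_s` with `i + 1 ≤ s ≤ j`, where `α_1, …, α_{n-1}` are the simple roots of `sl_n`. -/
def rootSupport {n : ℕ} (ρ : Fin n × Fin n) : Finset ℕ := Finset.Icc (ρ.1.val + 1) ρ.2.val

/-- `ζ(ρ) = μ` for positive roots `ρ`, `μ`, where `ζ` is the (additively extended) bijection of the
Belavin–Drinfeld triple `𝒯_{m,n} = (Π ∖ {α_{n-m}}, Π ∖ {α_m}, α_s ↦ α_{s+m mod n})`. -/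
def bdStep (m n : ℕ) (ρ μ : Fin n × Fin n) : Prop :=
  ρ.1 < ρ.2 ∧ μ.1 < μ.2 ∧ n - m ∉ rootSupport ρ ∧
    (rootSupport ρ).image (fun s => (s + m) % n) = rootSupport μ

/-- The partial order `ρ ≺ μ`: some iterate `ζ^N` with `N ≥ 1` takes `ρ` to `μ`. -/
def bdLT (m n : ℕ) : Fin n × Fin n → Fin n × Fin n → Prop := Relation.TransGen (bdStep m n)

/-- The elementary matrix `e_{ij}`. -/
def e {n : ℕ} (i j : Fin n) : Mat k n := Matrix.single i j 1

open Classical in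
/-- `α = 2 ∑_{ρ ≺ μ} e_ρ ∧ e_{-μ}`. -/
def alphaPart (k : Type*) [Field k] (m n : ℕ) : Mat₂ k n :=
  (2 : k) • ∑ ρ : Fin n × Fin n, ∑ μ : Fin n × Fin n,
    if bdLT m n ρ μ then wedge (e ρ.1 ρ.2) (e μ.2 μ.1) else 0

/-- `β = ∑_{j<l} (-1 + 2/n [(j - l) m⁻¹ mod n]) e_{jj} ∧ e_{ll}`. -/
def betaPart (k : Type*) [Field k] (m n : ℕ) : Mat₂ k n :=
  ∑ j : Fin n, ∑ l : Fin n, if j < l then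
    (-1 + 2 / (n : k) *
      ((((j.val : ZMod n) - (l.val : ZMod n)) * (m : ZMod n)⁻¹).val : k)) • wedge (e j j) (e l l)
    else 0

/-- `γ = ∑_{j<l} e_{jl} ∧ e_{lj}`. -/
def gammaPart (k : Type*) [Field k] (n : ℕ) : Mat₂ k n :=
  ∑ j : Fin n, ∑ l : Fin n, if j < l then wedge (e j l) (e l j) else 0

/-- The generalized Cremmer–Gervais `r`-matrix `r_{m,n}` (for coprime `m < n`). -/
def rCG (k : Type*) [Field k] (m n : ℕ) : Mat₂ k n :=
  alphaPart k m n + betaPart k m n + gammaPart k n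

/- ### The adjoint action and its exponential -/

/-- `E₁ = ∑_{j=1}^{n-2} ⌊(j+1)/2⌋ e_{j,j+2}` in `sl_n`
(with `a = j - 1` as row index). -/
def matE₁ (k : Type*) [Field k] (n : ℕ) : Mat k n :=
  Matrix.of fun a b => if b.val = a.val + 2 then (((a.val + 2) / 2 : ℕ) : k) else 0

/-- `E₂ = e_{32} + e_{54} + ⋯ + e_{n,n-1}` in `sl_n`, `n` odd
(with row index `a` starting from `0`, hence even). -/
def matE₂ (k : Type*) [Field k] (n : ℕ) : Mat k n :=
  Matrix.of fun a b => if a.val = b.val + 1 ∧ Even a.val then 1 else 0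

/-- The action `X ⊗ 1 + 1 ⊗ X` of `X` on `kⁿ ⊗ kⁿ`. -/
def coprod {n : ℕ} (X : Mat k n) : Mat₂ k n := X ⊗ₖ (1 : Mat k n) + (1 : Mat k n) ⊗ₖ X

/-- The adjoint action of a matrix on tensors, `X.(A ⊗ B) = [X, A] ⊗ B + A ⊗ [X, B]`. -/
def adAct {n : ℕ} (X : Mat k n) : Module.End k (Mat₂ k n) :=
  LieAlgebra.ad k (Mat₂ k n) (coprod X)

/-- The operator `e^X` on tensors, for `X` acting nilpotently. -/
def expAct [CharZero k] {n : ℕ} (X : Mat k n) : Module.End k (Mat₂ k n) :=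
  IsNilpotent.exp (adAct X)

/- ### Orbits and their boundaries in projective space -/

/-- The adjoint action of `SL_n` on tensors. -/
def slAct {n : ℕ} (g : Matrix.SpecialLinearGroup (Fin n) k) (R : Mat₂ k n) : Mat₂ k n :=
  (g.val ⊗ₖ g.val) * R * ((g⁻¹).val ⊗ₖ (g⁻¹).val)

/-- The `SL_n`-orbit of (the line through) `R` in projective space. -/
def projOrbit {n : ℕ} (R : Mat₂ k n) : Set (Projectivization k (Mat₂ k n)) :=
  {p | ∃ (g : Matrix.SpecialLinearGroup (Fin n) k) (h : slAct g R ≠ 0),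
    p = Projectivization.mk k (slAct g R) h}

/-- The value at a tensor of a polynomial in its coordinates. -/
def evalAt {n : ℕ} (P : MvPolynomial ((Fin n × Fin n) × (Fin n × Fin n)) k) (R : Mat₂ k n) : k :=
  MvPolynomial.eval (fun p => R p.1 p.2) P

/-- Zariski closure in projective space: the common zeros of all homogeneous polynomials
that vanish on the set. -/
def zariskiClosure {n : ℕ} (S : Set (Projectivization k (Mat₂ k n))) :
    Set (Projectivization k (Mat₂ k n)) :=
  {p | ∀ (d : ℕ) (P : MvPolynomial ((Fin n × Fin n) × (Fin n × Fin n)) k), P.IsHomogeneous d →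
    (∀ q ∈ S, evalAt P q.rep = 0) → evalAt P p.rep = 0}

/-- The boundary of the orbit of `R` in projective space. -/
def orbitBoundary {n : ℕ} (R : Mat₂ k n) : Set (Projectivization k (Mat₂ k n)) :=
  zariskiClosure (projOrbit R) \ projOrbit R

/- ### Carriers, parabolic subalgebras and Frobenius functionals -/

/-- The map `ξ ↦ (ξ ⊗ 1) R` from functionals on `gl_n` to `gl_n`. For `R` in `sl_n ⊗ sl_n` it
depends only on the restriction of `ξ` to `sl_n`. -/
def contract {n : ℕ} (R : Mat₂ k n) : Module.Dual k (Mat k n) →ₗ[k] Mat k n where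
  toFun ξ := Matrix.of fun b l => ξ (Matrix.of fun a j => R (a, b) (j, l))
  map_add' ξ η := by ext b l; simp
  map_smul' c ξ := by ext b l; simp

theorem contract_kronecker {n : ℕ} (A B : Mat k n) (ξ : Module.Dual k (Mat k n)) :
    contract (A ⊗ₖ B) ξ = ξ A • B := by
  ext b l
  have h : (Matrix.of fun a j => (A ⊗ₖ B) (a, b) (j, l)) = B b l • A := by
    ext a j; simp [mul_comm]
  simp only [contract, LinearMap.coe_mk, AddHom.coe_mk, Matrix.of_apply, h, map_smul,
    Matrix.smul_apply, smul_eq_mul, mul_comm]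

/-- The carrier of `R`: the span of all `(ξ ⊗ 1) R`. -/
def carrier {n : ℕ} (R : Mat₂ k n) : Submodule k (Mat k n) := LinearMap.range (contract R)

/-- The maximal parabolic subalgebra `𝔭_{m,n}` of `sl_n`: the traceless matrices in the span of
the `e_{jl}` with `j ≤ m` or `m < l` (indices from `1`). -/
def maxParabolic (k : Type*) [Field k] (m n : ℕ) : LieSubalgebra k (Mat k n) where
  carrier := {X | X.trace = 0 ∧ ∀ j l : Fin n, m ≤ j.val → l.val < m → X j l = 0}
  zero_mem' := by simp
  add_mem' := by
    rintro X Y ⟨hX, hX'⟩ ⟨hY, hY'⟩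
    refine ⟨by simp [hX, hY], fun j l hj hl => ?_⟩
    simp [hX' j l hj hl, hY' j l hj hl]
  smul_mem' := by
    rintro c X ⟨hX, hX'⟩
    refine ⟨by simp [hX], fun j l hj hl => ?_⟩
    simp [hX' j l hj hl]
  lie_mem' := by
    rintro X Y ⟨hX, hX'⟩ ⟨hY, hY'⟩
    refine ⟨?_, fun j l hj hl => ?_⟩
    · rw [Ring.lie_def, Matrix.trace_sub, Matrix.trace_mul_comm, sub_self]
    · rw [Ring.lie_def, Matrix.sub_apply, Matrix.mul_apply, Matrix.mul_apply,
        Finset.sum_eq_zero, Finset.sum_eq_zero, sub_zero]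
      · intro i _
        rcases lt_or_ge i.val m with h | h
        · rw [hY' j i hj h, zero_mul]
        · rw [hX' i l h hl, mul_zero]
      · intro i _
        rcases lt_or_ge i.val m with h | h
        · rw [hX' j i hj h, zero_mul]
        · rw [hY' i l h hl, mul_zero]

/-- The skew form `(X, Y) ↦ φ([X, Y])` of a functional `φ` on a Lie algebra. -/
def lieForm {n : ℕ} (f : LieSubalgebra k (Mat k n)) (φ : Module.Dual k f) :
    LinearMap.BilinForm k f :=
  LinearMap.mk₂ k (fun X Y : f => φ ⁅X, Y⁆)
    (by intros; simp) (by intros; simp) (by intros; simp) (by intros; simp)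

/-- `φ` is the Frobenius functional on the carrier `f` of `R`: the form `φ([X, Y])` is
nondegenerate, and it is the form `⟨ř⁻¹ X, Y⟩` of `R`, where `ř : f* → f` is the isomorphism
`ξ ↦ (ξ ⊗ 1) R`. -/
def IsFrobeniusFunctionalOf {n : ℕ} (R : Mat₂ k n) (f : LieSubalgebra k (Mat k n))
    (φ : Module.Dual k f) : Prop :=
  (lieForm f φ).Nondegenerate ∧
  ∃ rCheck : Module.Dual k f ≃ₗ[k] f,
    (∀ ξ : Module.Dual k (Mat k n),
      (rCheck (ξ.domRestrict f.toSubmodule) : Mat k n) = contract R ξ) ∧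
    ∀ X Y : f, φ ⁅X, Y⁆ = rCheck.symm X Y

/-- The functional reading off the entry in row `i` and column `j`, counted from `1`. -/
def entryDual (k : Type*) [Field k] (n i j : ℕ) : Module.Dual k (Mat k n) :=
  ∑ a : Fin n, ∑ b : Fin n,
    if a.val + 1 = i ∧ b.val + 1 = j then Matrix.entryLinearMap k k a b else 0

/-- The coefficient of `e_{ii} - e_{i+1,i+1}` in the basis of `sl_n` formed by the `e_{jl}`
(`j ≠ l`) and the `e_{jj} - e_{j+1,j+1}`, namely `X ↦ X_{11} + ⋯ + X_{ii}`. -/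
def corootDual (k : Type*) [Field k] (n i : ℕ) : Module.Dual k (Mat k n) :=
  ∑ j ∈ Finset.Icc 1 i, entryDual k n j j

/-- `u⁻¹ (e₁₃* + ⋯ + e_{n-2,n}*) - t⁻¹ e_{n,n-1}* + t e_{n-1,n}* + 2 (e_{n-1,n-1} - e_{nn})*`
on `𝔭_{n-2,n}`. -/
def frobFunctional (n : ℕ) (u t : k) : Module.Dual k (maxParabolic k (n - 2) n) :=
  (u⁻¹ • ∑ i ∈ Finset.Icc 1 (n - 2), entryDual k n i (i + 2)
    - t⁻¹ • entryDual k n n (n - 1) + t • entryDual k n (n - 1) n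
    + (2 : k) • corootDual k n (n - 1)).domRestrict (maxParabolic k (n - 2) n).toSubmodule

end CremmerGervais

end

noncomputable section

namespace CremmerGervais

variable {k : Type*} [Field k]

/- ### Coefficients of operators on Laurent polynomials -/

/-! All tensors are handled as operators on Laurent polynomials. An operator preserving P_n gives a
tensor, and commutators with E₁ and E₂ become the adjoint action (`adAct_truncMatrix`). With r₀ =
¼(Δ + ξ₁Δξ₂) - (1/2n)(x₁∂₁ - x₂∂₂), one has r_{n-2,n} = r₀ + ½v₄ (`rCG_eq_truncMatrix`). The
relations [E₁,r₀] = v₁, [E₂,r₀] = v₂, [E₂,v₁] = v₃, [E₁,v₂] = ½v₃, [E₂,v₃] = v₄, with all other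
commutators of E₁, E₂ with the vᵢ zero, make the exponential series stop. They give the formula for
b = b_CG(u,t), and also b = e^{tE₂}.(u v₁ + t v₂).

Boundary. There is a grading in which E₁ and E₂ have weight 1, so r₀, v₁, v₂, v₃, v₄ have weights 0,
1, 1, 2, 3. Hence b is nilpotent on kⁿ ⊗ kⁿ, whereas r = r_{n-2,n} is not: x₁ is an eigenvector of
r² with nonzero eigenvalue. Nilpotency is invariant under conjugation and scaling, so [b] is not in
the orbit. For all but finitely many s the tensor b + s(r + t v₂) is s times a conjugate of r
(`exists_glAct_rCG_eq`), so a homogeneous polynomial vanishing on the orbit vanishes along this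
line, and in particular at s = 0.

Frobenius functional. Multiplication by x₁² commutes with v₂ and satisfies [v₁, x₁²] = σ - 1/n
(`opV₁_shift`), where σ is the tensor ∑ e_{ij} ⊗ e_{ji} of the trace form. If F is u⁻¹ times the
truncated multiplication by x², contracting u v₁ + t v₂ with Y ↦ tr(F[X,Y]) therefore returns X for
traceless X, up to errors at the two top exponents. For X in the parabolic these errors are
repaired, through v₂, by the extra term -t⁻¹e_{n-1,n} of F (`coeff_commutator`). Conjugation by 1 +
tE₂ passes from u v₁ + t v₂ to b and from F to the matrix of φ, up to a matrix whose functional is a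
character of the parabolic and so does not affect the form (`frobMatrix'_mul_unipotent`). Thus ř is
a left inverse of X ↦ φ([X,·]), which gives both the carrier and the Frobenius property.

Triangularity. Skewness and vanishing partial trace hold for r₀ and survive the adjoint action,
which puts b in sl_n ∧ sl_n. The form inverse to b is a coboundary, so the Yang–Baxter equation is
the Jacobi identity inside φ. For ut = 0 it follows because the Yang–Baxter expression is quadratic
in the coefficients of v₁ and v₂. -/

theorem mono_apply (j l a b : ℤ) :
    (mono j l : Laurent k) (a, b) = if j = a ∧ l = b then 1 else 0 := by
  simp [mono, Finsupp.single_apply]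

theorem hom_ext_mono {S T : Module.End k (Laurent k)}
    (h : ∀ j l, S (mono j l) = T (mono j l)) : S = T :=
  Finsupp.lhom_ext' fun p => LinearMap.ext_ring (h p.1 p.2)

/-- Formulas for the output coefficients at an arbitrary f compose by rewriting, so products of
operators need no expansion into monomials; linearity reduces each such formula to monomials. -/
theorem apply_eq_of_mono {S : Module.End k (Laurent k)} {φ : Laurent k →ₗ[k] k} {a b : ℤ}
    (h : ∀ j l, S (mono j l) (a, b) = φ (mono j l)) (f : Laurent k) : S f (a, b) = φ f := by
  have : (Finsupp.lapply (a, b)).comp S = φ :=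
    Finsupp.lhom_ext' fun p => LinearMap.ext_ring (h p.1 p.2)
  exact LinearMap.congr_fun this f

theorem mulX_apply (p q : ℤ) (f : Laurent k) (a b : ℤ) :
    mulX p q f (a, b) = f (a - p, b - q) := by
  refine apply_eq_of_mono (φ := Finsupp.lapply (a - p, b - q)) (fun j l => ?_) f
  simp only [mulX, ofMono_mono, mono_apply, Finsupp.lapply_apply]
  congr 1
  apply propext
  constructor <;> rintro ⟨_, _⟩ <;> constructor <;> omega

theorem xi₁_apply (f : Laurent k) (a b : ℤ) : xi₁ f (a, b) = (-1 : k) ^ a * f (a, b) := by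
  refine apply_eq_of_mono (φ := (-1 : k) ^ a • Finsupp.lapply (a, b)) (fun j l => ?_) f
  simp only [xi₁, ofMono_mono, Finsupp.smul_apply, mono_apply, LinearMap.smul_apply,
    Finsupp.lapply_apply, smul_eq_mul]
  by_cases h : j = a <;> simp [h]

theorem xi₂_apply (f : Laurent k) (a b : ℤ) : xi₂ f (a, b) = (-1 : k) ^ b * f (a, b) := by
  refine apply_eq_of_mono (φ := (-1 : k) ^ b • Finsupp.lapply (a, b)) (fun j l => ?_) f
  simp only [xi₂, ofMono_mono, Finsupp.smul_apply, mono_apply, LinearMap.smul_apply,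
    Finsupp.lapply_apply, smul_eq_mul]
  by_cases h : l = b <;> simp [h]

theorem pd₁_apply (f : Laurent k) (a b : ℤ) : pd₁ f (a, b) = ((a : k) + 1) * f (a + 1, b) := by
  refine apply_eq_of_mono (φ := ((a : k) + 1) • Finsupp.lapply (a + 1, b)) (fun j l => ?_) f
  simp only [pd₁, ofMono_mono, Finsupp.smul_apply, mono_apply, LinearMap.smul_apply,
    Finsupp.lapply_apply, smul_eq_mul]
  by_cases h : j = a + 1
  · simp [h]
  · rw [if_neg (by omega), if_neg (by omega)]; simp

theorem pd₂_apply (f : Laurent k) (a b : ℤ) : pd₂ f (a, b) = ((b : k) + 1) * f (a, b + 1) := by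
  refine apply_eq_of_mono (φ := ((b : k) + 1) • Finsupp.lapply (a, b + 1)) (fun j l => ?_) f
  simp only [pd₂, ofMono_mono, Finsupp.smul_apply, mono_apply, LinearMap.smul_apply,
    Finsupp.lapply_apply, smul_eq_mul]
  by_cases h : l = b + 1
  · simp [h]
  · rw [if_neg (by omega), if_neg (by omega)]; simp

theorem xi₂_mono (j l : ℤ) : (xi₂ (mono j l) : Laurent k) = (-1 : k) ^ l • mono j l :=
  ofMono_mono _ j l

/-- The sign of an integer, in `k`. -/
def sgn (k : Type*) [Field k] (x : ℤ) : k := ((Int.sign x : ℤ) : k)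

theorem sgn_pos {x : ℤ} (h : 0 < x) : sgn k x = 1 := by simp [sgn, Int.sign_eq_one_of_pos h]
theorem sgn_neg {x : ℤ} (h : x < 0) : sgn k x = -1 := by simp [sgn, Int.sign_eq_neg_one_of_neg h]
theorem sgn_zero : sgn k 0 = 0 := by simp [sgn]
theorem sgn_neg_arg (x : ℤ) : sgn k (-x) = -sgn k x := by simp [sgn]

/-- The two families of monomials cover the segment from j - d to j, each missing one end, so
interior exponents count twice and the two ends once. -/
theorem sum_range_mono_apply (j l a b : ℤ) (d : ℕ) :
    (∑ N ∈ Finset.range d, (mono (j - N) (l + N) + mono (j - 1 - N) (l + 1 + N)) : Laurent k) (a, b)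
      = if a + b = j + l then
          (if j - d < a ∧ a ≤ j then 1 else 0) + (if j - d ≤ a ∧ a < j then 1 else 0) else 0 := by
  induction d with
  | zero =>
    simp only [Finset.range_zero, Finset.sum_empty, Finsupp.coe_zero, Pi.zero_apply]
    split_ifs <;> first | omega | simp
  | succ d ih =>
    rw [Finset.sum_range_succ, Finsupp.add_apply, ih, Finsupp.add_apply, mono_apply, mono_apply]
    push_cast
    by_cases h : a + b = j + l
    · rw [if_pos h, if_pos h]
      have e1 : (j - (d : ℤ) = a ∧ l + d = b) ↔ a = j - d := by omega
      have e2 : (j - 1 - (d : ℤ) = a ∧ l + 1 + d = b) ↔ a = j - 1 - d := by omega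
      simp only [e1, e2]
      have key : ∀ (P Q R : Prop) [Decidable P] [Decidable Q] [Decidable R], (R ↔ P ∨ Q) →
          (P → ¬ Q) → (if R then (1 : k) else 0) = (if P then 1 else 0) + if Q then 1 else 0 := by
        intro P Q R _ _ _ h1 h2
        by_cases hP : P <;> by_cases hQ : Q <;> simp_all
      rw [key (j - d < a ∧ a ≤ j) (a = j - d) (j - ((d : ℤ) + 1) < a ∧ a ≤ j) (by omega) (by omega),
        key (j - d ≤ a ∧ a < j) (a = j - 1 - d) (j - ((d : ℤ) + 1) ≤ a ∧ a < j) (by omega)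
          (by omega)]
      ring
    · rw [if_neg h, if_neg h, if_neg (by omega), if_neg (by omega)]; simp

/-- A sum of two signs equals 2 in absolute value strictly between j and l, 1 at the ends and 0
outside. It also changes sign with the order of j and l, so it covers both sums defining Δ at once.
-/
theorem divDiff_mono_apply (j l a b : ℤ) :
    (divDiff (mono j l) : Laurent k) (a, b)
      = if a + b = j + l then sgn k (j - a) + sgn k (a - l) else 0 := by
  rw [divDiff, ofMono_mono, Finsupp.sub_apply, sum_range_mono_apply, sum_range_mono_apply]
  by_cases h : a + b = j + l
  · rw [if_pos h, if_pos (show a + b = l + j by omega), if_pos h]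
    have e1 : sgn k (j - a) = if a < j then 1 else if j < a then -1 else 0 := by
      split_ifs
      · exact sgn_pos (by omega)
      · exact sgn_neg (by omega)
      · rw [show j - a = 0 by omega, sgn_zero]
    have e2 : sgn k (a - l) = if l < a then 1 else if a < l then -1 else 0 := by
      split_ifs
      · exact sgn_pos (by omega)
      · exact sgn_neg (by omega)
      · rw [show a - l = 0 by omega, sgn_zero]
    rw [e1, e2]
    split_ifs <;> first | omega | norm_num
  · rw [if_neg h, if_neg (show ¬ a + b = l + j by omega), if_neg h]; simp

/-! ### Parity signs under shifts, and coefficients of E₁, E₂, v₂, v₃, v₄. -/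

theorem neg_one_zpow_add_one (x : ℤ) : (-1 : k) ^ (x + 1) = -(-1) ^ x := by
  rw [zpow_add₀ (by norm_num)]; norm_num

theorem neg_one_zpow_sub_one (x : ℤ) : (-1 : k) ^ (x - 1) = -(-1) ^ x := by
  have := neg_one_zpow_add_one (k := k) (x - 1)
  rw [sub_add_cancel] at this
  rw [this, neg_neg]

theorem neg_one_zpow_add_two (x : ℤ) : (-1 : k) ^ (x + 2) = (-1) ^ x := by
  rw [zpow_add₀ (by norm_num)]; norm_num

theorem opE₁_apply (f : Laurent k) (a b : ℤ) :
    opE₁ f (a, b) = ((1 / 2 : k) * (a + 2) - 1 / 4 * (1 - (-1) ^ a)) * f (a + 2, b)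
      + ((1 / 2 : k) * (b + 2) - 1 / 4 * (1 - (-1) ^ b)) * f (a, b + 2) := by
  simp only [opE₁, LinearMap.sub_apply, LinearMap.smul_apply, LinearMap.add_apply,
    Module.End.mul_apply, Finsupp.sub_apply, Finsupp.smul_apply, Finsupp.add_apply, mulX_apply,
    pd₁_apply, pd₂_apply, Module.End.one_apply, xi₁_apply, xi₂_apply, smul_eq_mul, sub_neg_eq_add, neg_one_zpow_add_two]
  have e1 : a + 1 + 1 = a + 2 := by ring
  have e2 : b + 1 + 1 = b + 2 := by ring
  simp only [sub_zero, e1, e2]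
  push_cast
  ring

theorem opE₂_apply (f : Laurent k) (a b : ℤ) :
    opE₂ f (a, b) = (1 / 2 : k) * (1 + (-1) ^ a) * f (a - 1, b)
      + (1 / 2 : k) * (1 + (-1) ^ b) * f (a, b - 1) := by
  simp only [opE₂, LinearMap.sub_apply, LinearMap.smul_apply, LinearMap.add_apply,
    Module.End.mul_apply, Finsupp.sub_apply, Finsupp.smul_apply, Finsupp.add_apply, mulX_apply,
    xi₁_apply, xi₂_apply, smul_eq_mul, neg_one_zpow_sub_one, sub_zero]
  ring

theorem opV₂_apply (n : ℕ) (f : Laurent k) (a b : ℤ) :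
    opV₂ n f (a, b) = (1 / 4 : k) *
      ((-(-1) ^ b + -(-1) ^ a * (-1) ^ b + 1 / n * (1 + (-1) ^ a)) * f (a - 1, b)
      + ((-1) ^ a + (-1) ^ a * (-1) ^ b - 1 / n * (1 + (-1) ^ b)) * f (a, b - 1)) := by
  simp only [opV₂, LinearMap.sub_apply, LinearMap.smul_apply, LinearMap.add_apply,
    Module.End.mul_apply, Finsupp.sub_apply, Finsupp.smul_apply, Finsupp.add_apply, mulX_apply,
    xi₁_apply, xi₂_apply, smul_eq_mul, neg_one_zpow_sub_one, sub_zero, Module.End.one_apply]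
  ring

theorem opV₃_apply (n : ℕ) (f : Laurent k) (a b : ℤ) :
    opV₃ n f (a, b) = (1 / 2 : k) *
      (((-1) ^ a * (1 + (-1) ^ b) - 1 / n * (1 + (-1) ^ b)) * f (a, b + 1)
      + (-(-1) ^ b * (1 + (-1) ^ a) + 1 / n * (1 + (-1) ^ a)) * f (a + 1, b)) := by
  simp only [opV₃, LinearMap.sub_apply, LinearMap.smul_apply, LinearMap.add_apply,
    Module.End.mul_apply, Finsupp.sub_apply, Finsupp.smul_apply, Finsupp.add_apply, mulX_apply,
    xi₁_apply, xi₂_apply, smul_eq_mul, sub_neg_eq_add, add_sub_cancel_right, sub_zero,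
    neg_one_zpow_add_one, Module.End.one_apply]
  ring

theorem opV₄_apply (f : Laurent k) (a b : ℤ) :
    opV₄ f (a, b) = (1 / 2 : k) * (1 + (-1) ^ a) * (1 + (-1) ^ b)
      * (f (a + 1, b - 1) - f (a - 1, b + 1)) := by
  simp only [opV₄, LinearMap.sub_apply, LinearMap.smul_apply, LinearMap.add_apply,
    Module.End.mul_apply, Finsupp.sub_apply, Finsupp.smul_apply, Finsupp.add_apply, mulX_apply,
    xi₁_apply, xi₂_apply, smul_eq_mul, sub_neg_eq_add, neg_one_zpow_add_one,
    neg_one_zpow_sub_one, Module.End.one_apply]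
  ring

/- ### Commutation relations -/

/-- The operators here and in the next five commutators do not involve Δ. Each output coefficient is
a combination of shifted coefficients of f whose factors are polynomial in a, b once the parities of
a and b are fixed. -/
theorem commutator_opE₂_opV₂ [CharZero k] (n : ℕ) : (opE₂ * opV₂ n - opV₂ n * opE₂ : Module.End k (Laurent k)) = 0 := by
  refine LinearMap.ext fun f => Finsupp.ext fun ⟨a, b⟩ => ?_
  simp only [LinearMap.sub_apply, Module.End.mul_apply, Finsupp.sub_apply,
    opE₂_apply, opV₂_apply, neg_one_zpow_sub_one, LinearMap.zero_apply, Finsupp.zero_apply]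
  rcases Int.even_or_odd a with ha | ha <;> rcases Int.even_or_odd b with hb | hb <;>
  simp only [ha.neg_one_zpow, hb.neg_one_zpow] <;> ring_nf

theorem commutator_opE₂_opV₃ [CharZero k] (n : ℕ) :
    (opE₂ * opV₃ n - opV₃ n * opE₂ : Module.End k (Laurent k)) = opV₄ := by
  refine LinearMap.ext fun f => Finsupp.ext fun ⟨a, b⟩ => ?_
  simp only [LinearMap.sub_apply, Module.End.mul_apply, Finsupp.sub_apply,
    opE₂_apply, opV₃_apply, opV₄_apply, neg_one_zpow_sub_one, neg_one_zpow_add_one]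
  rcases Int.even_or_odd a with ha | ha <;> rcases Int.even_or_odd b with hb | hb <;>
  simp only [ha.neg_one_zpow, hb.neg_one_zpow] <;> ring_nf

theorem commutator_opE₂_opV₄ [CharZero k] : (opE₂ * opV₄ - opV₄ * opE₂ : Module.End k (Laurent k)) = 0 := by
  refine LinearMap.ext fun f => Finsupp.ext fun ⟨a, b⟩ => ?_
  simp only [LinearMap.sub_apply, Module.End.mul_apply, Finsupp.sub_apply,
    opE₂_apply, opV₄_apply, neg_one_zpow_sub_one, neg_one_zpow_add_one, LinearMap.zero_apply,
    Finsupp.zero_apply]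
  rcases Int.even_or_odd a with ha | ha <;> rcases Int.even_or_odd b with hb | hb <;>
  simp only [ha.neg_one_zpow, hb.neg_one_zpow] <;> ring_nf

theorem commutator_opE₁_opV₂ [CharZero k] (n : ℕ) :
    (opE₁ * opV₂ n - opV₂ n * opE₁ : Module.End k (Laurent k)) = (1 / 2 : k) • opV₃ n := by
  refine LinearMap.ext fun f => Finsupp.ext fun ⟨a, b⟩ => ?_
  simp only [LinearMap.sub_apply, Module.End.mul_apply, Finsupp.sub_apply,
    opE₁_apply, opV₂_apply, opV₃_apply, neg_one_zpow_sub_one,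
    LinearMap.smul_apply, Finsupp.smul_apply, smul_eq_mul, neg_one_zpow_add_two]
  rcases Int.even_or_odd a with ha | ha <;> rcases Int.even_or_odd b with hb | hb <;>
  simp only [ha.neg_one_zpow, hb.neg_one_zpow] <;> push_cast <;> ring_nf

theorem commutator_opE₁_opV₃ [CharZero k] (n : ℕ) : (opE₁ * opV₃ n - opV₃ n * opE₁ : Module.End k (Laurent k)) = 0 := by
  refine LinearMap.ext fun f => Finsupp.ext fun ⟨a, b⟩ => ?_
  simp only [LinearMap.sub_apply, Module.End.mul_apply, Finsupp.sub_apply,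
    opE₁_apply, opV₃_apply, neg_one_zpow_add_one, LinearMap.zero_apply,
    Finsupp.zero_apply, neg_one_zpow_add_two]
  rcases Int.even_or_odd a with ha | ha <;> rcases Int.even_or_odd b with hb | hb <;>
  simp only [ha.neg_one_zpow, hb.neg_one_zpow] <;> push_cast <;> ring_nf

theorem commutator_opE₁_opV₄ [CharZero k] : (opE₁ * opV₄ - opV₄ * opE₁ : Module.End k (Laurent k)) = 0 := by
  refine LinearMap.ext fun f => Finsupp.ext fun ⟨a, b⟩ => ?_
  simp only [LinearMap.sub_apply, Module.End.mul_apply, Finsupp.sub_apply,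
    opE₁_apply, opV₄_apply, neg_one_zpow_sub_one, neg_one_zpow_add_one, LinearMap.zero_apply,
    Finsupp.zero_apply, neg_one_zpow_add_two]
  rcases Int.even_or_odd a with ha | ha <;> rcases Int.even_or_odd b with hb | hb <;>
  simp only [ha.neg_one_zpow, hb.neg_one_zpow] <;> push_cast <;> ring_nf

/-! ### Sign and parity identities. -/

theorem sgn_add_one (x : ℤ) :
    sgn k (x + 1) = sgn k x + (if x = 0 then 1 else 0) + if x = -1 then 1 else 0 := by
  rcases (by omega : x < -1 ∨ x = -1 ∨ x = 0 ∨ 0 < x) with h | rfl | rfl | h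
  · rw [sgn_neg (by omega), sgn_neg (by omega), if_neg (by omega), if_neg (by omega)]; simp
  · simp [sgn]
  · simp [sgn]
  · rw [sgn_pos (by omega), sgn_pos (by omega), if_neg (by omega), if_neg (by omega)]; simp

/-- This is |x| - |x - 2| = 2 sgn(x - 1) on the integers. It turns the linear coefficients of E₁
into the shifted signs of `opW`. -/
theorem mul_sgn_sub_mul_sgn (x : ℤ) :
    (x : k) * sgn k x - ((x : k) - 2) * sgn k (x - 2) = 2 * sgn k (x - 1) := by
  rcases (by omega : x < 1 ∨ x = 1 ∨ 1 < x) with h | rfl | h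
  · rcases (by omega : x < 0 ∨ x = 0) with h | rfl
    · rw [sgn_neg (by omega), sgn_neg (by omega), sgn_neg (by omega)]; ring
    · have h2 : (0 : ℤ) - 2 < 0 := by norm_num
      have h1 : (0 : ℤ) - 1 < 0 := by norm_num
      rw [sgn_neg h1, sgn_neg h2]; simp
  · norm_num [sgn]
  · rcases (by omega : 2 < x ∨ x = 2) with h | rfl
    · rw [sgn_pos (by omega), sgn_pos (by omega), sgn_pos (by omega)]; ring
    · rw [sgn_pos two_pos, sgn_pos (by norm_num : (0 : ℤ) < 2 - 1)]; norm_num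

theorem neg_one_zpow_of_even_sub {x y : ℤ} (h : Even (x - y)) : (-1 : k) ^ x = (-1) ^ y := by
  rw [← sub_add_cancel x y, zpow_add₀ (by norm_num), h.neg_one_zpow, one_mul]

theorem neg_one_zpow_of_odd_sub {x y : ℤ} (h : Odd (x - y)) : (-1 : k) ^ x = -(-1) ^ y := by
  rw [← sub_add_cancel x y, zpow_add₀ (by norm_num), h.neg_one_zpow, neg_one_mul]

theorem neg_one_zpow_of_add_even {a b j l : ℤ} (h : Even (a + b + j + l)) :
    (-1 : k) ^ b = (-1) ^ a * (-1) ^ j * (-1) ^ l := by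
  rcases Int.even_or_odd a with ha | ha <;> rcases Int.even_or_odd j with hj | hj <;>
  rcases Int.even_or_odd l with hl | hl <;>
  simp only [ha.neg_one_zpow, hj.neg_one_zpow, hl.neg_one_zpow] <;>
  first
  | rw [Even.neg_one_zpow (by grind)]; norm_num
  | rw [Odd.neg_one_zpow (by grind)]; norm_num

theorem neg_one_zpow_of_add_odd {a b j l : ℤ} (h : Odd (a + b + j + l)) :
    (-1 : k) ^ b = -((-1) ^ a * (-1) ^ j * (-1) ^ l) := by
  have := neg_one_zpow_of_add_even (k := k) (a := a) (b := b + 1) (j := j) (l := l) (by grind)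
  rw [← this, neg_one_zpow_add_one, neg_neg]

theorem neg_one_zpow_add_mul_ite (a j : ℤ) :
    ((-1 : k) ^ j + (-1) ^ a) * (if j = a + 1 then 1 else 0) = 0 := by
  split_ifs with h
  · rw [h, neg_one_zpow_add_one]; ring
  · simp

theorem opE₁_mono (j l : ℤ) : (opE₁ (mono j l) : Laurent k)
    = ((1 / 2 : k) * j - 1 / 4 * (1 - (-1) ^ j)) • mono (j - 2) l
      + ((1 / 2 : k) * l - 1 / 4 * (1 - (-1) ^ l)) • mono j (l - 2) := by
  refine Finsupp.ext fun ⟨a, b⟩ => ?_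
  simp only [opE₁_apply, Finsupp.add_apply, Finsupp.smul_apply, mono_apply, smul_eq_mul]
  congr 1
  · by_cases h : j = a + 2 ∧ l = b
    · obtain ⟨rfl, rfl⟩ := h
      simp [neg_one_zpow_add_two]
    · rw [if_neg h, if_neg (by omega)]; simp
  · by_cases h : j = a ∧ l = b + 2
    · obtain ⟨rfl, rfl⟩ := h
      simp [neg_one_zpow_add_two]
    · rw [if_neg h, if_neg (by omega)]; simp

theorem opE₂_mono (j l : ℤ) : (opE₂ (mono j l) : Laurent k)
    = ((1 / 2 : k) * (1 - (-1) ^ j)) • mono (j + 1) l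
      + ((1 / 2 : k) * (1 - (-1) ^ l)) • mono j (l + 1) := by
  refine Finsupp.ext fun ⟨a, b⟩ => ?_
  simp only [opE₂_apply, Finsupp.add_apply, Finsupp.smul_apply, mono_apply, smul_eq_mul]
  congr 1
  · by_cases h : j = a - 1 ∧ l = b
    · obtain ⟨rfl, rfl⟩ := h
      simp [neg_one_zpow_sub_one]
    · rw [if_neg h, if_neg (by omega)]; simp
  · by_cases h : j = a ∧ l = b - 1
    · obtain ⟨rfl, rfl⟩ := h
      simp [neg_one_zpow_sub_one]
    · rw [if_neg h, if_neg (by omega)]; simp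

/-- `Δ + ξ₁Δξ₂`. -/
def opP : Module.End k (Laurent k) := divDiff + xi₁ * divDiff * xi₂

/-- `x₁∂₁ - x₂∂₂`. -/
def opD : Module.End k (Laurent k) := mulX 1 0 * pd₁ - mulX 0 1 * pd₂

/-- `(x₁x₂)⁻¹ (Δ - ξ₁Δξ₂ + ξ₁ - ξ₂)`. -/
def opW : Module.End k (Laurent k) :=
  mulX (-1) (-1) * (divDiff - xi₁ * divDiff * xi₂ + xi₁ - xi₂)

/-- `2 (x₁⁻¹∂₁ - x₂⁻¹∂₂) - x₁⁻² (1 - ξ₁) + x₂⁻² (1 - ξ₂)`. -/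
def opU : Module.End k (Laurent k) :=
  (2 : k) • (mulX (-1) 0 * pd₁ - mulX 0 (-1) * pd₂)
      - mulX (-2) 0 * (1 - xi₁) + mulX 0 (-2) * (1 - xi₂)

/-- The weight zero part of the Cremmer–Gervais `r`-matrix, as an operator. -/
def opR₀ (n : ℕ) : Module.End k (Laurent k) := (1 / 4 : k) • opP - (1 / (2 * n) : k) • opD

theorem opV₁_eq (n : ℕ) : (opV₁ n : Module.End k (Laurent k))
    = (1 / 4 : k) • opW - (1 / (4 * n) : k) • opU := rfl

/-- Conjugating by the ξ's multiplies the coefficient of Δ by (-1)^{a+l}, so the sum doubles the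
terms with a ≡ l mod 2 and drops the others. -/
theorem opP_mono_apply (j l a b : ℤ) : (opP (mono j l) : Laurent k) (a, b)
    = if a + b = j + l then (1 + (-1) ^ a * (-1) ^ l) * (sgn k (j - a) + sgn k (a - l)) else 0 := by
  simp only [opP, LinearMap.add_apply, Module.End.mul_apply, Finsupp.add_apply, xi₁_apply,
    xi₂_mono, map_smul, Finsupp.smul_apply, divDiff_mono_apply, smul_eq_mul]
  split_ifs <;> ring

theorem opW_mono_apply (j l a b : ℤ) : (opW (mono j l) : Laurent k) (a, b)
    = if a + b + 2 = j + l then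
        (1 + (-1) ^ a * (-1) ^ l) * (sgn k (j - a - 1) + sgn k (a + 1 - l))
          + ((-1) ^ j - (-1) ^ l) * (if j = a + 1 then 1 else 0) else 0 := by
  simp only [opW, LinearMap.add_apply, LinearMap.sub_apply, Module.End.mul_apply,
    Finsupp.add_apply, Finsupp.sub_apply, xi₁_apply, mulX_apply, sub_neg_eq_add,
    xi₂_mono, map_smul, Finsupp.smul_apply, divDiff_mono_apply, smul_eq_mul, mono_apply,
    neg_one_zpow_add_one]
  by_cases h : a + b + 2 = j + l
  · rw [if_pos h, if_pos (by omega)]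
    by_cases h' : j = a + 1
    · obtain rfl : l = b + 1 := by omega
      subst h'
      simp only [if_true, and_self, neg_one_zpow_add_one]
      ring_nf
    · rw [if_neg h', if_neg (by omega), show j - a - 1 = j - (a + 1) by ring]; ring
  · rw [if_neg h, if_neg (by omega), if_neg (by omega)]; ring

theorem opD_apply (f : Laurent k) (a b : ℤ) : opD f (a, b) = ((a : k) - b) * f (a, b) := by
  simp only [opD, LinearMap.sub_apply, Module.End.mul_apply, Finsupp.sub_apply, mulX_apply,
    pd₁_apply, pd₂_apply, sub_zero, sub_add_cancel]
  push_cast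
  ring

theorem opU_apply (f : Laurent k) (a b : ℤ) :
    opU f (a, b) = (2 * ((a : k) + 2) - (1 - (-1) ^ a)) * f (a + 2, b)
      - (2 * ((b : k) + 2) - (1 - (-1) ^ b)) * f (a, b + 2) := by
  have e1 : a + 1 + 1 = a + 2 := by ring
  have e2 : b + 1 + 1 = b + 2 := by ring
  simp only [opU, LinearMap.sub_apply, LinearMap.smul_apply, LinearMap.add_apply,
    Module.End.mul_apply, Finsupp.sub_apply, Finsupp.smul_apply, Finsupp.add_apply, mulX_apply,
    pd₁_apply, pd₂_apply, Module.End.one_apply, xi₁_apply, xi₂_apply, smul_eq_mul, sub_neg_eq_add,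
    neg_one_zpow_add_two, sub_zero, e1, e2]
  push_cast
  ring

/-! ### Commutators of E₁ and E₂ with the pieces of r₀ and v₁. -/

theorem commutator_opE₁_opD [CharZero k] :
    (opE₁ * opD - opD * opE₁ : Module.End k (Laurent k)) = (1 / 2 : k) • opU := by
  refine LinearMap.ext fun f => Finsupp.ext fun ⟨a, b⟩ => ?_
  simp only [LinearMap.sub_apply, Module.End.mul_apply, Finsupp.sub_apply, opE₁_apply, opD_apply,
    opU_apply, LinearMap.smul_apply, Finsupp.smul_apply, smul_eq_mul]
  push_cast
  ring

theorem commutator_opE₁_opU [CharZero k] :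
    (opE₁ * opU - opU * opE₁ : Module.End k (Laurent k)) = 0 := by
  refine LinearMap.ext fun f => Finsupp.ext fun ⟨a, b⟩ => ?_
  simp only [LinearMap.sub_apply, Module.End.mul_apply, Finsupp.sub_apply, opE₁_apply,
    opU_apply, neg_one_zpow_add_two, LinearMap.zero_apply, Finsupp.zero_apply]
  push_cast
  ring_nf

theorem commutator_opE₂_opD [CharZero k] :
    (opE₂ * opD - opD * opE₂ : Module.End k (Laurent k))
      = (-1 / 2 : k) • (mulX 1 0 * (1 - xi₁) - mulX 0 1 * (1 - xi₂)) := by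
  refine LinearMap.ext fun f => Finsupp.ext fun ⟨a, b⟩ => ?_
  simp only [LinearMap.sub_apply, Module.End.mul_apply, Finsupp.sub_apply, opE₂_apply, opD_apply,
    LinearMap.smul_apply, Finsupp.smul_apply, smul_eq_mul, mulX_apply, xi₁_apply, xi₂_apply,
    Module.End.one_apply, sub_zero, neg_one_zpow_sub_one]
  push_cast
  ring

theorem commutator_opE₂_opU [CharZero k] :
    (opE₂ * opU - opU * opE₂ : Module.End k (Laurent k))
      = (-2 : k) • (mulX (-1) (-1) * (mulX 0 1 * (1 - xi₁) - mulX 1 0 * (1 - xi₂))) := by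
  refine LinearMap.ext fun f => Finsupp.ext fun ⟨a, b⟩ => ?_
  simp only [LinearMap.sub_apply, Module.End.mul_apply, Finsupp.sub_apply, opE₂_apply, opU_apply,
    LinearMap.smul_apply, Finsupp.smul_apply, smul_eq_mul, mulX_apply, xi₁_apply, xi₂_apply,
    Module.End.one_apply, sub_zero, neg_one_zpow_sub_one, sub_neg_eq_add, add_sub_cancel_right,
    neg_one_zpow_add_one, neg_one_zpow_add_two]
  push_cast
  rcases Int.even_or_odd a with ha | ha <;> rcases Int.even_or_odd b with hb | hb <;>
  simp only [ha.neg_one_zpow, hb.neg_one_zpow] <;> ring_nf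

/-- Only one total degree contributes, so b and its parity are determined by a, j, l. The linear
parts of the coefficients of E₁ produce differences |x| - |x - 2| in j - a and in a + 2 - l. Their
parity parts leave a correction at j = a + 1, which accounts for the term ξ₁ - ξ₂ of `opW`. -/
theorem commutator_opE₁_opP [CharZero k] :
    (opE₁ * opP - opP * opE₁ : Module.End k (Laurent k)) = opW := by
  refine hom_ext_mono fun j l => Finsupp.ext fun ⟨a, b⟩ => ?_
  simp only [LinearMap.sub_apply, Module.End.mul_apply, Finsupp.sub_apply, opE₁_apply, opE₁_mono,
    map_add, map_smul, Finsupp.add_apply, Finsupp.smul_apply, opP_mono_apply, opW_mono_apply,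
    smul_eq_mul, neg_one_zpow_add_two]
  by_cases h : a + b + 2 = j + l
  swap
  · rw [if_neg (by omega), if_neg (by omega), if_neg (by omega), if_neg (by omega), if_neg h]
    ring
  rw [if_pos (by omega), if_pos (by omega), if_pos (by omega), if_pos (by omega), if_pos h]
  have hl : (-1 : k) ^ (l - 2) = (-1) ^ l := by
    rw [← neg_one_zpow_add_two (l - 2), sub_add_cancel]
  obtain rfl : b = j + l - 2 - a := by omega
  have hb : (-1 : k) ^ (j + l - 2 - a) = (-1) ^ a * (-1) ^ j * (-1) ^ l :=
    neg_one_zpow_of_add_even (by grind)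
  have hA := mul_sgn_sub_mul_sgn (k := k) (j - a)
  have hC := mul_sgn_sub_mul_sgn (k := k) (a + 2 - l)
  rw [show j - (a + 2) = j - a - 2 by ring, show j - 2 - a = j - a - 2 by ring,
    show a - (l - 2) = a + 2 - l by ring, hl, hb]
  rw [show a + 2 - l - 2 = a - l by ring, show a + 2 - l - 1 = a + 1 - l by ring] at hC
  -- For even j - a the parity factor vanishes; for odd j - a the two signs differ only at j - a =
  -- 1.
  have hδ : ((-1 : k) ^ a - (-1) ^ j) * (sgn k (j - a - 2) - sgn k (j - a)
      + 2 * if j = a + 1 then 1 else 0) = 0 := by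
    rcases Int.even_or_odd (j - a) with h' | h'
    · rw [neg_one_zpow_of_even_sub h']; ring
    · rcases (by grind : j - a < 0 ∨ j - a = 1 ∨ 2 < j - a) with h' | h' | h'
      · rw [sgn_neg (by omega), sgn_neg (by omega), if_neg (by omega)]; ring
      · rw [if_pos (by omega), h']; norm_num [sgn]
      · rw [sgn_pos (by omega), sgn_pos (by omega), if_neg (by omega)]; ring
  have hδ' := neg_one_zpow_add_mul_ite (k := k) a j
  push_cast at hA hC ⊢
  rcases Int.even_or_odd a with ha | ha <;> rcases Int.even_or_odd l with hb | hb <;>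
  simp only [ha.neg_one_zpow, hb.neg_one_zpow] at hδ hδ' ⊢ <;>
  first
  | linear_combination hA + hC + 1 / 2 * hδ
  | linear_combination -hδ'

/-- E₂ shifts an exponent by one, and sgn x changes between x and x + 1 only at x = 0 and x = -1.
These jumps are the delta terms making up the multiplication operators on the right. -/
theorem commutator_opE₂_opP [CharZero k] :
    (opE₂ * opP - opP * opE₂ : Module.End k (Laurent k))
      = mulX 0 1 * xi₁ - mulX 1 0 * xi₂ + (mulX 1 0 - mulX 0 1) * xi₁ * xi₂ := by
  refine hom_ext_mono fun j l => Finsupp.ext fun ⟨a, b⟩ => ?_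
  simp only [LinearMap.sub_apply, LinearMap.add_apply, Module.End.mul_apply, Finsupp.sub_apply,
    opE₂_apply, opE₂_mono, map_add, map_smul, Finsupp.add_apply, Finsupp.smul_apply,
    opP_mono_apply, smul_eq_mul, neg_one_zpow_sub_one, mulX_apply, xi₁_apply, xi₂_apply, mono_apply,
    sub_zero, neg_one_zpow_add_one]
  by_cases h : a + b = j + l + 1
  swap
  · rw [if_neg (by omega), if_neg (by omega), if_neg (by omega), if_neg (by omega),
      if_neg (by omega), if_neg (by omega)]
    ring
  rw [if_pos (by omega), if_pos (by omega), if_pos (by omega), if_pos (by omega)]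
  have hb : (-1 : k) ^ b = -((-1) ^ a * (-1) ^ j * (-1) ^ l) :=
    neg_one_zpow_of_add_odd (by grind)
  have e1 : (j = a ∧ l = b - 1) ↔ j - a = 0 := by omega
  have e2 : (j = a - 1 ∧ l = b) ↔ j - a = -1 := by omega
  simp only [e1, e2, hb]
  rw [show j - (a - 1) = j - a + 1 by ring, show j + 1 - a = j - a + 1 by ring,
    show a - (l + 1) = a - 1 - l by ring, sgn_add_one (j - a)]
  have h1 : ((-1 : k) ^ j - (-1) ^ a) * (if j - a = 0 then 1 else 0) = 0 := by
    split_ifs with h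
    · rw [show j = a by omega]; ring
    · simp
  have h2 : ((-1 : k) ^ j + (-1) ^ a) * (if j - a = -1 then 1 else 0) = 0 := by
    split_ifs with h
    · rw [show a = j + 1 by omega, neg_one_zpow_add_one]; ring
    · simp
  rcases Int.even_or_odd a with ha | ha <;> rcases Int.even_or_odd l with hl | hl <;>
  rcases Int.even_or_odd j with hj | hj <;>
  simp only [ha.neg_one_zpow, hl.neg_one_zpow, hj.neg_one_zpow] at h1 h2 ⊢ <;> norm_num at h1 h2 ⊢
  all_goals simp only [*] 
  all_goals split_ifs <;> first | contradiction | ring1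

theorem commutator_opE₂_opW [CharZero k] :
    (opE₂ * opW - opW * opE₂ : Module.End k (Laurent k))
      = (2 : k) • (mulX (-1) (-1) * (mulX 1 0 * xi₁ - mulX 0 1 * xi₂
          - (mulX 1 0 - mulX 0 1) * xi₁ * xi₂)) := by
  refine hom_ext_mono fun j l => Finsupp.ext fun ⟨a, b⟩ => ?_
  simp only [LinearMap.sub_apply, LinearMap.smul_apply, Module.End.mul_apply, Finsupp.sub_apply,
    opE₂_apply, opE₂_mono, map_add, map_smul, Finsupp.add_apply, Finsupp.smul_apply,
    opW_mono_apply, smul_eq_mul, neg_one_zpow_sub_one, mulX_apply, xi₁_apply, xi₂_apply, mono_apply,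
    sub_zero, neg_one_zpow_add_one, sub_neg_eq_add, add_sub_cancel_right]
  by_cases h : a + b + 1 = j + l
  swap
  · rw [if_neg (show ¬ a - 1 + b + 2 = j + l by omega),
      if_neg (show ¬ a + (b - 1) + 2 = j + l by omega),
      if_neg (show ¬ a + b + 2 = j + 1 + l by omega),
      if_neg (show ¬ a + b + 2 = j + (l + 1) by omega),
      if_neg (show ¬ (j = a ∧ l = b + 1) by omega), if_neg (show ¬ (j = a + 1 ∧ l = b) by omega)]
    ring
  rw [if_pos (show a - 1 + b + 2 = j + l by omega), if_pos (show a + (b - 1) + 2 = j + l by omega),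
    if_pos (show a + b + 2 = j + 1 + l by omega), if_pos (show a + b + 2 = j + (l + 1) by omega)]
  have hb : (-1 : k) ^ b = -((-1) ^ a * (-1) ^ j * (-1) ^ l) :=
    neg_one_zpow_of_add_odd (by grind)
  have e1 : (j = a ∧ l = b + 1) ↔ j = a := by omega
  have e2 : (j = a + 1 ∧ l = b) ↔ j = a + 1 := by omega
  have e3 : j = a - 1 + 1 ↔ j = a := by omega
  have e4 : j + 1 = a + 1 ↔ j = a := by omega
  simp only [e1, e2, e3, e4, hb]
  have hs := sgn_add_one (k := k) (j - a - 1)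
  have e5 : j - a - 1 = 0 ↔ j = a + 1 := by omega
  have e6 : j - a - 1 = -1 ↔ j = a := by omega
  simp only [sub_add_cancel, e5, e6] at hs
  rw [show j - (a - 1) - 1 = j - a by ring, show a - 1 + 1 - l = a - l by ring,
    show a + 1 - (l + 1) = a - l by ring, show j + 1 - a - 1 = j - a by ring, hs]
  have h1 : ((-1 : k) ^ j - (-1) ^ a) * (if j = a then 1 else 0) = 0 := by
    split_ifs with h
    · rw [h]; ring
    · simp
  have h2 := neg_one_zpow_add_mul_ite (k := k) a j
  rcases Int.even_or_odd a with ha | ha <;> rcases Int.even_or_odd l with hl | hl <;>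
  rcases Int.even_or_odd j with hj | hj <;>
  simp only [ha.neg_one_zpow, hl.neg_one_zpow, hj.neg_one_zpow] at h1 h2 ⊢ <;> norm_num at h1 h2 ⊢
  all_goals simp only [*]
  all_goals split_ifs <;> first | contradiction | ring1

/-- This stops the series of e^{uE₁} at r₀ after the linear term. The relevant signs differ only
near the diagonal. At even distance the one exceptional position has a vanishing linear factor; for
odd j - a the exceptional positions j = a + 1 and j = a + 3 are compensated by the delta term of
`opW`. -/
theorem commutator_opE₁_opW [CharZero k] :
    (opE₁ * opW - opW * opE₁ : Module.End k (Laurent k)) = 0 := by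
  refine hom_ext_mono fun j l => Finsupp.ext fun ⟨a, b⟩ => ?_
  simp only [LinearMap.sub_apply, Module.End.mul_apply, Finsupp.sub_apply, opE₁_apply, opE₁_mono,
    map_add, map_smul, Finsupp.add_apply, Finsupp.smul_apply, opW_mono_apply,
    smul_eq_mul, neg_one_zpow_add_two, LinearMap.zero_apply, Finsupp.zero_apply]
  by_cases h : a + b + 4 = j + l
  swap
  · rw [if_neg (show ¬ a + 2 + b + 2 = j + l by omega),
      if_neg (show ¬ a + (b + 2) + 2 = j + l by omega),
      if_neg (show ¬ a + b + 2 = j - 2 + l by omega),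
      if_neg (show ¬ a + b + 2 = j + (l - 2) by omega)]
    ring
  rw [if_pos (show a + 2 + b + 2 = j + l by omega), if_pos (show a + (b + 2) + 2 = j + l by omega),
    if_pos (show a + b + 2 = j - 2 + l by omega), if_pos (show a + b + 2 = j + (l - 2) by omega)]
  have hl (x : ℤ) : (-1 : k) ^ (x - 2) = (-1) ^ x := by
    rw [← neg_one_zpow_add_two (x - 2), sub_add_cancel]
  have hb : (-1 : k) ^ b = (-1) ^ a * (-1) ^ j * (-1) ^ l :=
    neg_one_zpow_of_add_even (by grind)
  have hbk : (b : k) = j + l - a - 4 := by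
    have : ((a + b + 4 : ℤ) : k) = ((j + l : ℤ) : k) := by rw [h]
    push_cast at this
    linear_combination this
  have e1 : j = a + 2 + 1 ↔ j = a + 3 := by omega
  have e2 : j - 2 = a + 1 ↔ j = a + 3 := by omega
  rw [show j - (a + 2) - 1 = j - a - 3 by ring, show j - 2 - a - 1 = j - a - 3 by ring,
    show a + 1 - (l - 2) = a + 3 - l by ring, show a + 2 + 1 - l = a + 3 - l by ring]
  simp only [e1, e2, hl, hb, hbk]
  have hC : (1 + (-1 : k) ^ a * (-1) ^ l) * (((a : k) + 2 - l) * (sgn k (a + 3 - l)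
      - sgn k (a + 1 - l))) = 0 := by
    rcases Int.even_or_odd (a - l) with h' | h'
    · rcases (by grind : a - l < -2 ∨ a - l = -2 ∨ 0 ≤ a - l) with h' | h' | h'
      · rw [sgn_neg (by grind), sgn_neg (by omega)]; ring
      · obtain rfl : l = a + 2 := by omega
        push_cast; ring
      · rw [sgn_pos (by omega), sgn_pos (by omega)]; ring
    · rw [neg_one_zpow_of_odd_sub h', neg_mul, ← zpow_add₀ (by norm_num), Even.neg_one_zpow]
      · ring
      · simp
  rcases Int.even_or_odd (j - a) with hx | hx
  · have hx' := neg_one_zpow_of_even_sub (k := k) hx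
    obtain ⟨c, hc⟩ := hx
    rw [if_neg (show j ≠ a + 3 by omega), if_neg (show j ≠ a + 1 by omega), hx']
    have hA : ((j : k) - a - 2) * (sgn k (j - a - 1) - sgn k (j - a - 3)) = 0 := by
      rcases (by omega : j - a ≤ 0 ∨ j = a + 2 ∨ 3 < j - a) with h' | rfl | h'
      · rw [sgn_neg (by omega), sgn_neg (by omega)]; ring
      · push_cast; ring
      · rw [sgn_pos (by omega), sgn_pos (by omega)]; ring
    rcases Int.even_or_odd a with ha | ha <;> rcases Int.even_or_odd l with hl | hl <;>
    simp only [ha.neg_one_zpow, hl.neg_one_zpow] at hC ⊢ <;>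
    first
    | linear_combination hA + 1 / 2 * hC
    | ring
  · have hx' := neg_one_zpow_of_odd_sub (k := k) hx
    rw [hx']
    rcases (by omega : j - a < 1 ∨ j = a + 1 ∨ j = a + 2 ∨ j = a + 3 ∨ 3 < j - a)
      with h' | rfl | rfl | rfl | h'
    · rw [sgn_neg (show j - a - 3 < 0 by omega), sgn_neg (show j - a - 1 < 0 by omega),
        if_neg (show j ≠ a + 3 by omega), if_neg (show j ≠ a + 1 by omega)]
      rcases Int.even_or_odd a with ha | ha <;> rcases Int.even_or_odd l with hl | hl <;>
      simp only [ha.neg_one_zpow, hl.neg_one_zpow] at hC ⊢ <;> linear_combination 1 / 2 * hC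
    · rw [show a + 1 - a - 1 = 0 by ring, sgn_zero, sgn_neg (show a + 1 - a - 3 < 0 by omega),
        if_neg (show a + 1 ≠ a + 3 by omega), if_pos rfl]
      push_cast
      rcases Int.even_or_odd a with ha | ha <;> rcases Int.even_or_odd l with hl | hl <;>
      simp only [ha.neg_one_zpow, hl.neg_one_zpow] at hC ⊢ <;> linear_combination 1 / 2 * hC
    · exact absurd hx (by grind)
    · rw [show a + 3 - a - 3 = 0 by ring, sgn_zero, sgn_pos (show 0 < a + 3 - a - 1 by omega),
        if_neg (show a + 3 ≠ a + 1 by omega), if_pos rfl]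
      push_cast
      rcases Int.even_or_odd a with ha | ha <;> rcases Int.even_or_odd l with hl | hl <;>
      simp only [ha.neg_one_zpow, hl.neg_one_zpow] at hC ⊢ <;> linear_combination 1 / 2 * hC
    · rw [sgn_pos (show 0 < j - a - 3 by omega), sgn_pos (show 0 < j - a - 1 by omega),
        if_neg (show j ≠ a + 3 by omega), if_neg (show j ≠ a + 1 by omega)]
      rcases Int.even_or_odd a with ha | ha <;> rcases Int.even_or_odd l with hl | hl <;>
      simp only [ha.neg_one_zpow, hl.neg_one_zpow] at hC ⊢ <;> linear_combination 1 / 2 * hC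

theorem commutator_opE₁_opR₀ [CharZero k] (n : ℕ) :
    (opE₁ * opR₀ n - opR₀ n * opE₁ : Module.End k (Laurent k)) = opV₁ n := by
  have h : (opE₁ * opR₀ n - opR₀ n * opE₁ : Module.End k (Laurent k))
      = (1 / 4 : k) • (opE₁ * opP - opP * opE₁) - (1 / (2 * n) : k) • (opE₁ * opD - opD * opE₁) := by
    refine LinearMap.ext fun f => ?_
    simp only [opR₀, LinearMap.sub_apply, LinearMap.smul_apply, Module.End.mul_apply, map_sub,
      map_smul]
    module
  rw [h, commutator_opE₁_opP, commutator_opE₁_opD, opV₁_eq, smul_smul]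
  congr 2
  ring

theorem commutator_opE₁_opV₁ [CharZero k] (n : ℕ) :
    (opE₁ * opV₁ n - opV₁ n * opE₁ : Module.End k (Laurent k)) = 0 := by
  have h : (opE₁ * opV₁ n - opV₁ n * opE₁ : Module.End k (Laurent k))
      = (1 / 4 : k) • (opE₁ * opW - opW * opE₁) - (1 / (4 * n) : k) • (opE₁ * opU - opU * opE₁) := by
    refine LinearMap.ext fun f => ?_
    simp only [opV₁_eq, LinearMap.sub_apply, LinearMap.smul_apply, Module.End.mul_apply, map_sub,
      map_smul]
    module
  rw [h, commutator_opE₁_opW, commutator_opE₁_opU]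
  refine LinearMap.ext fun f => ?_
  simp only [LinearMap.sub_apply, LinearMap.zero_apply, smul_zero, sub_zero]

theorem commutator_opE₂_opR₀ [CharZero k] (n : ℕ) :
    (opE₂ * opR₀ n - opR₀ n * opE₂ : Module.End k (Laurent k)) = opV₂ n := by
  have h : (opE₂ * opR₀ n - opR₀ n * opE₂ : Module.End k (Laurent k))
      = (1 / 4 : k) • (opE₂ * opP - opP * opE₂) - (1 / (2 * n) : k) • (opE₂ * opD - opD * opE₂) := by
    refine LinearMap.ext fun f => ?_
    simp only [opR₀, LinearMap.sub_apply, LinearMap.smul_apply, Module.End.mul_apply, map_sub,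
      map_smul]
    module
  rw [h, commutator_opE₂_opP, commutator_opE₂_opD]
  refine LinearMap.ext fun f => ?_
  simp only [opV₂, LinearMap.sub_apply, LinearMap.add_apply, LinearMap.smul_apply]
  module

theorem commutator_opE₂_opV₁ [CharZero k] (n : ℕ) :
    (opE₂ * opV₁ n - opV₁ n * opE₂ : Module.End k (Laurent k)) = opV₃ n := by
  have h : (opE₂ * opV₁ n - opV₁ n * opE₂ : Module.End k (Laurent k))
      = (1 / 4 : k) • (opE₂ * opW - opW * opE₂) - (1 / (4 * n) : k) • (opE₂ * opU - opU * opE₂) := by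
    refine LinearMap.ext fun f => ?_
    simp only [opV₁_eq, LinearMap.sub_apply, LinearMap.smul_apply, Module.End.mul_apply, map_sub,
      map_smul]
    module
  rw [h, commutator_opE₂_opW, commutator_opE₂_opU]
  refine LinearMap.ext fun f => ?_
  simp only [opV₃, LinearMap.sub_apply, LinearMap.add_apply, LinearMap.smul_apply,
    Module.End.mul_apply, map_add, map_sub, map_smul]
  module

/- ### Truncation to polynomials of bounded degree -/

theorem mem_truncPol {n : ℕ} {f : Laurent k} : f ∈ truncPol k n ↔
    ∀ a b : ℤ, ¬ ((0 ≤ a ∧ a < n) ∧ (0 ≤ b ∧ b < n)) → f (a, b) = 0 := by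
  rw [truncPol, Finsupp.mem_supported']
  exact ⟨fun h a b hab => h (a, b) hab, fun h ⟨a, b⟩ hab => h a b hab⟩

/-- The operator `T` preserves polynomials of degree less than `n` in both variables. -/
def Preserves (n : ℕ) (T : Module.End k (Laurent k)) : Prop :=
  ∀ f ∈ truncPol k n, T f ∈ truncPol k n

theorem Preserves.mul {n : ℕ} {S T : Module.End k (Laurent k)} (hS : Preserves n S)
    (hT : Preserves n T) : Preserves n (S * T) := fun f hf => hS _ (hT f hf)

theorem Preserves.add {n : ℕ} {S T : Module.End k (Laurent k)} (hS : Preserves n S)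
    (hT : Preserves n T) : Preserves n (S + T) :=
  fun f hf => Submodule.add_mem _ (hS f hf) (hT f hf)

theorem Preserves.sub {n : ℕ} {S T : Module.End k (Laurent k)} (hS : Preserves n S)
    (hT : Preserves n T) : Preserves n (S - T) :=
  fun f hf => Submodule.sub_mem _ (hS f hf) (hT f hf)

theorem Preserves.smul {n : ℕ} {T : Module.End k (Laurent k)} (c : k)
    (hT : Preserves n T) : Preserves n (c • T) :=
  fun f hf => Submodule.smul_mem _ c (hT f hf)

theorem preserves_of_mono {n : ℕ} {T : Module.End k (Laurent k)}
    (h : ∀ j l a b : ℤ, 0 ≤ j → j < n → 0 ≤ l → l < n →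
      ¬ ((0 ≤ a ∧ a < n) ∧ (0 ≤ b ∧ b < n)) → (T (mono j l) : Laurent k) (a, b) = 0) :
    Preserves n T := by
  intro f hf
  rw [truncPol, Finsupp.supported_eq_span_single] at hf
  refine Submodule.span_induction (p := fun f _ => T f ∈ truncPol k n) ?_ (by simp)
    (fun x y _ _ hx hy => by rw [map_add]; exact Submodule.add_mem _ hx hy)
    (fun c x _ hx => by rw [map_smul]; exact Submodule.smul_mem _ c hx) hf
  rintro _ ⟨⟨j, l⟩, ⟨⟨h1, h2⟩, h3, h4⟩, rfl⟩
  exact mem_truncPol.2 fun a b hab => h j l a b h1 h2 h3 h4 hab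

/-- The factor ⌊j/2⌋ with which E₁ lowers an exponent j by two vanishes at j = 0 and j = 1, exactly
where the result would be negative. -/
theorem preserves_opE₁ [CharZero k] (n : ℕ) : Preserves n (opE₁ : Module.End k (Laurent k)) := by
  intro f hf
  rw [mem_truncPol] at hf ⊢
  intro a b hab
  have h2 : (-1 : k) ^ (-2 : ℤ) = 1 := by norm_num
  have h1 : (-1 : k) ^ (-1 : ℤ) = -1 := by norm_num
  rw [opE₁_apply]
  by_cases h : a = -1 ∨ a = -2 ∨ b = -1 ∨ b = -2
  · rcases h with rfl | rfl | rfl | rfl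
    · rw [hf (-1) _ (by omega), h1]; norm_num
    · rw [hf (-2) _ (by omega), h2]; norm_num
    · rw [hf _ (-1) (by omega), h1]; norm_num
    · rw [hf _ (-2) (by omega), h2]; norm_num
  · rw [hf (a + 2) b (by omega), hf a (b + 2) (by omega)]; ring

/-- E₂ raises only odd exponents, and the top exponent n - 1 is even because n is odd. -/
theorem preserves_opE₂ [CharZero k] {n : ℕ} (hn : Odd n) :
    Preserves n (opE₂ : Module.End k (Laurent k)) := by
  intro f hf
  rw [mem_truncPol] at hf ⊢
  intro a b hab
  have h1 : (-1 : k) ^ (n : ℤ) = -1 := by rw [zpow_natCast, hn.neg_one_pow]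
  rw [opE₂_apply]
  by_cases h : a = n ∨ b = n
  · rcases h with rfl | rfl
    · rw [hf n _ (by omega), h1]; norm_num
    · rw [hf _ n (by omega), h1]; norm_num
  · rw [hf (a - 1) b (by omega), hf a (b - 1) (by omega)]; ring

/-- The total degree is preserved, so if either exponent leaves the range then a lies outside the
segment between j and l, and the two signs cancel. -/
theorem preserves_opR₀ [CharZero k] (n : ℕ) :
    Preserves n (opR₀ n : Module.End k (Laurent k)) := by
  refine ((preserves_of_mono fun j l a b h1 h2 h3 h4 hab => ?_).smul _).sub
    (Preserves.smul _ fun f hf => ?_)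
  · rw [opP_mono_apply]
    split_ifs with h
    · rcases (by omega : (a < j ∧ a < l) ∨ (j < a ∧ l < a)) with h' | h'
      · rw [sgn_pos (by omega), sgn_neg (by omega)]; ring
      · rw [sgn_neg (by omega), sgn_pos (by omega)]; ring
    · rfl
  · rw [mem_truncPol] at hf ⊢
    intro a b hab
    rw [opD_apply, hf a b hab, mul_zero]

/-- The vᵢ are iterated commutators of r₀ with E₁ and E₂, so they inherit the property without
inspection of their coefficients. -/
theorem preserves_opV₁ [CharZero k] (n : ℕ) :
    Preserves n (opV₁ n : Module.End k (Laurent k)) := by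
  rw [← commutator_opE₁_opR₀]
  exact ((preserves_opE₁ n).mul (preserves_opR₀ n)).sub ((preserves_opR₀ n).mul (preserves_opE₁ n))

theorem preserves_opV₂ [CharZero k] {n : ℕ} (hn : Odd n) :
    Preserves n (opV₂ n : Module.End k (Laurent k)) := by
  rw [← commutator_opE₂_opR₀]
  exact ((preserves_opE₂ hn).mul (preserves_opR₀ n)).sub
    ((preserves_opR₀ n).mul (preserves_opE₂ hn))

theorem preserves_opV₃ [CharZero k] {n : ℕ} (hn : Odd n) :
    Preserves n (opV₃ n : Module.End k (Laurent k)) := by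
  rw [← commutator_opE₂_opV₁]
  exact ((preserves_opE₂ hn).mul (preserves_opV₁ n)).sub
    ((preserves_opV₁ n).mul (preserves_opE₂ hn))

theorem preserves_opV₄ [CharZero k] {n : ℕ} (hn : Odd n) :
    Preserves n (opV₄ : Module.End k (Laurent k)) := by
  rw [← commutator_opE₂_opV₃ n]
  exact ((preserves_opE₂ hn).mul (preserves_opV₃ hn)).sub
    ((preserves_opV₃ hn).mul (preserves_opE₂ hn))

theorem preserves_opB [CharZero k] {n : ℕ} (hn : Odd n) (u t : k) :
    Preserves n (opB n u t : Module.End k (Laurent k)) :=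
  ((((preserves_opV₁ n).smul u).add ((preserves_opV₂ hn).smul t)).add
    ((preserves_opV₃ hn).smul (t * u))).add ((preserves_opV₄ hn).smul _)

theorem truncMatrix_apply (n : ℕ) (T : Module.End k (Laurent k)) (a b j l : Fin n) :
    truncMatrix n T (a, b) (j, l) = (T (mono (j : ℕ) (l : ℕ)) : Laurent k) ((a : ℕ), (b : ℕ)) :=
  rfl

theorem truncMatrix_sub (n : ℕ) (S T : Module.End k (Laurent k)) :
    truncMatrix n (S - T) = truncMatrix n S - truncMatrix n T := rfl

theorem mono_mem_truncPol {n : ℕ} (j l : Fin n) :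
    (mono (j : ℕ) (l : ℕ) : Laurent k) ∈ truncPol k n := by
  rw [mem_truncPol]
  intro a b hab
  rw [mono_apply, if_neg (by omega)]

theorem eq_sum_mono_of_mem_truncPol {n : ℕ} {f : Laurent k} (hf : f ∈ truncPol k n) :
    f = ∑ p : Fin n × Fin n, f ((p.1 : ℕ), (p.2 : ℕ)) • mono (p.1 : ℕ) (p.2 : ℕ) := by
  refine Finsupp.ext fun ⟨a, b⟩ => ?_
  simp only [Finsupp.coe_finsetSum, Finset.sum_apply, Finsupp.smul_apply, mono_apply, smul_eq_mul]
  by_cases hab : (0 ≤ a ∧ a < n) ∧ (0 ≤ b ∧ b < n)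
  · obtain ⟨⟨h1, h2⟩, h3, h4⟩ := hab
    lift a to ℕ using h1
    lift b to ℕ using h3
    rw [Finset.sum_eq_single (⟨a, by omega⟩, ⟨b, by omega⟩)]
    · simp
    · rintro ⟨c, d⟩ _ hcd
      rw [if_neg, mul_zero]
      rintro ⟨h1, h2⟩
      exact hcd (Prod.ext (Fin.ext (by simpa using h1)) (Fin.ext (by simpa using h2)))
    · simp
  · rw [mem_truncPol.1 hf a b hab, Finset.sum_eq_zero]
    rintro ⟨c, d⟩ _
    rw [if_neg (by dsimp only; omega), mul_zero]

/-- Only the right factor has to preserve P_n: then no intermediate monomial is lost, and the final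
truncation merely reads off coefficients. -/
theorem truncMatrix_mul {n : ℕ} (S : Module.End k (Laurent k)) {T : Module.End k (Laurent k)}
    (hT : Preserves n T) : truncMatrix n (S * T) = truncMatrix n S * truncMatrix n T := by
  ext ⟨a, b⟩ ⟨j, l⟩
  rw [truncMatrix_apply, Module.End.mul_apply,
    eq_sum_mono_of_mem_truncPol (hT _ (mono_mem_truncPol j l)), map_sum, Matrix.mul_apply]
  simp only [Finsupp.coe_finsetSum, Finset.sum_apply, map_smul, Finsupp.smul_apply, smul_eq_mul]
  refine Finset.sum_congr rfl fun p _ => ?_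
  rw [mul_comm]
  rfl

theorem truncMatrix_opE₁ [CharZero k] (n : ℕ) :
    truncMatrix n opE₁ = coprod (matE₁ k n) := by
  ext ⟨a, b⟩ ⟨j, l⟩
  have hf (x : ℕ) : (1 / 2 : k) * x - 1 / 4 * (1 - (-1) ^ (x : ℤ)) = ((x / 2 : ℕ) : k) := by
    rcases Nat.even_or_odd' x with ⟨c, rfl | rfl⟩
    · rw [show 2 * c / 2 = c by omega, zpow_natCast, Even.neg_one_pow (by simp)]; push_cast; ring
    · rw [show (2 * c + 1) / 2 = c by omega, zpow_natCast, Odd.neg_one_pow (by simp)]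
      push_cast; ring
  rw [truncMatrix_apply, opE₁_mono]
  simp only [Int.cast_natCast, hf, Finsupp.add_apply, Finsupp.smul_apply, mono_apply, coprod,
    Matrix.add_apply, Matrix.kroneckerMap_apply, matE₁, Matrix.of_apply, smul_eq_mul,
    Matrix.one_apply]
  congr 1
  · by_cases h : j.val = a.val + 2 ∧ l = b
    · obtain ⟨h, rfl⟩ := h
      rw [if_pos (by omega), if_pos h, if_pos rfl, h]
    · have : ¬ ((j : ℕ) - 2 = (a : ℤ) ∧ (l : ℕ) = (b : ℤ)) := by
        rintro ⟨h1, h2⟩; exact h ⟨by omega, Fin.ext (by omega)⟩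
      rw [if_neg this, mul_zero]
      by_cases h' : j.val = a.val + 2
      · rw [if_neg (fun h'' => h ⟨h', h''.symm⟩ : ¬ b = l), mul_zero]
      · rw [if_neg h', zero_mul]
  · by_cases h : l.val = b.val + 2 ∧ j = a
    · obtain ⟨h, rfl⟩ := h
      rw [if_pos (by omega), if_pos h, if_pos rfl, h, mul_comm]
    · have : ¬ ((j : ℕ) = (a : ℤ) ∧ (l : ℕ) - 2 = (b : ℤ)) := by
        rintro ⟨h1, h2⟩; exact h ⟨by omega, Fin.ext (by omega)⟩
      rw [if_neg this, mul_zero]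
      by_cases h' : l.val = b.val + 2
      · rw [if_neg (fun h'' => h ⟨h', h''.symm⟩ : ¬ a = j), zero_mul]
      · rw [if_neg h', mul_zero]

theorem truncMatrix_opE₂ [CharZero k] (n : ℕ) :
    truncMatrix n opE₂ = coprod (matE₂ k n) := by
  ext ⟨a, b⟩ ⟨j, l⟩
  have hf (x : ℕ) : (1 / 2 : k) * (1 + (-1) ^ (x : ℤ)) = if Even x then 1 else 0 := by
    split_ifs with h
    · rw [zpow_natCast, h.neg_one_pow]; ring
    · rw [zpow_natCast, (Nat.not_even_iff_odd.1 h).neg_one_pow]; ring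
  rw [truncMatrix_apply, opE₂_apply]
  simp only [hf, mono_apply, coprod,
    Matrix.add_apply, Matrix.kroneckerMap_apply, matE₂, Matrix.of_apply,
    Matrix.one_apply]
  congr 1
  · have : ((j : ℕ) = (a : ℤ) - 1 ∧ (l : ℕ) = (b : ℤ)) ↔ (a.val = j.val + 1 ∧ b = l) := by
      rw [Fin.ext_iff]; omega
    simp only [this]
    by_cases h1 : a.val = j.val + 1 <;> by_cases h2 : b = l <;> simp [h1, h2]
  · have : ((j : ℕ) = (a : ℤ) ∧ (l : ℕ) = (b : ℤ) - 1) ↔ (b.val = l.val + 1 ∧ a = j) := by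
      rw [Fin.ext_iff]; omega
    simp only [this]
    by_cases h1 : b.val = l.val + 1 <;> by_cases h2 : a = j <;> simp [h1, h2]

/- ### The Cremmer–Gervais `r`-matrix `r_{n-2,n}` -/

/-- Modulo n, adding n - 2 subtracts 2, so ζ sends α_s to α_{s-2} for s ≥ 3 and α₁ to α_{n-1}. The
support of a root is an interval; if it avoids 2, it lies in s ≥ 3 or is {1}. -/
theorem bdStep_sub_two_iff {n : ℕ} (hn3 : 3 ≤ n) (ρ μ : Fin n × Fin n) :
    bdStep (n - 2) n ρ μ ↔
      (ρ.1 < ρ.2 ∧ μ.1.val + 2 = ρ.1.val ∧ μ.2.val + 2 = ρ.2.val) ∨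
      (ρ.1.val = 0 ∧ ρ.2.val = 1 ∧ μ.1.val = n - 2 ∧ μ.2.val = n - 1) := by
  obtain ⟨⟨r1, hr1⟩, ⟨r2, hr2⟩⟩ := ρ
  obtain ⟨⟨m1, hm1⟩, ⟨m2, hm2⟩⟩ := μ
  have hmod (s : ℕ) (h1 : 2 ≤ s) (h2 : s < n) : (s + (n - 2)) % n = s - 2 := by
    rw [show s + (n - 2) = s - 2 + n by omega, Nat.add_mod_right, Nat.mod_eq_of_lt (by omega)]
  have hmod1 : (1 + (n - 2)) % n = n - 1 := by
    rw [Nat.mod_eq_of_lt (by omega)]; omega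
  simp only [bdStep, rootSupport, Fin.mk_lt_mk, Finset.mem_Icc, not_and_or, not_le]
  rw [show n - (n - 2) = 2 by omega]
  constructor
  · rintro ⟨h1, h2, h3, h4⟩
    have hmem (x : ℕ) : (∃ s, (r1 + 1 ≤ s ∧ s ≤ r2) ∧ (s + (n - 2)) % n = x)
        ↔ m1 + 1 ≤ x ∧ x ≤ m2 := by
      rw [← Finset.mem_Icc, ← h4]; simp
    rcases le_or_gt r2 1 with h5 | h5
    · right
      obtain ⟨s1, hs1, e1⟩ := (hmem (m1 + 1)).2 ⟨le_rfl, h2⟩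
      obtain ⟨s2, hs2, e2⟩ := (hmem m2).2 ⟨h2, le_rfl⟩
      obtain rfl : s1 = 1 := by omega
      obtain rfl : s2 = 1 := by omega
      rw [hmod1] at e1 e2
      omega
    · left
      obtain ⟨s1, hs1, e1⟩ := (hmem (m1 + 1)).2 ⟨le_rfl, h2⟩
      obtain ⟨s2, hs2, e2⟩ := (hmem m2).2 ⟨h2, le_rfl⟩
      have e3 := (hmem (r1 + 1 - 2)).1 ⟨r1 + 1, ⟨le_rfl, h1⟩, hmod _ (by omega) (by omega)⟩
      have e4 := (hmem (r2 - 2)).1 ⟨r2, ⟨h1, le_rfl⟩, hmod _ (by omega) (by omega)⟩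
      rw [hmod _ (by omega) (by omega)] at e1 e2
      omega
  · rintro (⟨h1, rfl, rfl⟩ | ⟨rfl, rfl, rfl, rfl⟩)
    · refine ⟨h1, by omega, by omega, ?_⟩
      ext x
      simp only [Finset.mem_image, Finset.mem_Icc]
      constructor
      · rintro ⟨s, hs, rfl⟩
        rw [hmod _ (by omega) (by omega)]; omega
      · intro hx
        exact ⟨x + 2, by omega, by rw [hmod _ (by omega) (by omega)]; omega⟩
    · refine ⟨by omega, by omega, by omega, ?_⟩
      ext x
      simp only [Finset.mem_image, Finset.mem_Icc]
      constructor
      · rintro ⟨s, hs, rfl⟩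
        obtain rfl : s = 1 := by omega
        rw [hmod1]; omega
      · intro hx
        exact ⟨1, by omega, by rw [hmod1]; omega⟩

theorem bdStep_reflTransGen_of_shift {n : ℕ} (hn3 : 3 ≤ n) (N : ℕ) :
    ∀ ρ μ : Fin n × Fin n, μ.1 < μ.2 → μ.1.val + 2 * N = ρ.1.val → μ.2.val + 2 * N = ρ.2.val →
      Relation.ReflTransGen (bdStep (n - 2) n) ρ μ := by
  induction N with
  | zero =>
    intro ρ μ _ h1 h2
    have : ρ = μ := Prod.ext (Fin.ext (by omega)) (Fin.ext (by omega))
    rw [this]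
  | succ N ih =>
    rintro ⟨r1, r2⟩ ⟨m1, m2⟩ h h1 h2
    dsimp only at h h1 h2
    rw [Fin.lt_def] at h
    refine Relation.ReflTransGen.head
      (b := ((⟨r1.val - 2, by omega⟩ : Fin n), (⟨r2.val - 2, by omega⟩ : Fin n)))
      ((bdStep_sub_two_iff hn3 _ _).2 (Or.inl ?_)) (ih _ _ h ?_ ?_)
    · dsimp only; rw [Fin.lt_def]; omega
    · dsimp only; omega
    · dsimp only; omega

/-- For odd n the simple roots form the single ζ-chain α_{n-2}, α_{n-4}, …, α₁, α_{n-1}, α_{n-3}, …,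
α₂, so each odd-labelled one precedes each even-labelled one. Only a simple root can cross from α₁
to α_{n-1}; every other relation is a shift by an even number. Indices start from 0, so an even
first index means an odd label. -/
theorem bdLT_sub_two_iff {n : ℕ} (hn : Odd n) (hn3 : 3 ≤ n) (ρ μ : Fin n × Fin n) :
    bdLT (n - 2) n ρ μ ↔
      (ρ.1 < ρ.2 ∧ ∃ N : ℕ, 1 ≤ N ∧ μ.1.val + 2 * N = ρ.1.val ∧ μ.2.val + 2 * N = ρ.2.val) ∨
      (ρ.2.val = ρ.1.val + 1 ∧ Even ρ.1.val ∧ μ.2.val = μ.1.val + 1 ∧ Odd μ.1.val) := by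
  constructor
  · intro h
    induction h with
    | single h =>
      rcases (bdStep_sub_two_iff hn3 _ _).1 h with ⟨h1, h2, h3⟩ | ⟨h1, h2, h3, h4⟩
      · exact Or.inl ⟨h1, 1, le_rfl, h2, h3⟩
      · refine Or.inr ⟨by omega, by simp [h1], by omega, ?_⟩
        rw [h3]; grind
    | tail _ h ih =>
      rcases (bdStep_sub_two_iff hn3 _ _).1 h with ⟨h1, h2, h3⟩ | ⟨h1, h2, h3, h4⟩
      · rcases ih with ⟨i1, N, i2, i3, i4⟩ | ⟨i1, i2, i3, i4⟩
        · exact Or.inl ⟨i1, N + 1, by omega, by omega, by omega⟩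
        · exact Or.inr ⟨i1, i2, by omega, by grind⟩
      · rcases ih with ⟨i1, N, i2, i3, i4⟩ | ⟨i1, i2, i3, i4⟩
        · refine Or.inr ⟨by omega, ⟨N, by omega⟩, by omega, ?_⟩
          rw [h3]; grind
        · rw [h1] at i4; exact absurd i4 (by decide)
  · obtain ⟨⟨r1, hr1⟩, ⟨r2, hr2⟩⟩ := ρ
    obtain ⟨⟨m1, hm1⟩, ⟨m2, hm2⟩⟩ := μ
    dsimp only
    rintro (⟨h1, N, h2, h3, h4⟩ | ⟨h1, ⟨c, hc⟩, h3, h4⟩)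
    · rw [Fin.mk_lt_mk] at h1
      refine Relation.TransGen.head'
        (b := ((⟨r1 - 2, by omega⟩ : Fin n), (⟨r2 - 2, by omega⟩ : Fin n)))
        ((bdStep_sub_two_iff hn3 _ _).2 (Or.inl ?_))
        (bdStep_reflTransGen_of_shift hn3 (N - 1) _ _ ?_ ?_ ?_)
      · dsimp only; rw [Fin.mk_lt_mk]; omega
      · dsimp only; rw [Fin.mk_lt_mk]; omega
      · dsimp only; omega
      · dsimp only; omega
    · obtain ⟨d, hd⟩ : ∃ d, m1 + 2 * d = n - 2 := by
        obtain ⟨x, hx⟩ := h4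
        obtain ⟨y, hy⟩ := hn
        exact ⟨y - 1 - x, by omega⟩
      -- The path descends by c shifts to α₁, crosses to α_{n-1}, and descends by d further shifts.
      refine Relation.TransGen.trans_right (b := ((⟨0, by omega⟩ : Fin n), (⟨1, by omega⟩ : Fin n)))
        (bdStep_reflTransGen_of_shift hn3 c _ _ ?_ ?_ ?_) ?_
      · dsimp only; rw [Fin.mk_lt_mk]; omega
      · dsimp only; omega
      · dsimp only; omega
      · refine Relation.TransGen.head'
          (b := ((⟨n - 2, by omega⟩ : Fin n), (⟨n - 1, by omega⟩ : Fin n)))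
          ((bdStep_sub_two_iff hn3 _ _).2 (Or.inr ?_))
          (bdStep_reflTransGen_of_shift hn3 d _ _ ?_ ?_ ?_)
        · simp
        · dsimp only; rw [Fin.mk_lt_mk]; omega
        · dsimp only; omega
        · dsimp only; omega

/-! ### Coordinates of the three parts of the Cremmer–Gervais matrix. -/

theorem e_apply {n : ℕ} (i j a b : Fin n) :
    (e i j : Mat k n) a b = if i = a ∧ j = b then 1 else 0 := by
  rw [e, Matrix.single_apply]

theorem wedge_apply {n : ℕ} (A B : Mat k n) (a b j l : Fin n) :
    wedge A B (a, b) (j, l) = 1 / 2 * (A a j * B b l - B a j * A b l) := by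
  simp [wedge, Matrix.kroneckerMap_apply]

theorem ite_mul_e_mul_e {n : ℕ} (P : Prop) [Decidable P] (c : k) (i j i' j' a b a' b' : Fin n) :
    (if P then c * ((e i j : Mat k n) a b * (e i' j' : Mat k n) a' b') else 0)
      = if i = a then if j = b then if i' = a' then if j' = b' then if P then c else 0 else 0 else 0
        else 0 else 0 := by
  rw [e_apply, e_apply]
  by_cases h1 : i = a <;> by_cases h2 : j = b <;> by_cases h3 : i' = a' <;>
  by_cases h4 : j' = b' <;> simp [h1, h2, h3, h4]

open Classical in
theorem alphaPart_apply [CharZero k] (m n : ℕ) (a b j l : Fin n) :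
    alphaPart k m n (a, b) (j, l)
      = (if bdLT m n (a, j) (l, b) then 1 else 0) - if bdLT m n (b, l) (j, a) then 1 else 0 := by
  have h (r1 r2 m1 m2 : Fin n) :
      (if bdLT m n (r1, r2) (m1, m2) then wedge (e r1 r2) (e m2 m1) else 0 : Mat₂ k n) (a, b) (j, l)
      = (if bdLT m n (r1, r2) (m1, m2) then
          1 / 2 * ((e r1 r2 : Mat k n) a j * (e m2 m1 : Mat k n) b l) else 0)
        - if bdLT m n (r1, r2) (m1, m2) then
          1 / 2 * ((e r1 r2 : Mat k n) b l * (e m2 m1 : Mat k n) a j) else 0 := by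
    split_ifs
    · rw [wedge_apply]; ring
    · simp
  rw [alphaPart, Matrix.smul_apply, Matrix.sum_apply]
  simp only [Matrix.sum_apply, Fintype.sum_prod_type, h, ite_mul_e_mul_e, Finset.sum_sub_distrib,
    Finset.sum_ite_irrel, Finset.sum_const_zero, Finset.sum_ite_eq', Finset.mem_univ, if_true,
    smul_eq_mul]
  split_ifs <;> norm_num

theorem betaPart_apply (m n : ℕ) (a b j l : Fin n) :
    betaPart k m n (a, b) (j, l) = if a = j ∧ b = l then
      (if a < b then (-1 + 2 / (n : k) *
        ((((a.val : ZMod n) - (b.val : ZMod n)) * (m : ZMod n)⁻¹).val : k)) * (1 / 2) else 0)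
      - (if b < a then (-1 + 2 / (n : k) *
        ((((b.val : ZMod n) - (a.val : ZMod n)) * (m : ZMod n)⁻¹).val : k)) * (1 / 2) else 0)
      else 0 := by
  have h (c : Fin n → Fin n → k) (x y : Fin n) :
      (if x < y then c x y • wedge (e x x) (e y y) else 0 : Mat₂ k n) (a, b) (j, l)
      = (if x < y then (c x y * (1 / 2)) * ((e x x : Mat k n) a j * (e y y : Mat k n) b l) else 0)
        - if x < y then (c x y * (1 / 2)) * ((e x x : Mat k n) b l * (e y y : Mat k n) a j)
          else 0 := by
    split_ifs
    · rw [Matrix.smul_apply, wedge_apply, smul_eq_mul]; ring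
    · simp
  rw [betaPart]
  simp only [Matrix.sum_apply, h (fun x y => -1 + 2 / (n : k) *
    ((((x.val : ZMod n) - (y.val : ZMod n)) * (m : ZMod n)⁻¹).val : k)), ite_mul_e_mul_e,
    Finset.sum_sub_distrib, Finset.sum_ite_irrel, Finset.sum_const_zero, Finset.sum_ite_eq',
    Finset.mem_univ, if_true]
  by_cases h1 : a = j <;> by_cases h2 : b = l <;> simp [h1, h2]

theorem gammaPart_apply (n : ℕ) (a b j l : Fin n) :
    gammaPart k n (a, b) (j, l) = if a = l ∧ b = j then
      (if a < b then 1 / 2 else 0) - (if b < a then 1 / 2 else 0) else 0 := by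
  have h (x y : Fin n) :
      (if x < y then wedge (e x y) (e y x) else 0 : Mat₂ k n) (a, b) (j, l)
      = (if x < y then 1 / 2 * ((e x y : Mat k n) a j * (e y x : Mat k n) b l) else 0)
        - if x < y then 1 / 2 * ((e x y : Mat k n) b l * (e y x : Mat k n) a j) else 0 := by
    split_ifs
    · rw [wedge_apply]; ring
    · simp
  rw [gammaPart]
  simp only [Matrix.sum_apply, h, ite_mul_e_mul_e,
    Finset.sum_sub_distrib, Finset.sum_ite_irrel, Finset.sum_const_zero, Finset.sum_ite_eq',
    Finset.mem_univ, if_true]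
  rcases eq_or_ne a l with rfl | h1 <;> rcases eq_or_ne b j with rfl | h2
  · simp
  · simp [h2, h2.symm]
  · simp [h1, h1.symm]
  · simp [h1, h1.symm, h2.symm]

/-- Since n - 2 ≡ -2, the value v solves 2v ≡ y - x mod n; it is half of whichever of y - x and y -
x + n is even. -/
theorem zmod_sub_mul_inv_val {n : ℕ} (hn : Odd n) (hn3 : 3 ≤ n) {x y : ℕ} (hxy : x < y)
    (hy : y < n) : ((((x : ZMod n) - (y : ZMod n)) * ((n - 2 : ℕ) : ZMod n)⁻¹).val)
      = if Even (y - x) then (y - x) / 2 else (y - x + n) / 2 := by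
  have hcop : Nat.Coprime (n - 2) n := by
    have h : Nat.Coprime 2 n := (Nat.coprime_two_left).2 hn
    exact (Nat.coprime_self_sub_left (by omega)).2 h
  have key (v : ℕ) (hv : v < n) (h : 2 * v = y - x ∨ 2 * v = y - x + n) :
      ((((x : ZMod n) - (y : ZMod n)) * ((n - 2 : ℕ) : ZMod n)⁻¹).val) = v := by
    have h1 : (x : ZMod n) - (y : ZMod n) = v * ((n - 2 : ℕ) : ZMod n) := by
      have h2 : (2 : ZMod n) * v = y - x := by
        rw [← Nat.cast_sub hxy.le]
        rcases h with h | h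
        · rw [← h]; push_cast; ring
        · have : (((y - x + n : ℕ)) : ZMod n) = ((y - x : ℕ) : ZMod n) := by
            push_cast; simp
          rw [← this, ← h]; push_cast; ring
      rw [Nat.cast_sub (by omega), ZMod.natCast_self]
      push_cast
      linear_combination h2
    rw [h1, mul_assoc, ZMod.coe_mul_inv_eq_one _ hcop, mul_one, ZMod.val_natCast_of_lt hv]
  split_ifs with h
  · obtain ⟨c, hc⟩ := h
    exact key _ (by omega) (Or.inl (by omega))
  · rw [Nat.not_even_iff_odd] at h
    have : Even (y - x + n) := h.add_odd hn
    obtain ⟨c, hc⟩ := this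
    exact key _ (by omega) (Or.inr (by omega))

/-- The coefficient splits into a linear part, matching x₁∂₁ - x₂∂₂, and a parity part, matching the
diagonal coefficients of Δ + ξ₁Δξ₂. -/
theorem beta_coeff [CharZero k] {n : ℕ} (hn : Odd n) (hn3 : 3 ≤ n) {x y : ℕ} (hxy : x < y)
    (hy : y < n) : (-1 + 2 / (n : k) *
        ((((x : ZMod n) - (y : ZMod n)) * ((n - 2 : ℕ) : ZMod n)⁻¹).val : k))
      = ((y : k) - x) / n - if Even (y - x) then 1 else 0 := by
  have hn0 : (n : k) ≠ 0 := by
    rw [Nat.cast_ne_zero]; omega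
  rw [zmod_sub_mul_inv_val hn hn3 hxy hy, ← Nat.cast_sub hxy.le]
  split_ifs with h
  · obtain ⟨c, hc⟩ := h
    rw [hc, show (c + c) / 2 = c by omega]
    push_cast
    field_simp
    ring
  · rw [Nat.not_even_iff_odd] at h
    obtain ⟨c, hc⟩ : Even (y - x + n) := h.add_odd hn
    rw [hc, show (c + c) / 2 = c by omega]
    have : ((y - x : ℕ) : k) + n = c + c := by exact_mod_cast congrArg (Nat.cast (R := k)) hc
    field_simp
    linear_combination -this

/-- The Cremmer–Gervais `r`-matrix `r_{n-2,n}` as an operator. -/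
def opR (n : ℕ) : Module.End k (Laurent k) := opR₀ n + (1 / 2 : k) • opV₄

theorem opR₀_mono_apply (n : ℕ) (j l a b : ℤ) : (opR₀ n (mono j l) : Laurent k) (a, b)
    = (if a + b = j + l then 1 / 4 * ((1 + (-1) ^ a * (-1) ^ l) *
        (sgn k (j - a) + sgn k (a - l))) else 0)
      - 1 / (2 * n) * (((a : k) - b) * if j = a ∧ l = b then 1 else 0) := by
  simp only [opR₀, LinearMap.sub_apply, LinearMap.smul_apply, Finsupp.sub_apply,
    Finsupp.smul_apply, opP_mono_apply, opD_apply, mono_apply, smul_eq_mul, mul_ite, mul_zero]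

/-- The crossings from odd-labelled to even-labelled simple roots give ½v₄. In ¼(Δ + ξ₁Δξ₂) the
exponents a strictly between j and l have coefficient ±1 and come from the shifts in α; the ends a =
j and a = l have coefficient ±½ and come from β and γ. The linear part of β is the remaining term of
r₀. -/
theorem rCG_eq_truncMatrix [CharZero k] {n : ℕ} (hn : Odd n) (hn3 : 3 ≤ n) :
    rCG k (n - 2) n = truncMatrix n (opR n) := by
  classical
  ext ⟨a, b⟩ ⟨j, l⟩
  rw [rCG, Matrix.add_apply, Matrix.add_apply, alphaPart_apply, betaPart_apply, gammaPart_apply,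
    truncMatrix_apply, opR, LinearMap.add_apply, Finsupp.add_apply, LinearMap.smul_apply,
    Finsupp.smul_apply, opR₀_mono_apply, opV₄_apply, mono_apply, mono_apply, smul_eq_mul]
  have hL (a b j l : Fin n) : bdLT (n - 2) n (a, j) (l, b) ↔
      (a.val < j.val ∧ l.val < a.val ∧ Even (a.val + l.val) ∧ a.val + b.val = j.val + l.val) ∨
      (j.val = a.val + 1 ∧ b.val = l.val + 1 ∧ Even a.val ∧ Odd l.val) := by
    rw [bdLT_sub_two_iff hn hn3]
    refine or_congr ?_ (by tauto)
    rw [Fin.lt_def]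
    constructor
    · rintro ⟨h1, N, h2, h3, h4⟩
      exact ⟨h1, by dsimp only at h3; omega, ⟨l.val + N, by dsimp only at h3; omega⟩,
        by dsimp only at h3 h4; omega⟩
    · rintro ⟨h1, h2, ⟨c, hc⟩, h4⟩
      exact ⟨h1, c - l.val, by omega, by dsimp only; omega, by dsimp only; omega⟩
  simp only [hL, Fin.lt_def, Fin.ext_iff]
  obtain ⟨a, ha⟩ := a
  obtain ⟨b, hb⟩ := b
  obtain ⟨j, hj⟩ := j
  obtain ⟨l, hl⟩ := l
  dsimp only
  have hβ (x y : ℕ) (hy : y < n) : (if x < y then (-1 + 2 / (n : k) *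
        ((((x : ZMod n) - (y : ZMod n)) * ((n - 2 : ℕ) : ZMod n)⁻¹).val : k)) * (1 / 2) else 0)
      = if x < y then (((y : k) - x) / n - if Even (y - x) then 1 else 0) * (1 / 2) else 0 := by
    split_ifs with h1 h2
    · rw [beta_coeff hn hn3 h1 hy, if_pos h2]
    · rw [beta_coeff hn hn3 h1 hy, if_neg h2]
    · rfl
  rw [hβ a b hb, hβ b a ha]
  have hV : (1 / 2 : k) * (1 / 2 * (1 + (-1) ^ (a : ℤ)) * (1 + (-1) ^ (b : ℤ)) *
      ((if (j : ℤ) = a + 1 ∧ (l : ℤ) = b - 1 then 1 else 0)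
        - if (j : ℤ) = a - 1 ∧ (l : ℤ) = b + 1 then 1 else 0))
      = (if j = a + 1 ∧ b = l + 1 ∧ Even a ∧ Odd l then 1 else 0)
        - if l = b + 1 ∧ a = j + 1 ∧ Even b ∧ Odd j then 1 else 0 := by
    have e1 : ((j : ℤ) = a + 1 ∧ (l : ℤ) = b - 1) ↔ (j = a + 1 ∧ b = l + 1) := by omega
    have e2 : ((j : ℤ) = a - 1 ∧ (l : ℤ) = b + 1) ↔ (l = b + 1 ∧ a = j + 1) := by omega
    simp only [e1, e2, zpow_natCast]
    have hpar (x y : ℕ) : (1 / 2 : k) * (1 / 2 * (1 + (-1) ^ x) * (1 + (-1) ^ (y + 1)))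
        = if Even x ∧ Odd y then 1 else 0 := by
      rcases Nat.even_or_odd x with h | h
      · rcases Nat.even_or_odd y with h' | h'
        · rw [if_neg (fun H => Nat.not_odd_iff_even.2 h' H.2), pow_succ, h'.neg_one_pow]; ring
        · rw [if_pos ⟨h, h'⟩, pow_succ, h.neg_one_pow, h'.neg_one_pow]; ring
      · rw [if_neg (fun H => Nat.not_odd_iff_even.2 H.1 h), h.neg_one_pow]; ring
    by_cases h1 : j = a + 1 ∧ b = l + 1
    · obtain ⟨rfl, rfl⟩ := h1
      rw [if_neg (show ¬ (l = l + 1 + 1 ∧ a = a + 1 + 1) by omega),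
        if_neg (show ¬ (l = l + 1 + 1 ∧ a = a + 1 + 1 ∧ Even (l + 1) ∧ Odd (a + 1)) by omega)]
      simp only [true_and, and_self, if_true]
      linear_combination hpar a l
    · rw [if_neg h1, if_neg (show ¬ (j = a + 1 ∧ b = l + 1 ∧ Even a ∧ Odd l) by tauto)]
      by_cases h2 : l = b + 1 ∧ a = j + 1
      · obtain ⟨rfl, rfl⟩ := h2
        simp only [true_and, and_self, if_true]
        linear_combination -hpar b j
      · rw [if_neg h2, if_neg (show ¬ (l = b + 1 ∧ a = j + 1 ∧ Even b ∧ Odd j) by tauto)]; ring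
  rw [hV]
  have hor (P Q : Prop) [Decidable P] [Decidable Q] (h : P → ¬ Q) :
      (if P ∨ Q then (1 : k) else 0) = (if P then 1 else 0) + if Q then 1 else 0 := by
    by_cases hP : P <;> by_cases hQ : Q <;> simp_all
  rw [hor _ _ (by rintro ⟨_, _, h, _⟩ ⟨_, _, h2, h3⟩; grind),
    hor _ _ (by rintro ⟨_, _, h, _⟩ ⟨_, _, h2, h3⟩; grind)]
  have e1 : ((j : ℤ) = a ∧ (l : ℤ) = b) ↔ (a = j ∧ b = l) := by omega
  have e2 : (a : ℤ) + b = j + l ↔ a + b = j + l := by omega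
  simp only [e1, e2, zpow_natCast]
  push_cast
  by_cases hs : a + b = j + l
  swap
  · rw [if_neg (show ¬ (a < j ∧ l < a ∧ Even (a + l) ∧ a + b = j + l) by tauto),
      if_neg (show ¬ (b < l ∧ j < b ∧ Even (b + j) ∧ b + a = l + j) by omega),
      if_neg (show ¬ (a = j ∧ b = l) by omega), if_neg (show ¬ (a = l ∧ b = j) by omega),
      if_neg hs, if_neg (show ¬ (a = j ∧ b = l) by omega)]
    ring
  rw [if_pos hs]
  have hm : (1 : k) + (-1) ^ a * (-1) ^ l = if Even (a + l) then 2 else 0 := by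
    rw [← pow_add]
    split_ifs with h
    · rw [h.neg_one_pow]; norm_num
    · rw [(Nat.not_even_iff_odd.1 h).neg_one_pow]; norm_num
  rw [hm]
  have hbj : Even (b + j) ↔ Even (a + l) := by
    constructor <;> rintro ⟨c, hc⟩
    · exact ⟨j + l - c, by omega⟩
    · exact ⟨j + l - c, by omega⟩
  simp only [hbj, hs, show b + a = l + j by omega, and_true]
  have hsj : sgn k ((j : ℤ) - a) = (if a < j then 1 else 0) - if j < a then 1 else 0 := by
    rcases lt_trichotomy a j with h | rfl | h
    · rw [sgn_pos (by omega), if_pos h, if_neg (by omega)]; ring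
    · rw [sub_self, sgn_zero, if_neg (by omega)]; ring
    · rw [sgn_neg (by omega), if_pos h, if_neg (by omega)]; ring
  have hsl : sgn k ((a : ℤ) - l) = (if l < a then 1 else 0) - if a < l then 1 else 0 := by
    rcases lt_trichotomy a l with h | rfl | h
    · rw [sgn_neg (by omega), if_pos h, if_neg (by omega)]; ring
    · rw [sub_self, sgn_zero, if_neg (by omega)]; ring
    · rw [sgn_pos (by omega), if_pos h, if_neg (by omega)]; ring
  rw [hsj, hsl]
  have c1 : b < l ↔ j < a := by omega
  have c2 : j < b ↔ a < l := by omega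
  have c3 : (a = j ∧ b = l) ↔ a = j := by omega
  have c4 : (a = l ∧ b = j) ↔ a = l := by omega
  simp only [c1, c2, c3, c4]
  have n1 : (n : k) ≠ 0 := Nat.cast_ne_zero.2 (by omega)
  -- The crossing terms now agree on both sides and play no further role.
  generalize (if j = a + 1 ∧ b = l + 1 ∧ Even a ∧ Odd l then (1 : k) else 0) = Y₁
  generalize (if l = b + 1 ∧ a = j + 1 ∧ Even b ∧ Odd j then (1 : k) else 0) = Y₂
  clear hL hβ hV hor hm hsj hsl hbj e1 e2 c1 c2 c3 c4
  rcases lt_trichotomy a j with h1 | rfl | h1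
  · rcases lt_trichotomy a l with h2 | rfl | h2
    · simp (disch := omega) only [if_neg]
      split_ifs <;> ring
    · simp only [lt_self_iff_false, false_and, and_false, h1, h1.ne, h1.not_gt, if_true, if_false,
        Even.add_self, show ¬ b < a by omega, show a < b by omega]
      ring
    · simp (disch := omega) only [if_neg, h1, h2, true_and]
      split_ifs <;> ring
  · obtain rfl : b = l := by omega
    simp only [lt_self_iff_false, false_and, if_true, if_false]
    rcases lt_trichotomy a b with h2 | rfl | h2
    · have : Even (b - a) ↔ Even (a + b) := by grind
      simp only [this, h2, h2.ne, h2.not_gt, if_true, if_false]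
      split_ifs <;> field_simp <;> ring
    · simp
    · have : Even (a - b) ↔ Even (a + b) := by grind
      simp only [this, h2, h2.ne', h2.not_gt, if_true, if_false]
      split_ifs <;> field_simp <;> ring
  · rcases lt_trichotomy a l with h2 | rfl | h2
    · simp (disch := omega) only [if_neg, h1, h2, true_and]
      split_ifs <;> ring
    · simp only [lt_self_iff_false, false_and, and_false, h1, h1.ne', h1.not_gt, if_true, if_false,
        Even.add_self, show ¬ a < b by omega, show b < a by omega]
      ring
    · simp (disch := omega) only [if_neg]
      split_ifs <;> ring

/- ### Nilpotency and exponentials -/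

theorem pow_apply_eq_zero_of_graded {ι : Type*} [Fintype ι] [DecidableEq ι] {A : Matrix ι ι k}
    {d : ι → ℤ} (h : ∀ p q, A p q ≠ 0 → d q + 1 ≤ d p) (m : ℕ) (p q : ι)
    (hpq : d p < d q + m) : (A ^ m) p q = 0 := by
  induction m generalizing p with
  | zero =>
    rw [pow_zero, Matrix.one_apply_ne]
    rintro rfl
    simp at hpq
  | succ m ih =>
    rw [pow_succ', Matrix.mul_apply]
    refine Finset.sum_eq_zero fun i _ => ?_
    by_cases hi : A p i = 0
    · rw [hi, zero_mul]
    · have := h p i hi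
      rw [ih i (by push_cast at hpq; omega), mul_zero]

theorem isNilpotent_of_graded {ι : Type*} [Fintype ι] [DecidableEq ι] {A : Matrix ι ι k}
    (d : ι → ℤ) (h : ∀ p q, A p q ≠ 0 → d q + 1 ≤ d p) : IsNilpotent A := by
  obtain ⟨M, hM⟩ := (Set.finite_range d).bddAbove
  obtain ⟨m, hm⟩ := (Set.finite_range d).bddBelow
  refine ⟨(M - m + 1).toNat, ?_⟩
  ext p q
  refine pow_apply_eq_zero_of_graded h _ p q ?_
  have h1 := hM (Set.mem_range_self p)
  have h2 := hm (Set.mem_range_self q)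
  omega

theorem isNilpotent_smul_matE₁ (n : ℕ) (u : k) : IsNilpotent (u • matE₁ k n) := by
  refine isNilpotent_of_graded (fun a => -(a.val : ℤ)) fun p q h => ?_
  rw [Matrix.smul_apply, matE₁, Matrix.of_apply] at h
  split_ifs at h with h'
  · omega
  · simp at h

theorem isNilpotent_smul_matE₂ (n : ℕ) (t : k) : IsNilpotent (t • matE₂ k n) := by
  refine isNilpotent_of_graded (fun a => (a.val : ℤ)) fun p q h => ?_
  rw [Matrix.smul_apply, matE₂, Matrix.of_apply] at h
  split_ifs at h with h'
  · omega
  · simp at h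

/-- `A ↦ A ⊗ 1`. -/
def kronL (k : Type*) [Field k] (n : ℕ) : Mat k n →+* Mat₂ k n where
  toFun A := A ⊗ₖ (1 : Mat k n)
  map_one' := Matrix.one_kronecker_one
  map_mul' A B := by rw [← Matrix.mul_kronecker_mul, one_mul]
  map_zero' := Matrix.zero_kronecker _
  map_add' A B := Matrix.add_kronecker _ _ _

/-- `A ↦ 1 ⊗ A`. -/
def kronR (k : Type*) [Field k] (n : ℕ) : Mat k n →+* Mat₂ k n where
  toFun A := (1 : Mat k n) ⊗ₖ A
  map_one' := Matrix.one_kronecker_one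
  map_mul' A B := by rw [← Matrix.mul_kronecker_mul, one_mul]
  map_zero' := Matrix.kronecker_zero _
  map_add' A B := Matrix.kronecker_add _ _ _

theorem kronL_mul_kronR {n : ℕ} (A B : Mat k n) : kronL k n A * kronR k n B = A ⊗ₖ B := by
  change A ⊗ₖ (1 : Mat k n) * (1 : Mat k n) ⊗ₖ B = _
  rw [← Matrix.mul_kronecker_mul, mul_one, one_mul]

theorem kronR_mul_kronL {n : ℕ} (A B : Mat k n) : kronR k n B * kronL k n A = A ⊗ₖ B := by
  change (1 : Mat k n) ⊗ₖ B * A ⊗ₖ (1 : Mat k n) = _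
  rw [← Matrix.mul_kronecker_mul, mul_one, one_mul]

theorem coprod_eq {n : ℕ} (X : Mat k n) : coprod X = kronL k n X + kronR k n X := rfl

theorem commute_kronL_kronR {n : ℕ} (A B : Mat k n) : Commute (kronL k n A) (kronR k n B) := by
  rw [Commute, SemiconjBy, kronL_mul_kronR, kronR_mul_kronL]

theorem isNilpotent_coprod {n : ℕ} {X : Mat k n} (hX : IsNilpotent X) :
    IsNilpotent (coprod X) :=
  (commute_kronL_kronR X X).isNilpotent_add (hX.map _) (hX.map _)

theorem isNilpotent_adAct {n : ℕ} {X : Mat k n} (hX : IsNilpotent X) : IsNilpotent (adAct X) :=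
  LieAlgebra.ad_nilpotent_of_nilpotent (isNilpotent_coprod hX)

/-! ### The exponential of the adjoint action as conjugation. -/

theorem adAct_apply {n : ℕ} (X : Mat k n) (R : Mat₂ k n) :
    adAct X R = coprod X * R - R * coprod X := rfl

theorem adAct_smul {n : ℕ} (c : k) (X : Mat k n) : adAct (c • X) = c • adAct X := by
  have : coprod (c • X) = c • coprod X := by
    rw [coprod, coprod, Matrix.smul_kronecker, Matrix.kronecker_smul, smul_add]
  rw [adAct, this, map_smul]; rfl

theorem exp_coprod [CharZero k] {n : ℕ} {X : Mat k n} (hX : IsNilpotent X) :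
    IsNilpotent.exp (coprod X) = IsNilpotent.exp X ⊗ₖ IsNilpotent.exp X := by
  rw [coprod_eq, IsNilpotent.exp_add_of_commute (commute_kronL_kronR X X) (hX.map _) (hX.map _),
    ← IsNilpotent.map_exp hX, ← IsNilpotent.map_exp hX, kronL_mul_kronR]

/-- Left multiplication by Y is the sum of right multiplication and ad Y, which commute.
Exponentiating, with the exponentials of the multiplications being multiplications by e^Y, shows
that e^{ad Y} is conjugation by e^Y. -/
theorem exp_ad_mul_exp [CharZero k] {n : ℕ} {Y : Mat₂ k n} (hY : IsNilpotent Y) (R : Mat₂ k n) :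
    IsNilpotent.exp (LieAlgebra.ad k (Mat₂ k n) Y) R * IsNilpotent.exp Y
      = IsNilpotent.exp Y * R := by
  have hl : IsNilpotent (LinearMap.mulLeft k Y) := by rwa [LinearMap.isNilpotent_mulLeft_iff]
  have hr : IsNilpotent (LinearMap.mulRight k Y) := by rwa [LinearMap.isNilpotent_mulRight_iff]
  have had := LieAlgebra.ad_nilpotent_of_nilpotent (R := k) hY
  have hsum : LinearMap.mulLeft k Y = LinearMap.mulRight k Y + LieAlgebra.ad k (Mat₂ k n) Y := by
    rw [LieAlgebra.ad_eq_lmul_left_sub_lmul_right]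
    exact (add_sub_cancel _ _).symm
  have hcomm : Commute (LinearMap.mulRight k Y) (LieAlgebra.ad k (Mat₂ k n) Y) := by
    rw [LieAlgebra.ad_eq_lmul_left_sub_lmul_right]
    exact ((LinearMap.commute_mulLeft_right Y Y).sub_left (Commute.refl _)).symm
  have key := IsNilpotent.exp_add_of_commute hcomm hr had
  rw [← hsum] at key
  obtain ⟨N, hN⟩ := hY
  have el : IsNilpotent.exp (LinearMap.mulLeft k Y) = LinearMap.mulLeft k (IsNilpotent.exp Y) := by
    have h : LinearMap.mulLeft k Y ^ N = 0 := by
      rw [LinearMap.pow_mulLeft, hN, LinearMap.mulLeft_zero_eq_zero]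
    rw [IsNilpotent.exp_eq_sum h, IsNilpotent.exp_eq_sum hN]
    refine LinearMap.ext fun R => ?_
    simp only [LinearMap.pow_mulLeft, LinearMap.mulLeft_apply, LinearMap.sum_apply,
      Finset.sum_mul, smul_mul_assoc, LinearMap.smul_apply]
  have er : IsNilpotent.exp (LinearMap.mulRight k Y)
      = LinearMap.mulRight k (IsNilpotent.exp Y) := by
    have h : LinearMap.mulRight k Y ^ N = 0 := by
      rw [LinearMap.pow_mulRight, hN, LinearMap.mulRight_zero_eq_zero]
    rw [IsNilpotent.exp_eq_sum h, IsNilpotent.exp_eq_sum hN]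
    refine LinearMap.ext fun R => ?_
    simp only [LinearMap.pow_mulRight, LinearMap.mulRight_apply, LinearMap.sum_apply,
      Finset.mul_sum, mul_smul_comm, LinearMap.smul_apply]
  rw [el, er] at key
  exact (LinearMap.congr_fun key R).symm

/-- The adjoint action of an invertible matrix on tensors. -/
def glAct {n : ℕ} (g : (Mat k n)ˣ) : Module.End k (Mat₂ k n) where
  toFun R := (g.val ⊗ₖ g.val) * R * (g⁻¹.val ⊗ₖ g⁻¹.val)
  map_add' R S := by rw [mul_add, add_mul]
  map_smul' c R := by rw [mul_smul_comm, smul_mul_assoc]; rfl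

theorem glAct_apply {n : ℕ} (g : (Mat k n)ˣ) (R : Mat₂ k n) :
    glAct g R = (g.val ⊗ₖ g.val) * R * (g⁻¹.val ⊗ₖ g⁻¹.val) := rfl

theorem kronecker_val_mul_inv {n : ℕ} (g : (Mat k n)ˣ) :
    (g.val ⊗ₖ g.val) * (g⁻¹.val ⊗ₖ g⁻¹.val) = 1 := by
  rw [← Matrix.mul_kronecker_mul, Units.mul_inv, Matrix.one_kronecker_one]

theorem kronecker_inv_mul_val {n : ℕ} (g : (Mat k n)ˣ) :
    (g⁻¹.val ⊗ₖ g⁻¹.val) * (g.val ⊗ₖ g.val) = 1 := by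
  rw [← Matrix.mul_kronecker_mul, Units.inv_mul, Matrix.one_kronecker_one]

theorem glAct_mul {n : ℕ} (g h : (Mat k n)ˣ) (R : Mat₂ k n) :
    glAct (g * h) R = glAct g (glAct h R) := by
  simp only [glAct_apply, mul_inv_rev, Units.val_mul, Matrix.mul_kronecker_mul, mul_assoc]

theorem glAct_inv_glAct {n : ℕ} (g : (Mat k n)ˣ) (R : Mat₂ k n) : glAct g⁻¹ (glAct g R) = R := by
  rw [← glAct_mul, inv_mul_cancel, glAct_apply, inv_one, Units.val_one, Matrix.one_kronecker_one,
    one_mul, mul_one]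

theorem glAct_pow {n : ℕ} (g : (Mat k n)ˣ) (R : Mat₂ k n) (m : ℕ) :
    glAct g R ^ m = glAct g (R ^ m) := by
  induction m with
  | zero => rw [pow_zero, pow_zero, glAct_apply, mul_one, kronecker_val_mul_inv]
  | succ m ih =>
    rw [pow_succ, ih, pow_succ, glAct_apply, glAct_apply, glAct_apply]
    calc _ = (g.val ⊗ₖ g.val) * R ^ m * ((g⁻¹.val ⊗ₖ g⁻¹.val) * (g.val ⊗ₖ g.val)) * R
          * (g⁻¹.val ⊗ₖ g⁻¹.val) := by simp only [mul_assoc]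
      _ = _ := by rw [kronecker_inv_mul_val, mul_one, mul_assoc _ (R ^ m) R]

theorem isNilpotent_of_glAct {n : ℕ} {g : (Mat k n)ˣ} {R : Mat₂ k n}
    (h : IsNilpotent (glAct g R)) : IsNilpotent R := by
  obtain ⟨m, hm⟩ := h
  refine ⟨m, ?_⟩
  rw [← glAct_inv_glAct g (R ^ m), ← glAct_pow, hm, map_zero]

theorem expAct_eq_glAct [CharZero k] {n : ℕ} {X : Mat k n} (hX : IsNilpotent X) (g : (Mat k n)ˣ)
    (hg : g.val = IsNilpotent.exp X) (R : Mat₂ k n) : expAct X R = glAct g R := by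
  have h := exp_ad_mul_exp (isNilpotent_coprod hX) R
  rw [exp_coprod hX, ← hg] at h
  rw [glAct_apply, ← h, mul_assoc, kronecker_val_mul_inv, mul_one]
  rfl

theorem exists_unit_expAct [CharZero k] {n : ℕ} {X : Mat k n} (hX : IsNilpotent X) :
    ∃ g : (Mat k n)ˣ, ∀ R, expAct X R = glAct g R := by
  obtain ⟨g, hg⟩ := IsNilpotent.isUnit_exp hX
  exact ⟨g, expAct_eq_glAct hX g hg⟩

theorem expAct_eq_sum [CharZero k] {n : ℕ} {X : Mat k n} (hX : IsNilpotent X) {m : ℕ}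
    {R : Mat₂ k n} (h : (adAct X ^ m) R = 0) :
    expAct X R = ∑ i ∈ Finset.range m, ((i.factorial : ℚ)⁻¹ • (adAct X ^ i) R : Mat₂ k n) :=
  IsNilpotent.exp_smul_eq_sum (a := adAct X) (m := R) h (isNilpotent_adAct hX)

theorem expAct_of_sq [CharZero k] {n : ℕ} {X : Mat k n} (hX : IsNilpotent X) {R S : Mat₂ k n}
    (h1 : adAct X R = S) (h2 : adAct X S = 0) : expAct X R = R + S := by
  rw [expAct_eq_sum hX (m := 2) (by rw [pow_two, Module.End.mul_apply, h1, h2])]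
  simp [Finset.sum_range_succ, h1]

theorem expAct_of_cube [CharZero k] {n : ℕ} {X : Mat k n} (hX : IsNilpotent X)
    {R S T : Mat₂ k n} (h1 : adAct X R = S) (h2 : adAct X S = T) (h3 : adAct X T = 0) :
    expAct X R = R + S + (1 / 2 : k) • T := by
  rw [expAct_eq_sum hX (m := 3)
    (by rw [pow_succ, pow_two, Module.End.mul_apply, Module.End.mul_apply, h1, h2, h3])]
  have : ((2 : ℚ)⁻¹ • T : Mat₂ k n) = (1 / 2 : k) • T := by
    ext p q
    simp [Rat.smul_def]
  simp [Finset.sum_range_succ, h1, pow_two, h2, Nat.factorial, this]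

/-- Scalar matrices act trivially, so g can be rescaled by an n-th root of its inverse determinant.
-/
theorem exists_slAct_eq_glAct [IsAlgClosed k] {n : ℕ} (hn : 0 < n) (g : (Mat k n)ˣ) :
    ∃ h : Matrix.SpecialLinearGroup (Fin n) k, ∀ R, slAct h R = glAct g R := by
  have hdet : IsUnit g.val.det := (Matrix.isUnit_iff_isUnit_det _).1 g.isUnit
  obtain ⟨c, hc⟩ := IsAlgClosed.exists_pow_nat_eq (g.val.det)⁻¹ hn
  have hc0 : c ≠ 0 := by
    rintro rfl
    rw [zero_pow hn.ne'] at hc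
    exact hdet.ne_zero (inv_eq_zero.1 hc.symm)
  have h1 : (c • g.val).det = 1 := by
    rw [Matrix.det_smul, Fintype.card_fin, hc, inv_mul_cancel₀ hdet.ne_zero]
  let h : Matrix.SpecialLinearGroup (Fin n) k := ⟨c • g.val, h1⟩
  have hinv : (h⁻¹).val = c⁻¹ • g⁻¹.val := by
    have e1 : h.val * (h⁻¹).val = 1 := by
      rw [← Matrix.SpecialLinearGroup.coe_mul, mul_inv_cancel, Matrix.SpecialLinearGroup.coe_one]
    have e2 : (c⁻¹ • g⁻¹.val) * h.val = 1 := by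
      change (c⁻¹ • g⁻¹.val) * (c • g.val) = 1
      rw [smul_mul_smul_comm, inv_mul_cancel₀ hc0, Units.inv_mul, one_smul]
    exact (left_inv_eq_right_inv e2 e1).symm
  refine ⟨h, fun R => ?_⟩
  rw [slAct, hinv, glAct_apply]
  change ((c • g.val) ⊗ₖ (c • g.val)) * R * _ = _
  simp only [Matrix.smul_kronecker, Matrix.kronecker_smul, smul_mul_assoc, mul_smul_comm,
    smul_smul]
  rw [show c⁻¹ * c⁻¹ * (c * c) = 1 by field_simp, one_smul]

theorem exists_glAct_eq_slAct {n : ℕ} (h : Matrix.SpecialLinearGroup (Fin n) k) :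
    ∃ g : (Mat k n)ˣ, ∀ R, slAct h R = glAct g R := by
  refine ⟨⟨h.val, (h⁻¹).val, ?_, ?_⟩, fun R => rfl⟩
  · rw [← Matrix.SpecialLinearGroup.coe_mul, mul_inv_cancel, Matrix.SpecialLinearGroup.coe_one]
  · rw [← Matrix.SpecialLinearGroup.coe_mul, inv_mul_cancel, Matrix.SpecialLinearGroup.coe_one]

/- ### The tensors `v₁, v₂, v₃, v₄` -/

/-- The weight zero part of `r_{n-2,n}` as a tensor. -/
def tenR₀ (k : Type*) [Field k] (n : ℕ) : Mat₂ k n := truncMatrix n (opR₀ n)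
/-- `v₁` as a tensor. -/
def tenV₁ (k : Type*) [Field k] (n : ℕ) : Mat₂ k n := truncMatrix n (opV₁ n)
/-- `v₂` as a tensor. -/
def tenV₂ (k : Type*) [Field k] (n : ℕ) : Mat₂ k n := truncMatrix n (opV₂ n)
/-- `v₃` as a tensor. -/
def tenV₃ (k : Type*) [Field k] (n : ℕ) : Mat₂ k n := truncMatrix n (opV₃ n)
/-- `v₄` as a tensor. -/
def tenV₄ (k : Type*) [Field k] (n : ℕ) : Mat₂ k n := truncMatrix n opV₄

theorem bCG_eq (n : ℕ) (u t : k) : bCG n u t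
    = u • tenV₁ k n + t • tenV₂ k n + (t * u) • tenV₃ k n + (1 / 2 * t ^ 2 * u) • tenV₄ k n := rfl

theorem rCG_eq [CharZero k] {n : ℕ} (hn : Odd n) (hn3 : 3 ≤ n) :
    rCG k (n - 2) n = tenR₀ k n + (1 / 2 : k) • tenV₄ k n := rCG_eq_truncMatrix hn hn3

/-- The bridge from operators to tensors: truncation is multiplicative on operators preserving P_n.
-/
theorem adAct_truncMatrix {n : ℕ} {X : Mat k n} {E T S : Module.End k (Laurent k)}
    (hX : truncMatrix n E = coprod X) (hE : Preserves n E) (hT : Preserves n T)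
    (h : E * T - T * E = S) : adAct X (truncMatrix n T) = truncMatrix n S := by
  rw [adAct_apply, ← hX, ← truncMatrix_mul _ hT, ← truncMatrix_mul _ hE, ← truncMatrix_sub, h]

section
variable [CharZero k]

theorem adE₁_tenR₀ (n : ℕ) : adAct (matE₁ k n) (tenR₀ k n) = tenV₁ k n :=
  adAct_truncMatrix (truncMatrix_opE₁ n) (preserves_opE₁ n) (preserves_opR₀ n)
    (commutator_opE₁_opR₀ n)

theorem adE₁_tenV₁ (n : ℕ) : adAct (matE₁ k n) (tenV₁ k n) = 0 :=
  adAct_truncMatrix (truncMatrix_opE₁ n) (preserves_opE₁ n) (preserves_opV₁ n)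
    (commutator_opE₁_opV₁ n)

theorem adE₁_tenV₂ {n : ℕ} (hn : Odd n) :
    adAct (matE₁ k n) (tenV₂ k n) = (1 / 2 : k) • tenV₃ k n :=
  adAct_truncMatrix (truncMatrix_opE₁ n) (preserves_opE₁ n) (preserves_opV₂ hn)
    (commutator_opE₁_opV₂ n)

theorem adE₁_tenV₃ {n : ℕ} (hn : Odd n) : adAct (matE₁ k n) (tenV₃ k n) = 0 :=
  adAct_truncMatrix (truncMatrix_opE₁ n) (preserves_opE₁ n) (preserves_opV₃ hn)
    (commutator_opE₁_opV₃ n)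

theorem adE₁_tenV₄ {n : ℕ} (hn : Odd n) : adAct (matE₁ k n) (tenV₄ k n) = 0 :=
  adAct_truncMatrix (truncMatrix_opE₁ n) (preserves_opE₁ n) (preserves_opV₄ hn)
    commutator_opE₁_opV₄

theorem adE₂_tenR₀ {n : ℕ} (hn : Odd n) : adAct (matE₂ k n) (tenR₀ k n) = tenV₂ k n :=
  adAct_truncMatrix (truncMatrix_opE₂ n) (preserves_opE₂ hn) (preserves_opR₀ n)
    (commutator_opE₂_opR₀ n)

theorem adE₂_tenV₁ {n : ℕ} (hn : Odd n) : adAct (matE₂ k n) (tenV₁ k n) = tenV₃ k n :=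
  adAct_truncMatrix (truncMatrix_opE₂ n) (preserves_opE₂ hn) (preserves_opV₁ n)
    (commutator_opE₂_opV₁ n)

theorem adE₂_tenV₂ {n : ℕ} (hn : Odd n) : adAct (matE₂ k n) (tenV₂ k n) = 0 :=
  adAct_truncMatrix (truncMatrix_opE₂ n) (preserves_opE₂ hn) (preserves_opV₂ hn)
    (commutator_opE₂_opV₂ n)

theorem adE₂_tenV₃ {n : ℕ} (hn : Odd n) : adAct (matE₂ k n) (tenV₃ k n) = tenV₄ k n :=
  adAct_truncMatrix (truncMatrix_opE₂ n) (preserves_opE₂ hn) (preserves_opV₃ hn)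
    (commutator_opE₂_opV₃ n)

theorem adE₂_tenV₄ {n : ℕ} (hn : Odd n) : adAct (matE₂ k n) (tenV₄ k n) = 0 :=
  adAct_truncMatrix (truncMatrix_opE₂ n) (preserves_opE₂ hn) (preserves_opV₄ hn)
    commutator_opE₂_opV₄

theorem expAct_matE₁_rCG {n : ℕ} (hn : Odd n) (hn3 : 3 ≤ n) (u : k) :
    expAct (u • matE₁ k n) (rCG k (n - 2) n) = rCG k (n - 2) n + u • tenV₁ k n := by
  refine expAct_of_sq (isNilpotent_smul_matE₁ n u) ?_ ?_
  · simp only [rCG_eq hn hn3, adAct_smul, LinearMap.smul_apply, map_add, map_smul, adE₁_tenR₀,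
      adE₁_tenV₄ hn, smul_zero, add_zero]
  · simp only [adAct_smul, LinearMap.smul_apply, map_smul, adE₁_tenV₁, smul_zero]

theorem expAct_rCG {n : ℕ} (hn : Odd n) (hn3 : 3 ≤ n) (u t : k) :
    expAct (t • matE₂ k n) (expAct (u • matE₁ k n) (rCG k (n - 2) n))
      = rCG k (n - 2) n + bCG n u t := by
  rw [expAct_matE₁_rCG hn hn3, expAct_of_cube (isNilpotent_smul_matE₂ n t)
    (S := t • tenV₂ k n + (t * u) • tenV₃ k n) (T := (t ^ 2 * u) • tenV₄ k n), bCG_eq]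
  · module
  · simp only [rCG_eq hn hn3, adAct_smul, LinearMap.smul_apply, map_add, map_smul, adE₂_tenR₀ hn,
      adE₂_tenV₄ hn, adE₂_tenV₁ hn, smul_zero, add_zero]
    module
  · simp only [adAct_smul, LinearMap.smul_apply, map_add, map_smul, adE₂_tenV₂ hn,
      adE₂_tenV₃ hn, smul_zero, zero_add]
    module
  · simp only [adAct_smul, LinearMap.smul_apply, map_smul, adE₂_tenV₄ hn, smul_zero]

/-- Presents b as a conjugate of u v₁ + t v₂, whose coefficients are simpler; the Frobenius
computation is done there and transported. -/
theorem expAct_matE₂_combination {n : ℕ} (hn : Odd n) (u t : k) :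
    expAct (t • matE₂ k n) (u • tenV₁ k n + t • tenV₂ k n) = bCG n u t := by
  rw [expAct_of_cube (isNilpotent_smul_matE₂ n t)
    (S := (t * u) • tenV₃ k n) (T := (t ^ 2 * u) • tenV₄ k n), bCG_eq]
  · module
  · simp only [adAct_smul, LinearMap.smul_apply, map_add, map_smul, adE₂_tenV₂ hn,
      adE₂_tenV₁ hn, smul_zero, add_zero]
    module
  · simp only [adAct_smul, LinearMap.smul_apply, map_smul, adE₂_tenV₃ hn]
    module
  · simp only [adAct_smul, LinearMap.smul_apply, map_smul, adE₂_tenV₄ hn, smul_zero]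

theorem expAct_matE₂_rCG {n : ℕ} (hn : Odd n) (hn3 : 3 ≤ n) (t : k) :
    expAct (t • matE₂ k n) (rCG k (n - 2) n) = rCG k (n - 2) n + t • tenV₂ k n := by
  refine expAct_of_sq (isNilpotent_smul_matE₂ n t) ?_ ?_
  · simp only [rCG_eq hn hn3, adAct_smul, LinearMap.smul_apply, map_add, map_smul, adE₂_tenR₀ hn,
      adE₂_tenV₄ hn, smul_zero, add_zero]
  · simp only [adAct_smul, LinearMap.smul_apply, map_smul, adE₂_tenV₂ hn, smul_zero]

/-- Taking E₁ with parameter -u before e^{tE₂} and 2u after it cancels v₃, because [E₁,v₂] is half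
of [E₂,v₁]. The cost is a change of the coefficient of v₄, which a diagonal one-parameter subgroup
can undo. -/
theorem expAct_triple {n : ℕ} (hn : Odd n) (c u t : k) :
    expAct ((2 * u) • matE₁ k n) (expAct (t • matE₂ k n) (expAct ((-u) • matE₁ k n)
      (tenR₀ k n + c • tenV₄ k n)))
      = tenR₀ k n + (c - 1 / 2 * t ^ 2 * u) • tenV₄ k n + (u • tenV₁ k n + t • tenV₂ k n) := by
  rw [expAct_of_sq (isNilpotent_smul_matE₁ n (-u)) (S := (-u) • tenV₁ k n),
    expAct_of_cube (isNilpotent_smul_matE₂ n t) (S := t • tenV₂ k n - (t * u) • tenV₃ k n)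
      (T := (-(t ^ 2 * u)) • tenV₄ k n),
    expAct_of_sq (isNilpotent_smul_matE₁ n (2 * u))
      (S := (2 * u) • tenV₁ k n + (t * u) • tenV₃ k n)]
  · module
  · simp only [adAct_smul, LinearMap.smul_apply, map_add, map_sub, map_smul, adE₁_tenR₀,
      adE₁_tenV₁, adE₁_tenV₂ hn, adE₁_tenV₃ hn, adE₁_tenV₄ hn]
    module
  · simp only [adAct_smul, LinearMap.smul_apply, map_add, map_smul, adE₁_tenV₁, adE₁_tenV₃ hn]
    module
  · simp only [adAct_smul, LinearMap.smul_apply, map_add, map_smul, adE₂_tenR₀ hn,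
      adE₂_tenV₄ hn, adE₂_tenV₁ hn]
    module
  · simp only [adAct_smul, LinearMap.smul_apply, map_sub, map_smul, adE₂_tenV₂ hn,
      adE₂_tenV₃ hn]
    module
  · simp only [adAct_smul, LinearMap.smul_apply, map_smul, adE₂_tenV₄ hn, smul_zero]
  · simp only [adAct_smul, LinearMap.smul_apply, map_add, map_smul, adE₁_tenR₀, adE₁_tenV₄ hn]
    module
  · simp only [adAct_smul, LinearMap.smul_apply, map_smul, adE₁_tenV₁, smul_zero]

end

/- ### Weights -/

/-- The weights of a diagonal one-parameter subgroup. -/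
def wt {n : ℕ} (p : Fin n × Fin n) : ℤ :=
  -((p.1.val / 2 : ℕ) : ℤ) - 2 * ((p.1.val % 2 : ℕ) : ℤ)
    + (-((p.2.val / 2 : ℕ) : ℤ) - 2 * ((p.2.val % 2 : ℕ) : ℤ))

/-- The operator `R` is homogeneous of weight `w`. -/
def HasWeight {n : ℕ} (w : ℤ) (R : Mat₂ k n) : Prop := ∀ p q, R p q ≠ 0 → wt p = wt q + w

theorem HasWeight.mul {n : ℕ} {w w' : ℤ} {R S : Mat₂ k n} (hR : HasWeight w R)
    (hS : HasWeight w' S) : HasWeight (w + w') (R * S) := by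
  intro p q h
  rw [Matrix.mul_apply] at h
  obtain ⟨i, _, hi⟩ := Finset.exists_ne_zero_of_sum_ne_zero h
  have := hR p i (left_ne_zero_of_mul hi)
  have := hS i q (right_ne_zero_of_mul hi)
  omega

theorem HasWeight.adAct {n : ℕ} {w w' : ℤ} {X : Mat k n} {R : Mat₂ k n}
    (hX : HasWeight w (coprod X)) (hR : HasWeight w' R) : HasWeight (w + w') (adAct X R) := by
  intro p q h
  rw [adAct_apply, Matrix.sub_apply] at h
  by_cases h1 : (coprod X * R) p q = 0
  · have := (hR.mul hX) p q (by rintro h2; rw [h1, h2, sub_zero] at h; exact h rfl)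
    omega
  · exact (hX.mul hR) p q h1

theorem hasWeight_coprod {n : ℕ} {X : Mat k n} {w : ℤ}
    (h : ∀ a b, X a b ≠ 0 → -((a.val / 2 : ℕ) : ℤ) - 2 * ((a.val % 2 : ℕ) : ℤ)
      = -((b.val / 2 : ℕ) : ℤ) - 2 * ((b.val % 2 : ℕ) : ℤ) + w) : HasWeight w (coprod X) := by
  rintro ⟨a, b⟩ ⟨j, l⟩ hne
  simp only [coprod, Matrix.add_apply, Matrix.kroneckerMap_apply, Matrix.one_apply] at hne
  simp only [wt]
  by_cases h1 : X a j = 0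
  · rw [h1, zero_mul, zero_add] at hne
    have e1 : a = j := by by_contra h'; simp [h'] at hne
    have := h b l (right_ne_zero_of_mul hne)
    rw [e1]; omega
  · by_cases e1 : b = l
    · have := h a j h1
      rw [e1]; omega
    · rw [if_neg e1, mul_zero, zero_add] at hne
      have e2 : a = j := by by_contra h'; simp [h'] at hne
      have := h b l (right_ne_zero_of_mul hne)
      rw [e2]; omega

/-- The weight -⌊a/2⌋ - 2(a mod 2) of the index a is chosen so that the step from a + 2 to a made by
E₁ and the step from an odd index to its successor made by E₂ both raise it by one. -/
theorem hasWeight_coprod_matE₁ (n : ℕ) : HasWeight 1 (coprod (matE₁ k n)) := by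
  refine hasWeight_coprod fun a b h => ?_
  rw [matE₁, Matrix.of_apply] at h
  split_ifs at h
  · omega
  · exact absurd rfl h

theorem hasWeight_coprod_matE₂ (n : ℕ) : HasWeight 1 (coprod (matE₂ k n)) := by
  refine hasWeight_coprod fun a b h => ?_
  rw [matE₂, Matrix.of_apply] at h
  split_ifs at h with h'
  · obtain ⟨h1, c, hc⟩ := h'
    omega
  · exact absurd rfl h

/-- The weight of a monomial depends only on its total degree and the number of its odd exponents.
Nonzero coefficients of r₀ preserve the degree and have a ≡ l, hence b ≡ j, mod 2. -/
theorem hasWeight_tenR₀ (n : ℕ) : HasWeight 0 (tenR₀ k n) := by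
  rintro ⟨a, b⟩ ⟨j, l⟩ h
  simp only [wt]
  rw [tenR₀, truncMatrix_apply, opR₀_mono_apply] at h
  by_cases h1 : j = a ∧ l = b
  · obtain ⟨rfl, rfl⟩ := h1; omega
  · rw [if_neg (show ¬ (((j : ℕ) : ℤ) = ((a : ℕ) : ℤ) ∧ ((l : ℕ) : ℤ) = ((b : ℕ) : ℤ)) from
      fun h' => h1 ⟨Fin.ext (by omega), Fin.ext (by omega)⟩), mul_zero, mul_zero, sub_zero] at h
    split_ifs at h with h2
    · rcases Int.even_or_odd ((a : ℤ) - l) with ⟨c, hc⟩ | h3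
      · omega
      · have := neg_one_zpow_of_odd_sub (k := k) h3
        rw [this, neg_mul, ← zpow_add₀ (by norm_num), Even.neg_one_zpow (by simp)] at h
        simp at h
    · exact absurd rfl h

section
variable [CharZero k]

theorem hasWeight_tenV₁ (n : ℕ) : HasWeight 1 (tenV₁ k n) := by
  rw [← adE₁_tenR₀]; exact (hasWeight_coprod_matE₁ n).adAct (hasWeight_tenR₀ n)

theorem hasWeight_tenV₂ {n : ℕ} (hn : Odd n) : HasWeight 1 (tenV₂ k n) := by
  rw [← adE₂_tenR₀ hn]; exact (hasWeight_coprod_matE₂ n).adAct (hasWeight_tenR₀ n)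

theorem hasWeight_tenV₃ {n : ℕ} (hn : Odd n) : HasWeight 2 (tenV₃ k n) := by
  rw [← adE₂_tenV₁ hn]; exact (hasWeight_coprod_matE₂ n).adAct (hasWeight_tenV₁ n)

theorem hasWeight_tenV₄ {n : ℕ} (hn : Odd n) : HasWeight 3 (tenV₄ k n) := by
  rw [← adE₂_tenV₃ hn]; exact (hasWeight_coprod_matE₂ n).adAct (hasWeight_tenV₃ hn)

theorem isNilpotent_bCG {n : ℕ} (hn : Odd n) (u t : k) : IsNilpotent (bCG n u t) := by
  refine isNilpotent_of_graded wt fun p q h => ?_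
  rw [bCG_eq] at h
  by_contra hlt
  have h1 : tenV₁ k n p q = 0 := by
    by_contra h'; have := hasWeight_tenV₁ n p q h'; omega
  have h2 : tenV₂ k n p q = 0 := by
    by_contra h'; have := hasWeight_tenV₂ hn p q h'; omega
  have h3 : tenV₃ k n p q = 0 := by
    by_contra h'; have := hasWeight_tenV₃ hn p q h'; omega
  have h4 : tenV₄ k n p q = 0 := by
    by_contra h'; have := hasWeight_tenV₄ hn p q h'; omega
  simp [h1, h2, h3, h4] at h

end

theorem exists_unit_glAct_of_hasWeight {n : ℕ} {c : k} (hc : c ≠ 0) :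
    ∃ g : (Mat k n)ˣ, ∀ (w : ℤ) (R : Mat₂ k n), HasWeight w R → glAct g R = c ^ w • R := by
  let d : Fin n → ℤ := fun a => -((a.val / 2 : ℕ) : ℤ) - 2 * ((a.val % 2 : ℕ) : ℤ)
  refine ⟨⟨Matrix.diagonal fun a => c ^ d a, Matrix.diagonal fun a => c ^ (-d a), ?_, ?_⟩, ?_⟩
  · rw [Matrix.diagonal_mul_diagonal, ← Matrix.diagonal_one]
    congr 1; ext a
    rw [← zpow_add₀ hc, add_neg_cancel, zpow_zero]
  · rw [Matrix.diagonal_mul_diagonal, ← Matrix.diagonal_one]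
    congr 1; ext a
    rw [← zpow_add₀ hc, neg_add_cancel, zpow_zero]
  · intro w R hR
    ext ⟨a, b⟩ ⟨j, l⟩
    rw [glAct_apply]
    change ((Matrix.diagonal fun a => c ^ d a) ⊗ₖ (Matrix.diagonal fun a => c ^ d a) * R *
      ((Matrix.diagonal fun a => c ^ (-d a)) ⊗ₖ (Matrix.diagonal fun a => c ^ (-d a))) :
        Mat₂ k n) (a, b) (j, l) = _
    rw [Matrix.diagonal_kronecker_diagonal, Matrix.diagonal_kronecker_diagonal,
      Matrix.mul_diagonal, Matrix.diagonal_mul, Matrix.smul_apply, smul_eq_mul]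
    by_cases h : R (a, b) (j, l) = 0
    · rw [h]; ring
    · have := hR _ _ h
      have h1 : w = d a + d b + (-d j + -d l) := by
        simp only [wt] at this; simp only [d]; omega
      rw [h1, zpow_add₀ hc, zpow_add₀ hc, zpow_add₀ hc]; ring

/- ### Nonvanishing and non-nilpotency -/

theorem opV₁_mono_apply (n : ℕ) (j l a b : ℤ) : (opV₁ n (mono j l) : Laurent k) (a, b)
    = 1 / 4 * (if a + b + 2 = j + l then
        (1 + (-1) ^ a * (-1) ^ l) * (sgn k (j - a - 1) + sgn k (a + 1 - l))
        + ((-1) ^ j - (-1) ^ l) * (if j = a + 1 then 1 else 0) else 0)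
      - 1 / (4 * n) * ((2 * ((a : k) + 2) - (1 - (-1) ^ a)) * (if j = a + 2 ∧ l = b then 1 else 0)
        - (2 * ((b : k) + 2) - (1 - (-1) ^ b)) * (if j = a ∧ l = b + 2 then 1 else 0)) := by
  rw [opV₁_eq, LinearMap.sub_apply, Finsupp.sub_apply, LinearMap.smul_apply, LinearMap.smul_apply,
    Finsupp.smul_apply, Finsupp.smul_apply, opW_mono_apply, opU_apply, mono_apply, mono_apply,
    smul_eq_mul, smul_eq_mul]

theorem truncMatrix_pow {n : ℕ} {T : Module.End k (Laurent k)} (hT : Preserves n T) (m : ℕ) :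
    truncMatrix n (T ^ (m + 1)) = truncMatrix n T ^ (m + 1) := by
  induction m with
  | zero => simp
  | succ m ih => rw [pow_succ, truncMatrix_mul _ hT, ih, pow_succ _ (m + 1)]

/-- Nilpotency as an operator on kⁿ ⊗ kⁿ is invariant under conjugation and nonzero scaling. -/
theorem mk_notMem_projOrbit {n : ℕ} {R S : Mat₂ k n} (hR : ¬ IsNilpotent R) (hS : IsNilpotent S)
    (hS0 : S ≠ 0) : Projectivization.mk k S hS0 ∉ projOrbit R := by
  rintro ⟨g, hg, h⟩
  obtain ⟨c, hc⟩ := (Projectivization.mk_eq_mk_iff' k _ _ _ _).1 h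
  obtain ⟨g', hg'⟩ := exists_glAct_eq_slAct g
  apply hR
  have hc0 : c ≠ 0 := by rintro rfl; exact hS0 (by rw [← hc, zero_smul])
  have : slAct g R = c⁻¹ • S := by rw [← hc, smul_smul, inv_mul_cancel₀ hc0, one_smul]
  refine isNilpotent_of_glAct (g := g') ?_
  rw [← hg', this]
  exact hS.smul _

section
variable [CharZero k]

/-- The operators v₁, v₂, v₃, v₄ change the total degree by -2, 1, -1, 0. So the coefficient of 1 in
the image of x₁² sees only u v₁, and that of x₁² in the image of x₁ only t v₂; they are u(1 - 1/n)
and -½t(1 - 1/n). -/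
theorem bCG_ne_zero {n : ℕ} (hn3 : 3 ≤ n) {u t : k} (h : (u, t) ≠ (0, 0)) : bCG n u t ≠ 0 := by
  intro hb
  have hn0 : (n : k) ≠ 0 := by norm_cast; omega
  have hn1 : (n : k) - 1 ≠ 0 := sub_ne_zero.2 (by norm_cast; omega)
  have entry : ∀ a b j l : Fin n, u * (opV₁ n (mono (j : ℕ) (l : ℕ)) : Laurent k) ((a : ℕ), (b : ℕ))
      + t * (opV₂ n (mono (j : ℕ) (l : ℕ)) : Laurent k) ((a : ℕ), (b : ℕ))
      + t * u * (opV₃ n (mono (j : ℕ) (l : ℕ)) : Laurent k) ((a : ℕ), (b : ℕ))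
      + 1 / 2 * t ^ 2 * u * (opV₄ (mono (j : ℕ) (l : ℕ)) : Laurent k) ((a : ℕ), (b : ℕ)) = 0 :=
    fun a b j l => congrFun (congrFun hb (a, b)) (j, l)
  have h1 := entry ⟨0, by omega⟩ ⟨0, by omega⟩ ⟨2, by omega⟩ ⟨0, by omega⟩
  have h2 := entry ⟨2, by omega⟩ ⟨0, by omega⟩ ⟨1, by omega⟩ ⟨0, by omega⟩
  simp only [opV₁_mono_apply, opV₂_apply, opV₃_apply, opV₄_apply, mono_apply] at h1 h2
  norm_num [sgn] at h1 h2
  apply h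
  have hu : u = 0 := by
    rcases h1 with h1 | h1
    · exact h1
    · exfalso
      field_simp at h1
      apply hn1
      linear_combination h1
  have ht : t = 0 := by
    rcases h2 with h2 | h2
    · exact h2
    · exfalso
      field_simp at h2
      apply hn1
      linear_combination -(1 / 2 : k) * h2
  rw [hu, ht]

/-! ### The invariant plane spanned by x₁ and x₂, on which the square of r_{n-2,n} is a nonzero
scalar. -/

theorem opR_mono_one_zero (n : ℕ) : (opR n (mono 1 0) : Laurent k)
    = (1 / 2 : k) • mono 0 1 - (1 / (2 * n) : k) • mono 1 0 := by
  refine Finsupp.ext fun ⟨a, b⟩ => ?_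
  simp only [opR, LinearMap.add_apply, LinearMap.smul_apply, Finsupp.add_apply, Finsupp.sub_apply,
    Finsupp.smul_apply, opR₀_mono_apply, opV₄_apply, mono_apply, smul_eq_mul]
  by_cases h : a + b = 1
  · obtain rfl : b = 1 - a := by omega
    rcases (by omega : a < 0 ∨ a = 0 ∨ a = 1 ∨ a = 2 ∨ 2 < a) with h | rfl | rfl | rfl | h
    · rw [sgn_pos (show 0 < 1 - a by omega), sgn_neg (show a - 0 < 0 by omega)]
      simp [show ¬ a = 0 by omega, show ¬ 1 = a by omega, show ¬ 1 = a - 1 by omega,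
        show ¬ 0 = a by omega]
    · norm_num [sgn, show Int.sign 2 = 1 from rfl]
    · norm_num [sgn, show Int.sign 2 = 1 from rfl]
    · norm_num [sgn, show Int.sign 2 = 1 from rfl]
    · rw [sgn_neg (show 1 - a < 0 by omega), sgn_pos (show 0 < a - 0 by omega)]
      simp [show ¬ a = 0 by omega, show ¬ 1 = a by omega, show ¬ 1 = a - 1 by omega,
        show ¬ 0 = a by omega]
  · simp only [show ¬ a + b = 1 + 0 by omega, show ¬ (1 = a ∧ 0 = b) by omega,
      show ¬ (0 = a ∧ 1 = b) by omega, show ¬ (1 = a + 1 ∧ 0 = b - 1) by omega,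
      show ¬ (1 = a - 1 ∧ 0 = b + 1) by omega, if_false]
    ring

theorem opR_mono_zero_one (n : ℕ) : (opR n (mono 0 1) : Laurent k)
    = (1 / (2 * n) : k) • mono 0 1 - (1 / 2 : k) • mono 1 0 := by
  refine Finsupp.ext fun ⟨a, b⟩ => ?_
  simp only [opR, LinearMap.add_apply, LinearMap.smul_apply, Finsupp.add_apply, Finsupp.sub_apply,
    Finsupp.smul_apply, opR₀_mono_apply, opV₄_apply, mono_apply, smul_eq_mul]
  by_cases h : a + b = 1
  · obtain rfl : b = 1 - a := by omega
    rcases (by omega : a < -1 ∨ a = -1 ∨ a = 0 ∨ a = 1 ∨ 1 < a) with h | rfl | rfl | rfl | h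
    · rw [sgn_pos (show 0 < 0 - a by omega), sgn_neg (show a - 1 < 0 by omega)]
      simp [show ¬ 0 = a + 1 by omega, show ¬ 1 = a by omega, show ¬ 0 = a - 1 by omega,
        show ¬ 0 = a by omega]
    · norm_num [sgn, show Int.sign 2 = 1 from rfl]
    · norm_num [sgn, show Int.sign 2 = 1 from rfl]
    · norm_num [sgn, show Int.sign 2 = 1 from rfl]
    · rw [sgn_neg (show 0 - a < 0 by omega), sgn_pos (show 0 < a - 1 by omega)]
      simp [show ¬ 0 = a + 1 by omega, show ¬ 1 = a by omega, show ¬ 0 = a - 1 by omega,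
        show ¬ 0 = a by omega]
  · simp only [show ¬ a + b = 0 + 1 by omega, show ¬ (1 = a ∧ 0 = b) by omega,
      show ¬ (0 = a ∧ 1 = b) by omega, show ¬ (0 = a + 1 ∧ 1 = b - 1) by omega,
      show ¬ (0 = a - 1 ∧ 1 = b + 1) by omega, if_false]
    ring

theorem not_isNilpotent_rCG {n : ℕ} (hn : Odd n) (hn3 : 3 ≤ n) :
    ¬ IsNilpotent (rCG k (n - 2) n) := by
  rintro ⟨m, hm⟩
  have hn0 : (n : k) ≠ 0 := by norm_cast; omega
  have hc : (1 / (4 * n ^ 2) - 1 / 4 : k) ≠ 0 := by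
    intro h
    field_simp at h
    have : ((n ^ 2 : ℕ) : k) = (1 : ℕ) := by push_cast; linear_combination -h
    have := Nat.cast_injective this
    nlinarith
  have hsq : ((opR n ^ 2 : Module.End k (Laurent k)) (mono 1 0))
      = (1 / (4 * n ^ 2) - 1 / 4 : k) • mono 1 0 := by
    rw [pow_two, Module.End.mul_apply, opR_mono_one_zero, map_sub, map_smul, map_smul,
      opR_mono_one_zero, opR_mono_zero_one]
    match_scalars <;> field_simp <;> ring
  have hpow : ∀ i : ℕ, ((opR n ^ 2 : Module.End k (Laurent k)) ^ i) (mono 1 0)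
      = (1 / (4 * n ^ 2) - 1 / 4 : k) ^ i • mono 1 0 := by
    intro i
    induction i with
    | zero => simp
    | succ i ih =>
      rw [pow_succ, Module.End.mul_apply, hsq, map_smul, ih, smul_smul, ← pow_succ']
  have hP : Preserves n (opR n : Module.End k (Laurent k)) :=
    (preserves_opR₀ n).add ((preserves_opV₄ hn).smul _)
  -- The exponent 2m + 2 is at least m, is even so that the square applies, and is positive as
  -- `truncMatrix_pow` requires.
  have h0 : truncMatrix n ((opR n : Module.End k (Laurent k)) ^ (2 * m + 1 + 1)) = 0 := by
    rw [truncMatrix_pow hP, ← rCG_eq_truncMatrix hn hn3, show 2 * m + 1 + 1 = m + (m + 2) by ring,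
      pow_add, hm, zero_mul]
  have h1 := congrFun (congrFun h0 (⟨1, by omega⟩, ⟨0, by omega⟩)) (⟨1, by omega⟩, ⟨0, by omega⟩)
  rw [truncMatrix_apply, show 2 * m + 1 + 1 = 2 * (m + 1) by ring, pow_mul] at h1
  simp only [Nat.cast_one, Nat.cast_zero, hpow, Finsupp.smul_apply, mono_apply, and_self, if_true,
    smul_eq_mul, mul_one, Matrix.zero_apply] at h1
  exact pow_ne_zero _ hc h1

theorem rCG_ne_zero {n : ℕ} (hn : Odd n) (hn3 : 3 ≤ n) : rCG k (n - 2) n ≠ 0 :=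
  fun h => not_isNilpotent_rCG (k := k) hn hn3 (h ▸ IsNilpotent.zero)

end

/- ### The boundary of the orbit -/

theorem evalAt_smul {n d : ℕ} {P : MvPolynomial ((Fin n × Fin n) × (Fin n × Fin n)) k}
    (hP : P.IsHomogeneous d) (c : k) (R : Mat₂ k n) : evalAt P (c • R) = c ^ d * evalAt P R := by
  rw [evalAt, evalAt, MvPolynomial.eval_eq, MvPolynomial.eval_eq, Finset.mul_sum]
  refine Finset.sum_congr rfl fun m hm => ?_
  have h1 : ∑ i ∈ m.support, m i = d := by
    have := hP (MvPolynomial.mem_support_iff.1 hm)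
    rw [Finsupp.weight_apply] at this
    simpa [Finsupp.sum] using this
  simp only [Matrix.smul_apply, smul_eq_mul, mul_pow, Finset.prod_mul_distrib]
  rw [Finset.prod_pow_eq_pow_sum, h1]
  ring

/-- Homogeneity moves the vanishing from chosen representatives of points of the orbit to every
conjugate of R itself. -/
theorem evalAt_glAct_eq_zero [IsAlgClosed k] {n d : ℕ} (hn : 0 < n)
    {P : MvPolynomial ((Fin n × Fin n) × (Fin n × Fin n)) k} (hP : P.IsHomogeneous d)
    {R : Mat₂ k n} (hR : R ≠ 0) (h : ∀ q ∈ projOrbit R, evalAt P q.rep = 0) (g : (Mat k n)ˣ) :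
    evalAt P (glAct g R) = 0 := by
  obtain ⟨g', hg'⟩ := exists_slAct_eq_glAct hn g
  have hne : slAct g' R ≠ 0 := by
    intro h0
    rw [hg'] at h0
    exact hR (by rw [← glAct_inv_glAct g R, h0, map_zero])
  have h1 := h _ ⟨g', hne, rfl⟩
  obtain ⟨a, ha⟩ := Projectivization.exists_smul_eq_mk_rep k (slAct g' R) hne
  rw [← ha, Units.smul_def, evalAt_smul hP] at h1
  rw [← hg']
  exact (mul_eq_zero.1 h1).resolve_left (pow_ne_zero _ a.ne_zero)

/-- An algebraic limit s → 0: on the line P is a polynomial in s, its product with D vanishes on an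
infinite field, so it is zero, even if D vanishes at 0. -/
theorem evalAt_eq_zero_of_line [Infinite k] {n : ℕ}
    (P : MvPolynomial ((Fin n × Fin n) × (Fin n × Fin n)) k) (A B : Mat₂ k n)
    {D : Polynomial k} (hD : D ≠ 0)
    (h : ∀ s : k, D.eval s ≠ 0 → evalAt P (B + s • A) = 0) : evalAt P B = 0 := by
  let Q : Polynomial k := MvPolynomial.eval₂ Polynomial.C
    (fun p => Polynomial.C (B p.1 p.2) + Polynomial.X * Polynomial.C (A p.1 p.2)) P
  have hQ : ∀ s, Q.eval s = evalAt P (B + s • A) := by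
    intro s
    have h1 := MvPolynomial.eval₂_comp_left (Polynomial.evalRingHom s) Polynomial.C
      (fun p => Polynomial.C (B p.1 p.2) + Polynomial.X * Polynomial.C (A p.1 p.2)) P
    rw [Polynomial.coe_evalRingHom] at h1
    change Polynomial.eval s _ = _
    rw [h1, evalAt, MvPolynomial.eval, MvPolynomial.coe_eval₂Hom]
    congr 1
    · ext; simp
    · funext p; simp only [Function.comp_apply, Polynomial.eval_add, Polynomial.eval_mul, Polynomial.eval_X,
        Polynomial.eval_C, Matrix.add_apply, Matrix.smul_apply, smul_eq_mul]
  have h0 : Q * D = 0 := by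
    refine Polynomial.funext fun s => ?_
    rw [Polynomial.eval_mul, Polynomial.eval_zero, hQ]
    by_cases hs : D.eval s = 0
    · rw [hs, mul_zero]
    · rw [h s hs, zero_mul]
  have h2 := hQ 0
  rw [(mul_eq_zero.1 h0).resolve_right hD, Polynomial.eval_zero, zero_smul, add_zero] at h2
  exact h2.symm

section
variable [CharZero k] [IsAlgClosed k]

/-- A diagonal matrix scales v₄ by c³ and fixes r₀; with c³ = 1 + t²u/s³ the loss in `expAct_triple`
at parameters u/s, t/s is made good, giving r + s⁻¹(u v₁ + t v₂). Then e^{tE₂} sends r to r + t v₂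
and u v₁ + t v₂ to b. The condition on s says c ≠ 0. -/
theorem exists_glAct_rCG_eq {n : ℕ} (hn : Odd n) (hn3 : 3 ≤ n) (u t : k) {s : k} (hs : s ≠ 0)
    (h : s ^ 3 + t ^ 2 * u ≠ 0) :
    ∃ g, glAct g (rCG k (n - 2) n) = rCG k (n - 2) n + t • tenV₂ k n + s⁻¹ • bCG n u t := by
  obtain ⟨c, hc⟩ := IsAlgClosed.exists_pow_nat_eq (1 + (s⁻¹) ^ 3 * (t ^ 2 * u)) (n := 3) (by norm_num)
  have hc0 : c ≠ 0 := by
    rintro rfl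
    apply h
    field_simp at hc
    linear_combination -hc
  obtain ⟨g₀, hg₀⟩ := exists_unit_glAct_of_hasWeight (n := n) hc0
  obtain ⟨g₁, hg₁⟩ := exists_unit_expAct (isNilpotent_smul_matE₁ n (-(s⁻¹ * u)))
  obtain ⟨g₂, hg₂⟩ := exists_unit_expAct (isNilpotent_smul_matE₂ n (s⁻¹ * t))
  obtain ⟨g₃, hg₃⟩ := exists_unit_expAct (isNilpotent_smul_matE₁ n (2 * (s⁻¹ * u)))
  obtain ⟨g₄, hg₄⟩ := exists_unit_expAct (isNilpotent_smul_matE₂ n t)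
  refine ⟨g₄ * (g₃ * (g₂ * (g₁ * g₀))), ?_⟩
  have hz : (1 / 2 * c ^ (3 : ℤ) : k) = c ^ 3 / 2 := by
    rw [show (3 : ℤ) = ((3 : ℕ) : ℤ) from rfl, zpow_natCast]; ring
  have h0 : glAct g₀ (rCG k (n - 2) n) = tenR₀ k n + (c ^ 3 / 2) • tenV₄ k n := by
    rw [rCG_eq hn hn3, map_add, map_smul, hg₀ _ _ (hasWeight_tenR₀ n),
      hg₀ _ _ (hasWeight_tenV₄ hn), zpow_zero, one_smul, smul_smul, hz]
  rw [glAct_mul, glAct_mul, glAct_mul, glAct_mul, h0, ← hg₁, ← hg₂, ← hg₃, ← hg₄,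
    expAct_triple hn, hc]
  have h1 : tenR₀ k n + ((1 + s⁻¹ ^ 3 * (t ^ 2 * u)) / 2 - 1 / 2 * (s⁻¹ * t) ^ 2 * (s⁻¹ * u))
      • tenV₄ k n + ((s⁻¹ * u) • tenV₁ k n + (s⁻¹ * t) • tenV₂ k n)
      = rCG k (n - 2) n + s⁻¹ • (u • tenV₁ k n + t • tenV₂ k n) := by
    rw [rCG_eq hn hn3]
    match_scalars <;> ring
  rw [h1, map_add, map_smul, expAct_matE₂_rCG hn hn3, expAct_matE₂_combination hn]

theorem mk_bCG_mem_orbitBoundary {n : ℕ} (hn : Odd n) (hn3 : 3 ≤ n) {u t : k}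
    (hb : bCG n u t ≠ 0) :
    Projectivization.mk k (bCG n u t) hb ∈ orbitBoundary (rCG k (n - 2) n) := by
  refine ⟨fun d P hP h => ?_,
    mk_notMem_projOrbit (not_isNilpotent_rCG hn hn3) (isNilpotent_bCG hn u t) hb⟩
  obtain ⟨a, ha⟩ := Projectivization.exists_smul_eq_mk_rep k (bCG n u t) hb
  rw [← ha, Units.smul_def, evalAt_smul hP]
  refine mul_eq_zero_of_right _ ?_
  have hD : (Polynomial.X * (Polynomial.X ^ 3 + Polynomial.C (t ^ 2 * u)) : Polynomial k) ≠ 0 :=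
    mul_ne_zero Polynomial.X_ne_zero (Polynomial.X_pow_add_C_ne_zero (by norm_num) _)
  refine evalAt_eq_zero_of_line P (rCG k (n - 2) n + t • tenV₂ k n) _ hD fun s hs => ?_
  simp only [Polynomial.eval_mul, Polynomial.eval_X, Polynomial.eval_add, Polynomial.eval_pow,
    Polynomial.eval_C] at hs
  have hs0 := left_ne_zero_of_mul hs
  obtain ⟨g, hg⟩ := exists_glAct_rCG_eq hn hn3 u t hs0 (right_ne_zero_of_mul hs)
  have h1 := evalAt_glAct_eq_zero (by omega) hP (rCG_ne_zero hn hn3) h g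
  have h2 : bCG n u t + s • (rCG k (n - 2) n + t • tenV₂ k n)
      = s • glAct g (rCG k (n - 2) n) := by
    rw [hg, smul_add _ (_ + _), smul_smul, mul_inv_cancel₀ hs0, one_smul, add_comm]
  rw [h2, evalAt_smul hP, h1, mul_zero]

end

/- ### The commutator of `v₁`, `v₂` with the Frobenius element -/

/-- Multiplication by x₁² commutes with v₂, since it does not change parities. -/
theorem opV₂_shift (n : ℕ) (a b j l : ℤ) :
    (opV₂ n (mono (j + 2) l) : Laurent k) (a, b) = (opV₂ n (mono j l) : Laurent k) (a - 2, b) := by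
  have e1 : (-1 : k) ^ (a - 2) = (-1) ^ a := by
    rw [← neg_one_zpow_add_two (a - 2), sub_add_cancel]
  simp only [opV₂_apply, mono_apply, e1, show (j + 2 = a - 1) ↔ (j = a - 2 - 1) by omega,
    show (j + 2 = a) ↔ (j = a - 2) by omega]

theorem opV₂_apply_eq_zero (n : ℕ) {a b j l : ℤ} (h1 : j ≠ a - 1) (h2 : j ≠ a) :
    (opV₂ n (mono j l) : Laurent k) (a, b) = 0 := by
  simp only [opV₂_apply, mono_apply, h1, h2, false_and, if_false]; ring

section
variable [CharZero k]

/-- In operator form this is [v₁, x₁²] = σ - 1/n, the source of the Frobenius functional: σ is the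
tensor of the trace form, and contracting it with Y ↦ tr(XY) returns X. -/
theorem opV₁_shift {n : ℕ} (hn0 : n ≠ 0) (a b j l : ℤ) :
    (opV₁ n (mono (j + 2) l) : Laurent k) (a, b) - (opV₁ n (mono j l) : Laurent k) (a - 2, b)
      = (if b = j ∧ l = a then 1 else 0) - 1 / n * (if j = a ∧ l = b then 1 else 0) := by
  have hn : (n : k) ≠ 0 := by exact_mod_cast hn0
  have e1 : (-1 : k) ^ (a - 2) = (-1) ^ a := by
    rw [← neg_one_zpow_add_two (a - 2), sub_add_cancel]
  rw [opV₁_mono_apply, opV₁_mono_apply]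
  simp only [neg_one_zpow_add_two, e1, show (a - 2 + b + 2 = j + l) ↔ (a + b = j + l) by omega,
    show (a + b + 2 = j + 2 + l) ↔ (a + b = j + l) by omega,
    show (j + 2 = a + 1) ↔ (j = a - 2 + 1) by omega, show (j + 2 = a + 2) ↔ (j = a) by omega,
    show (j = a - 2 + 2) ↔ (j = a) by omega, show (j + 2 = a) ↔ (j = a - 2) by omega,
    show j + 2 - a - 1 = j - (a - 2) - 1 by ring]
  -- The two signs differ only for |a - l| ≤ 1, and the parity factor removes a - l = ±1.
  have key : (1 + (-1 : k) ^ a * (-1) ^ l) * (sgn k (a + 1 - l) - sgn k (a - 2 + 1 - l))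
      = 4 * if l = a then 1 else 0 := by
    rcases (by omega : a + 1 < l ∨ l = a + 1 ∨ l = a ∨ l = a - 1 ∨ l < a - 1) with h | h | h | h | h
    · rw [sgn_neg (show a + 1 - l < 0 by omega), sgn_neg (show a - 2 + 1 - l < 0 by omega),
        if_neg (by omega)]; ring
    · rw [if_neg (by omega), neg_one_zpow_of_odd_sub (k := k) (x := a) (y := l) ⟨-1, by omega⟩,
        neg_mul, ← zpow_add₀ (by norm_num), Even.neg_one_zpow (by simp)]; ring
    · rw [if_pos h, h, sgn_pos (show 0 < a + 1 - a by omega),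
        sgn_neg (show a - 2 + 1 - a < 0 by omega), ← zpow_add₀ (by norm_num),
        Even.neg_one_zpow (by simp)]; norm_num
    · rw [if_neg (by omega), neg_one_zpow_of_odd_sub (k := k) (x := a) (y := l) ⟨0, by omega⟩,
        neg_mul, ← zpow_add₀ (by norm_num), Even.neg_one_zpow (by simp)]; ring
    · rw [sgn_pos (show 0 < a + 1 - l by omega), sgn_pos (show 0 < a - 2 + 1 - l by omega),
        if_neg (by omega)]; ring
  have hs : (if b = j ∧ l = a then (1 : k) else 0)
      = if a + b = j + l then (if l = a then 1 else 0) else 0 := by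
    rw [← ite_and]
    exact if_congr (by omega) rfl rfl
  rw [hs]
  push_cast
  by_cases h : a + b = j + l
  · simp only [if_pos h]
    field_simp
    linear_combination (n : k) * key
  · simp only [if_neg h]
    field_simp
    ring

/-- For l ≤ a the two signs cancel. The only other case is l = n - 1 = a + 1, where the parity
factor vanishes. -/
theorem opV₁_apply_of_lt {n : ℕ} (hn : Odd n) {b j l : ℤ} {a : ℤ} (ha : a = n - 1 ∨ a = n - 2)
    (hj : j < a) (hl : l < n) :
    (opV₁ n (mono j l) : Laurent k) (a, b) = 0 := by
  obtain ⟨c, hc⟩ := hn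
  rw [opV₁_mono_apply]
  simp only [show ¬ j = a + 1 by omega, show ¬ j = a + 2 by omega, show ¬ j = a by omega,
    false_and, if_false, mul_zero, add_zero, sub_zero]
  rw [sgn_neg (show j - a - 1 < 0 by omega)]
  by_cases h : l < a + 1
  · rw [sgn_pos (show 0 < a + 1 - l by omega)]; simp
  · rw [neg_one_zpow_of_odd_sub (k := k) (x := a) (y := l) ⟨-1, by omega⟩,
      neg_mul, ← zpow_add₀ (by norm_num), Even.neg_one_zpow (by simp)]
    simp

theorem opV₁_apply_diag {n : ℕ} (hn : Odd n) {b l : ℤ} {a : ℤ} (ha : a = n - 1 ∨ a = n - 2)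
    (hl : l < n) : (opV₁ n (mono a l) : Laurent k) (a, b)
      = 1 / (4 * n) * ((2 * ((b : k) + 2) - (1 - (-1) ^ b)) * (if l = b + 2 then 1 else 0)) := by
  obtain ⟨c, hc⟩ := hn
  rw [opV₁_mono_apply]
  simp only [show ¬ a = a + 1 by omega, show ¬ a = a + 2 by omega, true_and,
    false_and, if_false, mul_zero, add_zero]
  rw [sgn_neg (show a - a - 1 < 0 by omega)]
  by_cases h : l < a + 1
  · rw [sgn_pos (show 0 < a + 1 - l by omega)]; simp
  · rw [neg_one_zpow_of_odd_sub (k := k) (x := a) (y := l) ⟨-1, by omega⟩,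
      neg_mul, ← zpow_add₀ (by norm_num), Even.neg_one_zpow (by simp)]
    simp

/-- The values of `v₁` on monomials just outside the range are those of `v₂`. -/
theorem opV₁_boundary {n : ℕ} (hn : Odd n) {p q b l : ℤ} (hp : p = n - 1 ∨ p = n - 2)
    (hq : q = n - 1 ∨ q = n - 2) (hl : l < n) :
    (opV₁ n (mono (p + 2) l) : Laurent k) (q, b)
      = -(if p = n - 1 then (opV₂ n (mono (n - 2) l) : Laurent k) (q, b) else 0)
        + (if q = n - 2 then (opV₂ n (mono p l) : Laurent k) (n - 1, b) else 0) := by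
  have hn0 : (n : k) ≠ 0 := by
    rintro h; obtain ⟨c, rfl⟩ := hn; norm_cast at h
  obtain ⟨c, hc⟩ := hn
  have e1 : (-1 : k) ^ ((n : ℤ) - 1) = 1 := Even.neg_one_zpow ⟨c, by omega⟩
  have e2 : (-1 : k) ^ ((n : ℤ) - 2) = -1 := Odd.neg_one_zpow ⟨c - 1, by omega⟩
  have e0 : (-1 : k) ^ (n : ℤ) = -1 := Odd.neg_one_zpow ⟨c, by omega⟩
  have e3 : (-1 : k) ^ ((n : ℤ) - 1 + 2) = 1 := Even.neg_one_zpow ⟨c + 1, by omega⟩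
  have e4 : (-1 : k) ^ ((n : ℤ) - 2 + 2) = -1 := Odd.neg_one_zpow ⟨c, by omega⟩
  rw [opV₁_mono_apply, opV₂_apply, opV₂_apply]
  simp only [mono_apply]
  have hodd : l = n - 1 → (-1 : k) ^ l = 1 := fun h => h ▸ e1
  -- The sign is 1 unless l = n - 1, and then l is even and both sides vanish.
  have hsg : (1 - (-1 : k) ^ l) * (1 + sgn k (n - 1 - l)) = 2 * (1 - (-1 : k) ^ l) := by
    rcases (by omega : l = n - 1 ∨ l < n - 1) with h | h
    · rw [hodd h]; ring
    · rw [sgn_pos (show 0 < (n : ℤ) - 1 - l by omega)]; ring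
  rcases hp with rfl | rfl <;> rcases hq with rfl | rfl
  · by_cases h : l = b
    · subst h
      rw [sgn_pos (show 0 < (n : ℤ) - 1 + 2 - (n - 1) - 1 by omega),
        sgn_pos (show 0 < (n : ℤ) - 1 + 1 - l by omega)]
      simp only [e1, e3, if_true, if_false,
        show (n : ℤ) - 1 + l + 2 = n - 1 + 2 + l by ring, show ¬ (n : ℤ) - 1 + 2 = n - 1 + 1 by omega,
        true_and, show ¬ (n : ℤ) - 1 + 2 = n - 1 by omega, false_and,
        show (n : ℤ) - 2 = n - 1 - 1 by ring, show ¬ (n : ℤ) - 1 - 1 = n - 1 by omega,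
        show ¬ (n : ℤ) - 1 = n - 1 - 1 by omega]
      push_cast
      field_simp
      ring
    · simp only [show ¬ ((n : ℤ) - 1 + b + 2 = n - 1 + 2 + l) by omega, h, and_false, if_false,
        show ¬ (n : ℤ) - 1 + 2 = n - 1 by omega, show ¬ (n : ℤ) - 2 = n - 1 by omega, false_and,
        show ¬ (n : ℤ) - 1 = n - 2 by omega]
      simp
  · by_cases h : b = l + 1
    · subst h
      have hl1 : (-1 : k) ^ (l + 1) = -(-1) ^ l := neg_one_zpow_add_one l
      rw [sgn_pos (show 0 < (n : ℤ) - 1 + 2 - (n - 2) - 1 by omega),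
        show (n : ℤ) - 2 + 1 - l = n - 1 - l by ring]
      simp only [e1, e2, e3, if_true, show (n : ℤ) - 2 + (l + 1) + 2 = n - 1 + 2 + l by ring,
        show ¬ (n : ℤ) - 1 + 2 = n - 2 + 1 by omega, hl1,
        show ¬ (n : ℤ) - 1 + 2 = n - 2 + 2 by omega, show ¬ (n : ℤ) - 1 + 2 = n - 2 by omega,
        false_and, if_false, show ¬ (n : ℤ) - 2 = n - 2 - 1 by omega, true_and, add_sub_cancel_right,
        show ¬ (n : ℤ) - 1 = n - 1 - 1 by omega]
      linear_combination (1 / 4 : k) * hsg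
    · simp only [show ¬ ((n : ℤ) - 2 + b + 2 = n - 1 + 2 + l) by omega, if_false, if_true,
        show ¬ (n : ℤ) - 1 + 2 = n - 2 + 2 by omega, show ¬ (n : ℤ) - 1 + 2 = n - 2 by omega,
        show ¬ l = b - 1 by omega, and_false, false_and, show ¬ (n : ℤ) - 2 = n - 2 - 1 by omega,
        show ¬ (n : ℤ) - 1 = n - 1 - 1 by omega]
      simp
  · by_cases h : b = l - 1
    · subst h
      have hl1 : (-1 : k) ^ (l - 1) = -(-1) ^ l := neg_one_zpow_sub_one l
      rw [show (n : ℤ) - 2 + 2 - (n - 1) - 1 = 0 by ring, sgn_zero,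
        sgn_pos (show 0 < (n : ℤ) - 1 + 1 - l by omega)]
      simp only [e1, if_true, show (n : ℤ) - 1 + (l - 1) + 2 = n - 2 + 2 + l by ring,
        show (n : ℤ) - 2 + 2 = n - 1 + 1 by ring, 
        show ¬ (n : ℤ) - 1 + 1 = n - 1 + 2 by omega, show ¬ (n : ℤ) - 1 + 1 = n - 1 by omega,
        false_and, if_false, show ¬ (n : ℤ) - 2 = n - 1 by omega,
        show ¬ (n : ℤ) - 1 = n - 2 by omega]
      have e5 : (-1 : k) ^ ((n : ℤ) - 1 + 1) = -1 := by rw [sub_add_cancel, e0]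
      rw [e5]
      ring
    · simp only [show ¬ ((n : ℤ) - 1 + b + 2 = n - 2 + 2 + l) by omega, if_false, 
        show ¬ (n : ℤ) - 2 + 2 = n - 1 + 2 by omega, show ¬ (n : ℤ) - 2 + 2 = n - 1 by omega,
        false_and, show ¬ (n : ℤ) - 2 = n - 1 by omega,
        show ¬ (n : ℤ) - 1 = n - 2 by omega]
      simp
  · by_cases h : l = b
    · subst h
      rw [sgn_pos (show 0 < (n : ℤ) - 2 + 2 - (n - 2) - 1 by omega),
        show (n : ℤ) - 2 + 1 - l = n - 1 - l by ring]
      simp only [e1, e2, e4, if_true, show (n : ℤ) - 2 + l + 2 = n - 2 + 2 + l by ring,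
        show ¬ (n : ℤ) - 2 + 2 = n - 2 + 1 by omega, true_and, and_self,
        show ¬ (n : ℤ) - 2 + 2 = n - 2 by omega, show ¬ (n : ℤ) - 2 = n - 1 by omega,
        false_and, if_false, show (n : ℤ) - 1 - 1 = n - 2 by ring]
      push_cast
      field_simp
      linear_combination (n : k) * hsg
    · simp only [show ¬ ((n : ℤ) - 2 + b + 2 = n - 2 + 2 + l) by omega, h, and_false, if_false,
        show ¬ (n : ℤ) - 2 + 2 = n - 2 by omega, show ¬ (n : ℤ) - 2 = n - 1 by omega, false_and,
        if_true]
      simp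

end

/- ### Skew tensors over `sl_n` -/

/-- The tensor with the two legs exchanged. -/
def swapLegs {n : ℕ} (R : Mat₂ k n) : Mat₂ k n := R.submatrix Prod.swap Prod.swap

/-- Skew tensors. -/
def IsSkew {n : ℕ} (R : Mat₂ k n) : Prop := swapLegs R = -R

theorem IsSkew.apply {n : ℕ} {R : Mat₂ k n} (hR : IsSkew R) (a b j l : Fin n) :
    R (b, a) (l, j) = -R (a, b) (j, l) := congrFun (congrFun hR (a, b)) (j, l)

theorem IsSkew.add {n : ℕ} {R S : Mat₂ k n} (hR : IsSkew R) (hS : IsSkew S) : IsSkew (R + S) := by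
  ext ⟨a, b⟩ ⟨j, l⟩
  change R (b, a) (l, j) + S (b, a) (l, j) = -(R (a, b) (j, l) + S (a, b) (j, l))
  rw [hR.apply, hS.apply]; ring

theorem IsSkew.smul {n : ℕ} {R : Mat₂ k n} (c : k) (hR : IsSkew R) : IsSkew (c • R) := by
  ext ⟨a, b⟩ ⟨j, l⟩
  change c * R (b, a) (l, j) = -(c * R (a, b) (j, l))
  rw [hR.apply]; ring

theorem swapLegs_mul {n : ℕ} (R S : Mat₂ k n) : swapLegs (R * S) = swapLegs R * swapLegs S :=
  (Matrix.submatrix_mul_equiv R S Prod.swap (Equiv.prodComm (Fin n) (Fin n)) Prod.swap).symm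

theorem swapLegs_kronecker {n : ℕ} (A B : Mat k n) : swapLegs (A ⊗ₖ B) = B ⊗ₖ A := by
  ext ⟨a, b⟩ ⟨j, l⟩
  exact mul_comm _ _

theorem IsSkew.adAct {n : ℕ} {R : Mat₂ k n} (hR : IsSkew R) (X : Mat k n) :
    IsSkew (adAct X R) := by
  have h : swapLegs (coprod X) = coprod X := by
    change swapLegs (X ⊗ₖ 1) + swapLegs (1 ⊗ₖ X) = _
    rw [swapLegs_kronecker, swapLegs_kronecker, add_comm]; rfl
  rw [IsSkew, adAct_apply]
  change swapLegs (coprod X * R) - swapLegs (R * coprod X) = _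
  rw [swapLegs_mul, swapLegs_mul, h, show swapLegs R = -R from hR, mul_neg, neg_mul]
  abel

/-- The partial trace over the first leg. -/
def partialTrace {n : ℕ} : Mat₂ k n →ₗ[k] Mat k n where
  toFun R := Matrix.of fun b l => ∑ a, R (a, b) (a, l)
  map_add' R S := by ext b l; simp [Finset.sum_add_distrib]
  map_smul' c R := by ext b l; simp [Finset.mul_sum]

theorem partialTrace_apply {n : ℕ} (R : Mat₂ k n) (b l : Fin n) :
    partialTrace R b l = ∑ a, R (a, b) (a, l) := rfl

theorem hom_ext_kronecker {n : ℕ} {M : Type*} [AddCommMonoid M] [Module k M]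
    {f g : Mat₂ k n →ₗ[k] M} (h : ∀ A B : Mat k n, f (A ⊗ₖ B) = g (A ⊗ₖ B)) : f = g := by
  refine Matrix.ext_linearMap _ fun ⟨a, b⟩ ⟨j, l⟩ => LinearMap.ext_ring ?_
  have := h (Matrix.single a j 1) (Matrix.single b l 1)
  rwa [Matrix.single_kronecker_single, mul_one] at this

theorem partialTrace_kronecker {n : ℕ} (A B : Mat k n) : partialTrace (A ⊗ₖ B) = A.trace • B := by
  ext b l
  rw [partialTrace_apply, Matrix.smul_apply, Matrix.trace, smul_eq_mul, Finset.sum_mul]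
  rfl

/-- A commutator in the first leg has trace zero, so only the action on the second leg survives.
Thus vanishing of the partial trace is inherited from r₀. -/
theorem partialTrace_adAct {n : ℕ} (X : Mat k n) (R : Mat₂ k n) :
    partialTrace (adAct X R) = X * partialTrace R - partialTrace R * X := by
  suffices h : partialTrace ∘ₗ adAct X
      = (LinearMap.mulLeft k X - LinearMap.mulRight k X) ∘ₗ partialTrace from
    LinearMap.congr_fun h R
  refine hom_ext_kronecker fun A B => ?_
  have h1 : adAct X (A ⊗ₖ B) = (X * A - A * X) ⊗ₖ B + A ⊗ₖ (X * B - B * X) := by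
    rw [adAct_apply, coprod, add_mul, mul_add, ← Matrix.mul_kronecker_mul,
      ← Matrix.mul_kronecker_mul, ← Matrix.mul_kronecker_mul, ← Matrix.mul_kronecker_mul,
      one_mul, one_mul, mul_one, mul_one]
    ext ⟨a, b⟩ ⟨j, l⟩
    simp only [Matrix.add_apply, Matrix.sub_apply, Matrix.kroneckerMap_apply]
    ring
  simp only [LinearMap.comp_apply, h1, map_add, partialTrace_kronecker, Matrix.trace_sub,
    Matrix.trace_mul_comm X A, sub_self, zero_smul, zero_add, LinearMap.sub_apply,
    LinearMap.mulLeft_apply, LinearMap.mulRight_apply, mul_smul_comm, smul_mul_assoc, smul_sub]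

/-- Expand R along elementary matrices in the first leg and make these traceless by subtracting
multiples of 1; the total correction is the partial trace, which is zero. The second legs are
traceless by skewness. -/
theorem mem_slWedge {n : ℕ} [CharZero k] (hn : n ≠ 0) {R : Mat₂ k n} (hR : IsSkew R)
    (ht : partialTrace R = 0) : R ∈ slWedge k n := by
  have hn' : (n : k) ≠ 0 := by exact_mod_cast hn
  let A : Fin n → Fin n → Mat k n := fun a j =>
    Matrix.single a j 1 - (if a = j then (1 / n : k) else 0) • 1
  let B : Fin n → Fin n → Mat k n := fun a j => Matrix.of fun b l => R (a, b) (j, l)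
  have hsum : R = ∑ a, ∑ j, A a j ⊗ₖ B a j := by
    ext ⟨a, b⟩ ⟨j, l⟩
    simp only [Matrix.sum_apply, Matrix.kroneckerMap_apply, A, B, Matrix.sub_apply,
      Matrix.smul_apply, Matrix.of_apply, sub_mul, Finset.sum_sub_distrib, smul_eq_mul, ite_mul,
      zero_mul, Finset.sum_ite_eq, Finset.mem_univ, if_true, Matrix.single_apply, ite_and, one_mul]
    have h0 : ∑ i, R (i, b) (i, l) = 0 := congrFun (congrFun ht b) l
    simp only [mul_assoc, ← Finset.mul_sum]
    rw [h0]
    simp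
  have hA : ∀ a j, A a j ∈ LieAlgebra.SpecialLinear.sl (Fin n) k := by
    intro a j
    change (A a j).trace = 0
    by_cases h : a = j
    · simp [A, h, hn']
    · simp [A, h]
  have hB : ∀ a j, B a j ∈ LieAlgebra.SpecialLinear.sl (Fin n) k := by
    intro a j
    have h0 : ∑ i, R (i, a) (i, j) = 0 := congrFun (congrFun ht a) j
    change ∑ b, R (a, b) (j, b) = 0
    simp only [hR.apply _ a _ j, Finset.sum_neg_distrib, h0, neg_zero]
  have hw : R = ∑ a, ∑ j, wedge (A a j) (B a j) := by
    have h1 : R = (1 / 2 : k) • (R - swapLegs R) := by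
      rw [show swapLegs R = -R from hR]; module
    have h2 : swapLegs R = ∑ a, ∑ j, B a j ⊗ₖ A a j := by
      conv_lhs => rw [hsum]
      ext ⟨a, b⟩ ⟨j, l⟩
      simp only [swapLegs, Matrix.submatrix_apply, Matrix.sum_apply, Matrix.kroneckerMap_apply,
        Prod.swap_prod_mk, mul_comm]
    rw [h1, h2]
    conv_lhs => rw [hsum]
    simp only [wedge, ← Finset.sum_sub_distrib, ← Finset.smul_sum]
  rw [hw]
  exact Submodule.sum_mem _ fun a _ => Submodule.sum_mem _ fun j _ =>
    Submodule.subset_span ⟨_, hA a j, _, hB a j, rfl⟩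

/- ### Tensors over a parabolic subalgebra -/

/-- Block triangular matrices. -/
def IsBlock {n : ℕ} (m : ℕ) (X : Mat k n) : Prop :=
  ∀ j l : Fin n, m ≤ j.val → l.val < m → X j l = 0

theorem IsBlock.mul {n m : ℕ} {X Y : Mat k n} (hX : IsBlock m X) (hY : IsBlock m Y) :
    IsBlock m (X * Y) := by
  intro j l hj hl
  rw [Matrix.mul_apply]
  refine Finset.sum_eq_zero fun i _ => ?_
  rcases lt_or_ge i.val m with h | h
  · rw [hX j i hj h, zero_mul]
  · rw [hY i l h hl, mul_zero]

/-- The first leg of `R` is block triangular. -/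
def IsBlock₁ {n : ℕ} (m : ℕ) (R : Mat₂ k n) : Prop :=
  ∀ a b j l : Fin n, m ≤ a.val → j.val < m → R (a, b) (j, l) = 0

theorem IsBlock₁.add {n m : ℕ} {R S : Mat₂ k n} (hR : IsBlock₁ m R) (hS : IsBlock₁ m S) :
    IsBlock₁ m (R + S) := fun a b j l h1 h2 => by
  rw [Matrix.add_apply, hR a b j l h1 h2, hS a b j l h1 h2, add_zero]

theorem IsBlock₁.smul {n m : ℕ} {R : Mat₂ k n} (c : k) (hR : IsBlock₁ m R) :
    IsBlock₁ m (c • R) := fun a b j l h1 h2 => by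
  rw [Matrix.smul_apply, hR a b j l h1 h2, smul_zero]

theorem IsBlock₁.adAct {n m : ℕ} {R : Mat₂ k n} (hR : IsBlock₁ m R) {X : Mat k n}
    (hX : IsBlock m X) : IsBlock₁ m (adAct X R) := by
  intro a b j l h1 h2
  rw [adAct_apply, Matrix.sub_apply, Matrix.mul_apply, Matrix.mul_apply]
  rw [Finset.sum_eq_zero, Finset.sum_eq_zero, sub_zero]
  · rintro ⟨i, i'⟩ _
    rcases lt_or_ge i.val m with h | h
    · rw [hR a b i i' h1 h, zero_mul]
    · have hij : i ≠ j := by rintro rfl; omega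
      simp [coprod, hX i j h h2, hij]
  · rintro ⟨i, i'⟩ _
    rcases lt_or_ge i.val m with h | h
    · have hij : a ≠ i := by rintro rfl; omega
      simp [coprod, hX a i h1 h, hij]
    · rw [hR i i' j l h h2, mul_zero]

theorem contract_apply {n : ℕ} (R : Mat₂ k n) (ξ : Module.Dual k (Mat k n)) (b l : Fin n) :
    contract R ξ b l = ξ (Matrix.of fun a j => R (a, b) (j, l)) := rfl

/-- Skew tensors with both legs in the parabolic subalgebra `𝔭_{m,n}`. -/
structure IsParabolicTensor {n : ℕ} (m : ℕ) (R : Mat₂ k n) : Prop where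
  skew : IsSkew R
  partialTrace_eq_zero : partialTrace R = 0
  block : IsBlock₁ m R

namespace IsParabolicTensor

theorem slice_mem {n m : ℕ} {R : Mat₂ k n} (hR : IsParabolicTensor m R) (b l : Fin n) :
    (Matrix.of fun a j => R (a, b) (j, l)) ∈ maxParabolic k m n :=
  ⟨congrFun (congrFun hR.partialTrace_eq_zero b) l, fun a j h1 h2 => hR.block a b j l h1 h2⟩

theorem contract_mem {n m : ℕ} {R : Mat₂ k n} (hR : IsParabolicTensor m R)
    (ξ : Module.Dual k (Mat k n)) : contract R ξ ∈ maxParabolic k m n := by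
  refine ⟨?_, fun b l h1 h2 => ?_⟩
  · rw [Matrix.trace]
    simp only [Matrix.diag_apply, contract_apply, ← map_sum]
    convert map_zero ξ
    ext a j
    rw [Matrix.sum_apply]
    simp only [Matrix.of_apply, hR.skew.apply _ a _ j, Finset.sum_neg_distrib]
    rw [← partialTrace_apply, hR.partialTrace_eq_zero, Matrix.zero_apply, neg_zero]
  · rw [contract_apply]
    convert map_zero ξ
    ext a j
    rw [Matrix.of_apply, hR.skew.apply b a l j, hR.block b a l j h1 h2, neg_zero]
    rfl

theorem contract_congr {n m : ℕ} {R : Mat₂ k n} (hR : IsParabolicTensor m R)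
    {ξ η : Module.Dual k (Mat k n)} (h : ∀ Y ∈ maxParabolic k m n, ξ Y = η Y) :
    contract R ξ = contract R η := by
  ext b l
  exact h _ (hR.slice_mem b l)

end IsParabolicTensor

/- ### Frobenius functionals -/

/-- A parabolic tensor is inverse to the form of a functional as soon as it is a left inverse. -/
theorem isFrobeniusFunctionalOf_of_contract {n m : ℕ} {R : Mat₂ k n} (hR : IsParabolicTensor m R)
    (Φ : Module.Dual k (Mat k n))
    (h : ∀ X ∈ maxParabolic k m n,
      contract R (Φ ∘ₗ (LieAlgebra.ad k (Mat k n) X : Module.End k (Mat k n))) = X) :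
    IsFrobeniusFunctionalOf R (maxParabolic k m n)
      (Φ.domRestrict (maxParabolic k m n).toSubmodule) := by
  set P := maxParabolic k m n
  have hform : ∀ X Y : P, lieForm P (Φ.domRestrict P.toSubmodule) X Y
      = (Φ ∘ₗ (LieAlgebra.ad k (Mat k n) X.1 : Module.End k (Mat k n))) Y.1 := fun X Y => rfl
  have hleft : (lieForm P (Φ.domRestrict P.toSubmodule)).SeparatingLeft := by
    intro X hX
    have h1 := h X.1 X.2
    -- For X in the radical the functional φ([X,·]) vanishes on the parabolic, and the contraction
    -- depends only on that restriction, so X = 0.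
    rw [hR.contract_congr (η := 0) fun Y hY => ?_, map_zero] at h1
    · exact Subtype.ext h1.symm
    · rw [← hform X ⟨Y, hY⟩, hX]; rfl
  have hnd : (lieForm P (Φ.domRestrict P.toSubmodule)).Nondegenerate := by
    refine ⟨hleft, fun Y hY => hleft Y fun X => ?_⟩
    have h1 : lieForm P (Φ.domRestrict P.toSubmodule) Y X
        = -lieForm P (Φ.domRestrict P.toSubmodule) X Y := by
      change (Φ.domRestrict P.toSubmodule) ⁅Y, X⁆ = -(Φ.domRestrict P.toSubmodule) ⁅X, Y⁆
      rw [← lie_skew, map_neg]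
    rw [h1, hY X, neg_zero]
  refine ⟨hnd, (LinearMap.BilinForm.toDual _ hnd).symm, fun ξ => ?_, fun X Y => ?_⟩
  · set X := (LinearMap.BilinForm.toDual _ hnd).symm (ξ.domRestrict P.toSubmodule) with hX
    rw [← h X.1 X.2]
    refine hR.contract_congr fun Y hY => ?_
    rw [← hform X ⟨Y, hY⟩, ← LinearMap.BilinForm.toDual_def hnd, hX, LinearEquiv.apply_symm_apply]
    rfl
  · rw [LinearEquiv.symm_symm, LinearMap.BilinForm.toDual_def]
    rfl

theorem carrier_eq_of_contract {n m : ℕ} {R : Mat₂ k n} (hR : IsParabolicTensor m R)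
    (Φ : Module.Dual k (Mat k n))
    (h : ∀ X ∈ maxParabolic k m n,
      contract R (Φ ∘ₗ (LieAlgebra.ad k (Mat k n) X : Module.End k (Mat k n))) = X) :
    carrier R = (maxParabolic k m n).toSubmodule := by
  refine le_antisymm ?_ fun X hX => ⟨_, h X hX⟩
  rintro _ ⟨ξ, rfl⟩
  exact hR.contract_mem ξ

/-- Evaluating the Yang–Baxter expression on ξ₁ ⊗ ξ₂ ⊗ ξ₃ gives the cyclic sum of ξ₁([řξ₂, řξ₃]);
skewness is used to bring the contracted leg into first place. -/
theorem CYB_apply_of_isSkew {n : ℕ} {R : Mat₂ k n} (hR : IsSkew R) (p q : Fin n × Fin n × Fin n) :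
    CYB 0 R p q
      = ⁅contract R (Matrix.entryLinearMap k k p.2.1 q.2.1),
          contract R (Matrix.entryLinearMap k k p.2.2 q.2.2)⁆ p.1 q.1
      + ⁅contract R (Matrix.entryLinearMap k k p.2.2 q.2.2),
          contract R (Matrix.entryLinearMap k k p.1 q.1)⁆ p.2.1 q.2.1
      + ⁅contract R (Matrix.entryLinearMap k k p.1 q.1),
          contract R (Matrix.entryLinearMap k k p.2.1 q.2.1)⁆ p.2.2 q.2.2 := by
  obtain ⟨a₁, a₂, a₃⟩ := p
  obtain ⟨j₁, j₂, j₃⟩ := q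
  simp only [CYB, Ring.lie_def, leg₁₂, leg₁₃, leg₂₃, zero_smul, Matrix.add_apply,
    Matrix.sub_apply, Matrix.mul_apply, Matrix.of_apply, Fintype.sum_prod_type, contract_apply,
    Matrix.entryLinearMap_apply, ite_mul, mul_ite, zero_mul, mul_zero, Finset.sum_ite_eq,
    Finset.sum_ite_eq', Finset.mem_univ, if_true, Finset.sum_const_zero, Finset.sum_ite_irrel]
  have h1 : ∀ x, R (a₁, a₂) (x, j₂) * R (x, a₃) (j₁, j₃)
      = R (a₂, a₁) (j₂, x) * R (a₃, x) (j₃, j₁) := fun x => by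
    rw [hR.apply a₂ a₁, hR.apply a₃ x]; ring
  have h2 : ∀ x, R (a₁, a₃) (x, j₃) * R (x, a₂) (j₁, j₂)
      = R (a₃, a₁) (j₃, x) * R (a₂, x) (j₂, j₁) := fun x => by
    rw [hR.apply a₃ a₁, hR.apply a₂ x]; ring
  have h3 : ∀ x, R (a₁, a₂) (j₁, x) * R (x, a₃) (j₂, j₃)
      = -(R (a₁, a₂) (j₁, x) * R (a₃, x) (j₃, j₂)) := fun x => by
    rw [hR.apply a₃ x]; ring
  have h4 : ∀ x, R (a₂, a₃) (x, j₃) * R (a₁, x) (j₁, j₂)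
      = -(R (a₃, a₂) (j₃, x) * R (a₁, x) (j₁, j₂)) := fun x => by
    rw [hR.apply a₃ a₂]; ring
  simp only [h1, h2, h3, h4, Finset.sum_neg_distrib, Matrix.zero_apply]
  ring

/-- Since ξ(Y) = φ([řξ, Y]) on the parabolic, the cyclic sum is φ applied to a Jacobi sum. -/
theorem CYB_eq_zero_of_isFrobenius {n m : ℕ} {R : Mat₂ k n} (hR : IsSkew R)
    {φ : Module.Dual k (maxParabolic k m n)}
    (h : IsFrobeniusFunctionalOf R (maxParabolic k m n) φ) : CYB 0 R = 0 := by
  obtain ⟨-, rCheck, h1, h2⟩ := h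
  have key : ∀ (ξ : Module.Dual k (Mat k n)) (Y : maxParabolic k m n),
      ξ Y = φ ⁅rCheck (ξ.domRestrict (maxParabolic k m n).toSubmodule), Y⁆ := by
    intro ξ Y
    rw [h2, LinearEquiv.symm_apply_apply]; rfl
  ext p q
  rw [CYB_apply_of_isSkew hR, ← h1, ← h1, ← h1]
  set ξ₁ := Matrix.entryLinearMap k k p.1 q.1
  set ξ₂ := Matrix.entryLinearMap k k p.2.1 q.2.1
  set ξ₃ := Matrix.entryLinearMap k k p.2.2 q.2.2
  set X₁ := rCheck (ξ₁.domRestrict (maxParabolic k m n).toSubmodule) with hX₁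
  set X₂ := rCheck (ξ₂.domRestrict (maxParabolic k m n).toSubmodule) with hX₂
  set X₃ := rCheck (ξ₃.domRestrict (maxParabolic k m n).toSubmodule) with hX₃
  change ξ₁ (⁅X₂, X₃⁆ : maxParabolic k m n) + ξ₂ (⁅X₃, X₁⁆ : maxParabolic k m n)
    + ξ₃ (⁅X₁, X₂⁆ : maxParabolic k m n) = 0
  rw [key ξ₁, key ξ₂, key ξ₃, ← map_add, ← map_add, ← hX₁, ← hX₂, ← hX₃, lie_jacobi, map_zero]

/- ### `r_{n-2,n}` is skew with vanishing partial trace -/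

theorem isSkew_tenR₀ (n : ℕ) : IsSkew (tenR₀ k n) := by
  ext ⟨a, b⟩ ⟨j, l⟩
  change tenR₀ k n (b, a) (l, j) = -tenR₀ k n (a, b) (j, l)
  rw [tenR₀, truncMatrix_apply, truncMatrix_apply, opR₀_mono_apply, opR₀_mono_apply]
  simp only [show ((b : ℕ) : ℤ) + (a : ℕ) = (l : ℕ) + (j : ℕ) ↔
      ((a : ℕ) : ℤ) + (b : ℕ) = (j : ℕ) + (l : ℕ) by omega,
    show (((l : ℕ) : ℤ) = (b : ℕ) ∧ ((j : ℕ) : ℤ) = (a : ℕ)) ↔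
      (((j : ℕ) : ℤ) = (a : ℕ) ∧ ((l : ℕ) : ℤ) = (b : ℕ)) from and_comm]
  by_cases h : ((a : ℕ) : ℤ) + (b : ℕ) = (j : ℕ) + (l : ℕ)
  · rw [if_pos h, if_pos h, show ((l : ℕ) : ℤ) - (b : ℕ) = -(((j : ℕ) : ℤ) - (a : ℕ)) by omega,
      show ((b : ℕ) : ℤ) - (j : ℕ) = -(((a : ℕ) : ℤ) - (l : ℕ)) by omega, sgn_neg_arg, sgn_neg_arg]
    have hs : (-1 : k) ^ ((b : ℕ) : ℤ) * (-1) ^ ((j : ℕ) : ℤ)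
        = (-1) ^ ((a : ℕ) : ℤ) * (-1) ^ ((l : ℕ) : ℤ) := by
      rw [← zpow_add₀ (by norm_num), ← zpow_add₀ (by norm_num)]
      exact neg_one_zpow_of_even_sub ⟨((j : ℕ) : ℤ) - (a : ℕ), by omega⟩
    rw [hs]
    ring
  · rw [if_neg h, if_neg h]; ring

theorem isBlock_matE₂ {n : ℕ} (hn : Odd n) : IsBlock (n - 2) (matE₂ k n) := by
  intro j l h1 h2
  rw [matE₂, Matrix.of_apply, if_neg]
  rintro ⟨h3, c, hc⟩
  obtain ⟨d, hd⟩ := hn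
  omega

theorem IsParabolicTensor.add {n m : ℕ} {R S : Mat₂ k n} (hR : IsParabolicTensor m R)
    (hS : IsParabolicTensor m S) : IsParabolicTensor m (R + S) :=
  ⟨hR.1.add hS.1, by rw [map_add, hR.2, hS.2, add_zero], hR.3.add hS.3⟩

theorem IsParabolicTensor.smul {n m : ℕ} {R : Mat₂ k n} (c : k) (hR : IsParabolicTensor m R) :
    IsParabolicTensor m (c • R) :=
  ⟨hR.1.smul c, by rw [map_smul, hR.2, smul_zero], hR.3.smul c⟩

theorem IsParabolicTensor.adAct {n m : ℕ} {R : Mat₂ k n} (hR : IsParabolicTensor m R)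
    {X : Mat k n} (hX : IsBlock m X) : IsParabolicTensor m (adAct X R) :=
  ⟨hR.1.adAct X, by rw [partialTrace_adAct, hR.2, mul_zero, zero_mul, sub_zero], hR.3.adAct hX⟩

section
variable [CharZero k]

theorem sum_range_parity_mul_sgn (l m : ℕ) :
    ∑ a ∈ Finset.range m, (1 + (-1 : k) ^ (a : ℤ) * (-1) ^ (l : ℤ)) * sgn k (a - l)
      = if m ≤ l then -((m : k) + (-1) ^ (l : ℤ) * (1 - (-1) ^ (m : ℤ)) / 2)
        else (m : k) + (-1) ^ (l : ℤ) * (1 - (-1) ^ (m : ℤ)) / 2 - 2 * l - 1 - (-1) ^ (l : ℤ) := by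
  induction m with
  | zero => simp
  | succ m ih =>
    rw [Finset.sum_range_succ, ih]
    have hp : (-1 : k) ^ ((m + 1 : ℕ) : ℤ) = -(-1) ^ (m : ℤ) := by
      push_cast; exact neg_one_zpow_add_one _
    rw [hp]
    rcases lt_trichotomy m l with h | h | h
    · rw [if_pos (show m ≤ l by omega), if_pos (show m + 1 ≤ l by omega),
        sgn_neg (show (m : ℤ) - l < 0 by omega)]
      push_cast
      ring
    · subst h
      have hsq : (-1 : k) ^ (m : ℤ) * (-1) ^ (m : ℤ) = 1 := by
        rw [← zpow_add₀ (by norm_num), Even.neg_one_zpow ⟨_, rfl⟩]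
      rw [if_pos le_rfl, if_neg (show ¬ m + 1 ≤ m by omega), sub_self, sgn_zero]
      push_cast
      linear_combination (0 : k) * hsq
    · rw [if_neg (show ¬ m ≤ l by omega), if_neg (show ¬ m + 1 ≤ l by omega),
        sgn_pos (show 0 < (m : ℤ) - l by omega)]
      push_cast
      ring

/-- On the diagonal, for odd n, the alternating terms cancel, and the sign part and the linear part
both sum to (n - 1 - 2b)/4. -/
theorem partialTrace_tenR₀ {n : ℕ} (hn : Odd n) : partialTrace (tenR₀ k n) = 0 := by
  have hn0 : (n : k) ≠ 0 := by
    rintro h; obtain ⟨c, rfl⟩ := hn; norm_cast at h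
  have hodd : (-1 : k) ^ (n : ℤ) = -1 := Odd.neg_one_zpow (by exact_mod_cast hn)
  ext b l
  rw [partialTrace_apply, Matrix.zero_apply]
  simp only [tenR₀, truncMatrix_apply, opR₀_mono_apply, sub_self, sgn_zero, zero_add, true_and]
  by_cases h : b = l
  · subst h
    simp only [if_true, mul_one, Finset.sum_sub_distrib, ← Finset.mul_sum, Int.cast_natCast]
    have h1 := sum_range_parity_mul_sgn (k := k) b n
    rw [← Fin.sum_univ_eq_sum_range
      (fun a => (1 + (-1 : k) ^ (a : ℤ) * (-1) ^ ((b : ℕ) : ℤ)) * sgn k (a - (b : ℕ))),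
      if_neg (show ¬ n ≤ (b : ℕ) by omega), hodd] at h1
    rw [h1]
    have h2 : ∑ a : Fin n, ((a : ℕ) : k) = n * (n - 1) / 2 := by
      rw [Fin.sum_univ_eq_sum_range (fun a => (a : k))]
      have h3 := Finset.sum_range_id_mul_two n
      have h4 : ((∑ i ∈ Finset.range n, i : ℕ) : k) * 2 = n * ((n - 1 : ℕ) : k) := by
        exact_mod_cast h3
      rw [Nat.cast_sub hn.pos, Nat.cast_sum, Nat.cast_one] at h4
      linear_combination (1 / 2 : k) * h4
    rw [h2]
    simp only [Finset.sum_const, Finset.card_univ, Fintype.card_fin, nsmul_eq_mul]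
    field_simp
    ring
  · have h1 : ¬ ((l : ℕ) : ℤ) = (b : ℕ) := fun h' => h (Fin.ext (by omega))
    refine Finset.sum_eq_zero fun a _ => ?_
    rw [if_neg (show ¬ ((a : ℕ) : ℤ) + (b : ℕ) = (a : ℕ) + (l : ℕ) by omega), if_neg h1]
    ring

/- ### The tensors `v₁, …, v₄` are parabolic -/

theorem isParabolicTensor_tenV₁ {n : ℕ} (hn : Odd n) : IsParabolicTensor (n - 2) (tenV₁ k n) := by
  refine ⟨?_, ?_, fun a b j l h1 h2 => ?_⟩
  · rw [← adE₁_tenR₀]; exact (isSkew_tenR₀ n).adAct _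
  · rw [← adE₁_tenR₀, partialTrace_adAct, partialTrace_tenR₀ hn, mul_zero, zero_mul, sub_zero]
  · have := a.isLt
    have := l.isLt
    rw [tenV₁, truncMatrix_apply]
    exact opV₁_apply_of_lt hn (by omega) (by omega) (by omega)

theorem isParabolicTensor_tenV₂ {n : ℕ} (hn : Odd n) : IsParabolicTensor (n - 2) (tenV₂ k n) := by
  refine ⟨?_, ?_, fun a b j l h1 h2 => ?_⟩
  · rw [← adE₂_tenR₀ hn]; exact (isSkew_tenR₀ n).adAct _
  · rw [← adE₂_tenR₀ hn, partialTrace_adAct, partialTrace_tenR₀ hn, mul_zero, zero_mul, sub_zero]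
  · rw [tenV₂, truncMatrix_apply]
    -- With j < n - 2 ≤ a this forces a = n - 2, which is odd, and v₂ raises no exponent to an odd
    -- one in the first variable.
    by_cases h : ((j : ℕ) : ℤ) = (a : ℕ) - 1
    · obtain ⟨c, hc⟩ := hn
      have ho : (-1 : k) ^ ((a : ℕ) : ℤ) = -1 := Odd.neg_one_zpow ⟨c - 1, by omega⟩
      rw [opV₂_apply, mono_apply, mono_apply, ho, if_neg (show ¬ (((j : ℕ) : ℤ) = (a : ℕ) ∧ _) by
        omega)]
      ring
    · exact opV₂_apply_eq_zero n h (by omega)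

theorem isParabolicTensor_bCG {n : ℕ} (hn : Odd n) (u t : k) :
    IsParabolicTensor (n - 2) (bCG n u t) := by
  have h1 := isParabolicTensor_tenV₁ (k := k) hn
  have h3 := h1.adAct (isBlock_matE₂ hn)
  rw [adE₂_tenV₁ hn] at h3
  have h4 := h3.adAct (isBlock_matE₂ hn)
  rw [adE₂_tenV₃ hn] at h4
  rw [bCG_eq]
  exact (((h1.smul _).add ((isParabolicTensor_tenV₂ hn).smul _)).add (h3.smul _)).add (h4.smul _)

end

/- ### Contraction with trace functionals -/

/-- The functional `Y ↦ tr (M Y)`. -/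
def tracePair {n : ℕ} (M : Mat k n) : Module.Dual k (Mat k n) :=
  Matrix.traceLinearMap (Fin n) k k ∘ₗ LinearMap.mulLeft k M

theorem tracePair_apply {n : ℕ} (M Y : Mat k n) : tracePair M Y = (M * Y).trace := rfl

theorem tracePair_comp_ad {n : ℕ} (M X : Mat k n) :
    tracePair M ∘ₗ (LieAlgebra.ad k (Mat k n) X : Module.End k (Mat k n))
      = tracePair (M * X - X * M) := by
  ext1 Y
  change (M * (X * Y - Y * X)).trace = ((M * X - X * M) * Y).trace
  rw [mul_sub, sub_mul, Matrix.trace_sub, Matrix.trace_sub, ← mul_assoc, ← mul_assoc,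
    Matrix.trace_mul_comm (M * Y) X, mul_assoc X M Y]

/-- With the entries of X factored out, the identity to be proved becomes one linear equation for
each position (p, q), needed only where X may be nonzero. -/
theorem contract_tracePair_commutator {n : ℕ} (R : Mat₂ k n) (F X : Mat k n) (b l : Fin n) :
    contract R (tracePair (F * X - X * F)) b l
      = ∑ p, ∑ q, X p q * (∑ j, R (q, b) (j, l) * F j p - ∑ a, F q a * R (a, b) (p, l)) := by
  simp only [contract_apply, tracePair_apply, Matrix.trace, Matrix.diag_apply, sub_mul,
    Matrix.sub_apply, Matrix.mul_apply, Matrix.of_apply, mul_sub, Finset.sum_sub_distrib,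
    Finset.sum_mul, Finset.mul_sum]
  congr 1
  · calc _ = ∑ j, ∑ p, ∑ q, F j p * X p q * R (q, b) (j, l) :=
          Finset.sum_congr rfl fun _ _ => Finset.sum_comm
      _ = ∑ p, ∑ j, ∑ q, F j p * X p q * R (q, b) (j, l) := Finset.sum_comm
      _ = ∑ p, ∑ q, ∑ j, F j p * X p q * R (q, b) (j, l) :=
          Finset.sum_congr rfl fun _ _ => Finset.sum_comm
      _ = _ := Finset.sum_congr rfl fun _ _ => Finset.sum_congr rfl fun _ _ =>
          Finset.sum_congr rfl fun _ _ => by ring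
  · refine Finset.sum_congr rfl fun p _ => ?_
    rw [Finset.sum_comm]
    exact Finset.sum_congr rfl fun _ _ => Finset.sum_congr rfl fun _ _ => mul_assoc _ _ _

/-- The contraction map as a linear function of the tensor. -/
def contractRight {n : ℕ} (ξ : Module.Dual k (Mat k n)) : Mat₂ k n →ₗ[k] Mat k n where
  toFun R := contract R ξ
  map_add' R S := by ext b l; exact map_add ξ _ _
  map_smul' c R := by ext b l; exact map_smul ξ c _

theorem contract_glAct {n : ℕ} (g : (Mat k n)ˣ) (R : Mat₂ k n) (M : Mat k n) :
    contract (glAct g R) (tracePair M)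
      = g.val * contract R (tracePair (g⁻¹.val * M * g.val)) * g⁻¹.val := by
  suffices h : contractRight (tracePair M) ∘ₗ glAct g
      = (LinearMap.mulLeft k g.val ∘ₗ LinearMap.mulRight k g⁻¹.val)
        ∘ₗ contractRight (tracePair (g⁻¹.val * M * g.val)) by
    have := LinearMap.congr_fun h R
    rw [mul_assoc]
    exact this
  refine hom_ext_kronecker fun A B => ?_
  change contract (glAct g (A ⊗ₖ B)) (tracePair M)
    = g.val * (contract (A ⊗ₖ B) (tracePair (g⁻¹.val * M * g.val)) * g⁻¹.val)
  rw [glAct_apply, ← Matrix.mul_kronecker_mul, ← Matrix.mul_kronecker_mul, contract_kronecker,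
    contract_kronecker, tracePair_apply, tracePair_apply, smul_mul_assoc, mul_smul_comm]
  congr 1
  · rw [← mul_assoc, Matrix.trace_mul_comm]
    simp only [mul_assoc]
  · rw [mul_assoc]

/- ### The Frobenius functional at `u v₁ + t v₂` -/

/-- The matrix `u⁻¹ (e₃₁ + e₄₂ + ⋯ + e_{n,n-2}) - t⁻¹ e_{n-1,n}`. -/
def frobMatrix (n : ℕ) (u t : k) : Mat k n := Matrix.of fun a b =>
  (if a.val = b.val + 2 then u⁻¹ else 0) - (if a.val + 2 = n ∧ b.val + 1 = n then t⁻¹ else 0)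

theorem sum_fin_ite_eq {n : ℕ} (g : ℤ → k) (m : ℕ) (c : k) :
    ∑ j : Fin n, g ((j : ℕ) : ℤ) * (if (j : ℕ) = m then c else 0)
      = if m < n then g m * c else 0 := by
  split_ifs with h
  · rw [Finset.sum_eq_single ⟨m, h⟩ (fun j _ hj => ?_) (fun h' => absurd (Finset.mem_univ _) h')]
    · simp
    · rw [if_neg (fun h' => hj (Fin.ext h')), mul_zero]
  · refine Finset.sum_eq_zero fun j _ => ?_
    rw [if_neg (by omega), mul_zero]

section
variable [CharZero k]

/-- The coefficients of `u v₁ + t v₂` satisfy the linear equations of the Frobenius functional. -/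
theorem coeff_commutator {n : ℕ} (hn : Odd n) (hn3 : 3 ≤ n) {u t : k} (hu : u ≠ 0) (ht : t ≠ 0)
    {f : ℤ → ℤ → ℤ → ℤ → k} (hf : ∀ a b j l, f a b j l =
      u * (opV₁ n (mono j l) : Laurent k) (a, b) + t * (opV₂ n (mono j l) : Laurent k) (a, b))
    {p q b l : ℤ} (hpn : p < n) (hqn : q < n) (hln : l < n)
    (hpq : p < n - 2 ∨ n - 2 ≤ q) :
    ((if p < n - 2 then f q b (p + 2) l * u⁻¹ else 0)
        - (if p = n - 1 then f q b (n - 2) l * t⁻¹ else 0))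
      - (f (q - 2) b p l * u⁻¹ - (if q = n - 2 then f (n - 1) b p l * t⁻¹ else 0))
      = (if b = p ∧ l = q then 1 else 0) - 1 / n * (if p = q ∧ l = b then 1 else 0) := by
  have h1 := opV₁_shift (k := k) (show n ≠ 0 by omega) q b p l
  have h2 := opV₂_shift (k := k) n q b p l
  rw [← h1]
  rcases lt_or_ge p (n - 2) with hp | hp
  -- Here x₁^{p+2} is still in range, so v₂ drops out and only the commutator of v₁ with x₁²
  -- remains.
  · rw [if_pos hp, if_neg (show ¬ p = n - 1 by omega), hf, hf, ← h2]
    have h3 : f (n - 1) b p l = 0 := by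
      rw [hf, opV₁_apply_of_lt hn (Or.inl rfl) (by omega) hln,
        opV₂_apply_eq_zero n (show p ≠ n - 1 - 1 by omega) (by omega)]
      ring
    rw [h3, zero_mul, ite_self]
    field_simp
    ring
  -- Here x₁^{p+2} is truncated away. By `opV₁_boundary` the missing v₁ term equals what the -t⁻¹
  -- entry of the matrix produces from t v₂, and the contributions of that entry through u v₁ cancel
  -- by `h5`.
  · have hq : (n : ℤ) - 2 ≤ q := by omega
    have h3 := opV₁_boundary (k := k) (b := b) hn (show p = n - 1 ∨ p = n - 2 by omega)
      (show q = n - 1 ∨ q = n - 2 by omega) hln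
    have h4 : (opV₂ n (mono p l) : Laurent k) (q - 2, b) = 0 :=
      opV₂_apply_eq_zero n (by omega) (by omega)
    rw [if_neg (show ¬ p < n - 2 by omega), hf (q - 2), h4]
    have h5 : (if p = n - 1 then (opV₁ n (mono (n - 2) l) : Laurent k) (q, b) else 0)
        = if q = n - 2 then (opV₁ n (mono p l) : Laurent k) (n - 1, b) else 0 := by
      rcases (by omega : p = n - 1 ∨ p = n - 2) with h | h <;>
        rcases (by omega : q = n - 1 ∨ q = n - 2) with h' | h'
      · rw [if_pos h, if_neg (by omega), h', opV₁_apply_of_lt hn (Or.inl rfl) (by omega) hln]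
      · rw [if_pos h, if_pos h', h, h', opV₁_apply_diag hn (Or.inl rfl) hln,
          opV₁_apply_diag hn (Or.inr rfl) hln]
      · rw [if_neg (by omega), if_neg (by omega)]
      · rw [if_neg (by omega), if_pos h', h, opV₁_apply_of_lt hn (Or.inl rfl) (by omega) hln]
    have h6 : t⁻¹ * ((if p = n - 1 then f q b (n - 2) l else 0)
        - (if q = n - 2 then f (n - 1) b p l else 0))
        = -(opV₁ n (mono (p + 2) l) : Laurent k) (q, b) := by
      rw [h3]
      split_ifs at h5 ⊢ <;> (try simp only [hf]) <;> field_simp <;> linear_combination u * h5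
    have h7 : (if p = n - 1 then f q b (n - 2) l * t⁻¹ else 0)
        - (if q = n - 2 then f (n - 1) b p l * t⁻¹ else 0)
        = -(opV₁ n (mono (p + 2) l) : Laurent k) (q, b) := by
      rw [← h6]; split_ifs <;> ring
    have h8 : u * u⁻¹ = 1 := mul_inv_cancel₀ hu
    linear_combination -h7 - (opV₁ n (mono p l) : Laurent k) (q - 2, b) * h8

theorem contract_frobMatrix {n : ℕ} (hn : Odd n) (hn3 : 3 ≤ n) {u t : k} (hu : u ≠ 0) (ht : t ≠ 0)
    {X : Mat k n} (hX : X ∈ maxParabolic k (n - 2) n) :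
    contract (u • tenV₁ k n + t • tenV₂ k n)
      (tracePair (frobMatrix n u t * X - X * frobMatrix n u t)) = X := by
  have hP : Preserves n (u • opV₁ n + t • opV₂ n : Module.End k (Laurent k)) :=
    ((preserves_opV₁ n).smul u).add ((preserves_opV₂ hn).smul t)
  let f : ℤ → ℤ → ℤ → ℤ → k := fun a b j l =>
    ((u • opV₁ n + t • opV₂ n : Module.End k (Laurent k)) (mono j l) : Laurent k) (a, b)
  have hf : ∀ a b j l, f a b j l = u * (opV₁ n (mono j l) : Laurent k) (a, b)
      + t * (opV₂ n (mono j l) : Laurent k) (a, b) := fun a b j l => rfl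
  have hR : ∀ a b j l : Fin n, (u • tenV₁ k n + t • tenV₂ k n) (a, b) (j, l)
      = f (a : ℕ) (b : ℕ) (j : ℕ) (l : ℕ) := fun a b j l => rfl
  ext b l
  rw [contract_tracePair_commutator]
  have hQ : ∀ p q : Fin n, X p q * (∑ j, (u • tenV₁ k n + t • tenV₂ k n) (q, b) (j, l)
        * frobMatrix n u t j p - ∑ a, frobMatrix n u t q a
        * (u • tenV₁ k n + t • tenV₂ k n) (a, b) (p, l))
      = X p q * ((if b = p ∧ l = q then 1 else 0) - 1 / n * (if p = q ∧ l = b then 1 else 0)) := by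
    intro p q
    by_cases hpq : n - 2 ≤ p.val ∧ q.val < n - 2
    · rw [hX.2 p q hpq.1 hpq.2, zero_mul, zero_mul]
    congr 1
    have hp := p.isLt
    have hq := q.isLt
    have key := coeff_commutator hn hn3 hu ht hf (p := (p : ℕ)) (q := (q : ℕ)) (b := (b : ℕ))
      (l := (l : ℕ)) (by omega) (by omega) (by omega) (by omega)
    have e1 : ∑ j, (u • tenV₁ k n + t • tenV₂ k n) (q, b) (j, l) * frobMatrix n u t j p
        = (if ((p : ℕ) : ℤ) < n - 2 then f (q : ℕ) (b : ℕ) ((p : ℕ) + 2) (l : ℕ) * u⁻¹ else 0)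
          - (if ((p : ℕ) : ℤ) = n - 1 then f (q : ℕ) (b : ℕ) (n - 2) (l : ℕ) * t⁻¹ else 0) := by
      have g1 := sum_fin_ite_eq (n := n) (fun x => f (q : ℕ) (b : ℕ) x (l : ℕ)) (p + 2) u⁻¹
      have g2 := sum_fin_ite_eq (n := n) (fun x => f (q : ℕ) (b : ℕ) x (l : ℕ)) (n - 2)
        (if (p : ℕ) + 1 = n then t⁻¹ else 0)
      simp only [hR, frobMatrix, Matrix.of_apply, mul_sub, Finset.sum_sub_distrib]
      congr 1
      · rw [g1]
        push_cast
        exact if_congr (by omega) rfl rfl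
      · rw [if_pos (show n - 2 < n by omega), Nat.cast_sub (by omega)] at g2
        rw [← if_congr (show (p : ℕ) + 1 = n ↔ ((p : ℕ) : ℤ) = n - 1 by omega) rfl rfl]
        rw [mul_ite, mul_zero] at g2
        rw [show ((2 : ℕ) : ℤ) = 2 from rfl] at g2
        rw [← g2]
        refine Finset.sum_congr rfl fun j _ => ?_
        rw [← ite_and]
        congr 1
        exact if_congr (by omega) rfl rfl
    have e2 : ∑ a, frobMatrix n u t q a * (u • tenV₁ k n + t • tenV₂ k n) (a, b) (p, l)
        = f ((q : ℕ) - 2) (b : ℕ) (p : ℕ) (l : ℕ) * u⁻¹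
          - (if ((q : ℕ) : ℤ) = n - 2 then f (n - 1) (b : ℕ) (p : ℕ) (l : ℕ) * t⁻¹ else 0) := by
      have g1 := sum_fin_ite_eq (n := n) (fun x => f x (b : ℕ) (p : ℕ) (l : ℕ)) (q - 2) u⁻¹
      have g2 := sum_fin_ite_eq (n := n) (fun x => f x (b : ℕ) (p : ℕ) (l : ℕ)) (n - 1)
        (if (q : ℕ) + 2 = n then t⁻¹ else 0)
      simp only [hR, frobMatrix, Matrix.of_apply, sub_mul, Finset.sum_sub_distrib]
      congr 1
      · by_cases h2 : 2 ≤ (q : ℕ)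
        · rw [if_pos (show (q : ℕ) - 2 < n by omega), Nat.cast_sub h2] at g1
          rw [show ((2 : ℕ) : ℤ) = 2 from rfl] at g1
          rw [← g1]
          refine Finset.sum_congr rfl fun j _ => ?_
          rw [mul_comm]
          congr 1
          exact if_congr (by omega) rfl rfl
        · have h0 : f ((q : ℕ) - 2) (b : ℕ) (p : ℕ) (l : ℕ) = 0 :=
            mem_truncPol.1 (hP _ (mono_mem_truncPol p l)) _ _ (by omega)
          rw [h0, zero_mul]
          refine Finset.sum_eq_zero fun j _ => ?_
          rw [if_neg (by omega), zero_mul]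
      · rw [if_pos (show n - 1 < n by omega), Nat.cast_sub (by omega), Nat.cast_one] at g2
        rw [← if_congr (show (q : ℕ) + 2 = n ↔ ((q : ℕ) : ℤ) = n - 2 by omega) rfl rfl]
        rw [mul_ite, mul_zero] at g2
        rw [← g2]
        refine Finset.sum_congr rfl fun j _ => ?_
        rw [← ite_and, mul_comm]
        congr 1
        exact if_congr (by omega) rfl rfl
    rw [e1, e2, key]
    congr 1
    · exact if_congr (by rw [Fin.ext_iff, Fin.ext_iff]; omega) rfl rfl
    · congr 1
      exact if_congr (by rw [Fin.ext_iff, Fin.ext_iff]; omega) rfl rfl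
  simp only [hQ, mul_sub, Finset.sum_sub_distrib, mul_ite, mul_one, mul_zero, ite_and]
  -- Tracelessness of X removes the contribution of -1/n.
  have h0 : ∑ p, X p p = 0 := hX.1
  have h1 : ∑ p, ∑ q, (if b = p then if l = q then X p q else 0 else 0) = X b l := by simp
  have h2 : ∑ p, ∑ q, (if p = q then if l = b then X p q * (1 / n) else 0 else 0)
      = if l = b then (∑ p, X p p) * (1 / n) else 0 := by
    simp only [Finset.sum_ite_eq, Finset.mem_univ, if_true, Finset.sum_mul]
    split_ifs <;> simp
  rw [h1, h2, h0, zero_mul, ite_self, sub_zero]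

end

/- ### The unipotent element `e^{t E₂}` -/

theorem matE₂_mul_self (n : ℕ) : matE₂ k n * matE₂ k n = 0 := by
  ext a b
  rw [Matrix.mul_apply, Matrix.zero_apply]
  refine Finset.sum_eq_zero fun i _ => ?_
  simp only [matE₂, Matrix.of_apply]
  by_cases h : a.val = i.val + 1 ∧ Even a.val
  · rw [if_neg (show ¬ (i.val = b.val + 1 ∧ Even i.val) from fun h' => by
      obtain ⟨h1, c, hc⟩ := h; obtain ⟨h2, d, hd⟩ := h'; omega), mul_zero]
  · rw [if_neg h, zero_mul]

/-- The element `1 + t E₂ = e^{t E₂}` of `GL_n`. -/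
def unipotent (n : ℕ) (t : k) : (Mat k n)ˣ where
  val := 1 + t • matE₂ k n
  inv := 1 - t • matE₂ k n
  val_inv := by
    rw [add_mul, one_mul, mul_sub, mul_one, smul_mul_smul_comm, matE₂_mul_self, smul_zero]; abel
  inv_val := by
    rw [sub_mul, one_mul, mul_add, mul_one, smul_mul_smul_comm, matE₂_mul_self, smul_zero]; abel

theorem unipotent_val (n : ℕ) (t : k) : (unipotent n t).val = 1 + t • matE₂ k n := rfl

theorem unipotent_inv_val (n : ℕ) (t : k) : (unipotent n t)⁻¹.val = 1 - t • matE₂ k n := rfl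

theorem matE₂_mul_apply {n : ℕ} (m : ℕ → ℕ → k) (a b : Fin n) :
    (matE₂ k n * Matrix.of fun a b : Fin n => m a.val b.val) a b
      = if a.val % 2 = 0 ∧ 0 < a.val then m (a.val - 1) b.val else 0 := by
  simp only [Matrix.mul_apply, matE₂, Matrix.of_apply, ite_mul, one_mul, zero_mul]
  split_ifs with h
  · rw [Finset.sum_eq_single ⟨a.val - 1, by omega⟩ (fun i _ hi => ?_)
      (fun h' => absurd (Finset.mem_univ _) h')]
    · exact if_pos ⟨by simp only; omega, Nat.even_iff.2 h.1⟩
    · exact if_neg fun h' => hi (Fin.ext (by simp only; omega))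
  · refine Finset.sum_eq_zero fun i _ => if_neg fun h' => h ⟨Nat.even_iff.1 h'.2, by omega⟩

theorem mul_matE₂_apply {n : ℕ} (hn : Odd n) (m : ℕ → ℕ → k) (a b : Fin n) :
    ((Matrix.of fun a b : Fin n => m a.val b.val) * matE₂ k n) a b
      = if b.val % 2 = 1 then m a.val (b.val + 1) else 0 := by
  simp only [Matrix.mul_apply, matE₂, Matrix.of_apply, mul_ite, mul_one, mul_zero]
  split_ifs with h
  · obtain ⟨c, hc⟩ := hn
    rw [Finset.sum_eq_single ⟨b.val + 1, by omega⟩ (fun i _ hi => ?_)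
      (fun h' => absurd (Finset.mem_univ _) h')]
    · exact if_pos ⟨rfl, Nat.even_iff.2 (by simp only; omega)⟩
    · exact if_neg fun h' => hi (Fin.ext h'.1)
  · refine Finset.sum_eq_zero fun i _ => if_neg fun h' => h ?_
    have := Nat.even_iff.1 h'.2
    omega

/-- The projection to the lower right block. -/
def blockProj (k : Type*) [Field k] (m n : ℕ) : Mat k n :=
  Matrix.of fun a b => if a.val = b.val ∧ m ≤ a.val then 1 else 0

/-- The matrix of the functional `frobFunctional`. -/
def frobMatrix' (n : ℕ) (u t : k) : Mat k n := frobMatrix n u t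
  + Matrix.of fun a b => (if a.val + 1 = n ∧ b.val + 2 = n then t else 0)
    - (if a.val + 1 = n ∧ b.val + 1 = n then 2 else 0)

/-- The double shift commutes with E₂, so only the lower right 2 × 2 block matters. There the
conjugate by 1 + tE₂ of -t⁻¹e_{n-1,n} minus the identity of the block has rows (0, -t⁻¹) and (t,
-2), which is where the entries t and -2 come from. -/
theorem frobMatrix'_mul_unipotent {n : ℕ} (hn : Odd n) (hn3 : 3 ≤ n) (u : k) {t : k} (ht : t ≠ 0) :
    frobMatrix' n u t * (unipotent n t).val
      = (unipotent n t).val * (frobMatrix n u t - blockProj k (n - 2) n) := by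
  let f : ℕ → ℕ → k := fun a b => (if a = b + 2 then u⁻¹ else 0)
    - (if a + 2 = n ∧ b + 1 = n then t⁻¹ else 0) + ((if a + 1 = n ∧ b + 2 = n then t else 0)
    - (if a + 1 = n ∧ b + 1 = n then 2 else 0))
  let g : ℕ → ℕ → k := fun a b => (if a = b + 2 then u⁻¹ else 0)
    - (if a + 2 = n ∧ b + 1 = n then t⁻¹ else 0) - (if a = b ∧ n - 2 ≤ a then 1 else 0)
  have hf : frobMatrix' n u t = Matrix.of fun a b : Fin n => f a.val b.val := rfl
  have hg : frobMatrix n u t - blockProj k (n - 2) n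
      = Matrix.of fun a b : Fin n => g a.val b.val := rfl
  rw [hf, hg, unipotent_val, mul_add, add_mul, mul_one, one_mul, mul_smul_comm, smul_mul_assoc]
  ext a b
  rw [Matrix.add_apply, Matrix.add_apply, Matrix.smul_apply, Matrix.smul_apply, mul_matE₂_apply hn,
    matE₂_mul_apply, Matrix.of_apply, Matrix.of_apply, smul_eq_mul, smul_eq_mul]
  have h0 : (if b.val % 2 = 1 then (if a.val = b.val + 1 + 2 then u⁻¹ else 0) else 0)
      = if a.val % 2 = 0 ∧ 0 < a.val then (if a.val - 1 = b.val + 2 then u⁻¹ else 0) else 0 := by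
    rw [← ite_and, ← ite_and]
    exact if_congr (by omega) rfl rfl
  have h1 : (if b.val % 2 = 1 then f a.val (b.val + 1) else 0)
      - (if a.val % 2 = 0 ∧ 0 < a.val then g (a.val - 1) b.val else 0)
      = (if b.val % 2 = 1 then f a.val (b.val + 1) - (if a.val = b.val + 1 + 2 then u⁻¹ else 0)
          else 0)
      - (if a.val % 2 = 0 ∧ 0 < a.val then g (a.val - 1) b.val
          - (if a.val - 1 = b.val + 2 then u⁻¹ else 0) else 0) := by
    split_ifs at h0 ⊢ <;> linear_combination h0
  suffices h : f a.val b.val - g a.val b.val + t * ((if b.val % 2 = 1 then f a.val (b.val + 1) else 0)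
      - (if a.val % 2 = 0 ∧ 0 < a.val then g (a.val - 1) b.val else 0)) = 0 by
    linear_combination h
  rw [h1]
  simp only [f, g]
  have ha := a.isLt
  have hb := b.isLt
  obtain ⟨c, hc⟩ := hn
  generalize a.val = a at *
  generalize b.val = b at *
  clear h0 h1 hf hg
  rcases (by omega : a + 1 = n ∨ a + 2 = n ∨ a + 2 < n) with h | h | h <;>
  rcases (by omega : b + 1 = n ∨ b + 2 = n ∨ b + 2 < n) with h' | h' | h' <;>
  · simp (disch := omega) only [if_pos, if_neg, sub_zero, zero_sub, add_zero, zero_add, sub_self,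
      mul_zero, ite_self]
    try field_simp
    try ring

/-- In a trace pairing, reading off the (i, j) entry is done by e_{ji}. On traceless matrices the
sum of the first n - 1 diagonal entries is minus the last one, so the coroot term becomes -2e_{nn}.
-/
theorem frobFunctional_eq {n : ℕ} (hn3 : 3 ≤ n) (u t : k) :
    frobFunctional n u t
      = (tracePair (frobMatrix' n u t)).domRestrict (maxParabolic k (n - 2) n).toSubmodule := by
  ext ⟨Y, hY⟩
  have hE : ∀ i j, entryDual k n i j Y
      = ∑ a : Fin n, ∑ b : Fin n, (if a.val + 1 = i ∧ b.val + 1 = j then 1 else 0) * Y a b := by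
    intro i j
    simp only [entryDual, LinearMap.sum_apply]
    refine Finset.sum_congr rfl fun a _ => Finset.sum_congr rfl fun b _ => ?_
    split_ifs
    · rw [one_mul]; rfl
    · rw [zero_mul]; rfl
  have hS : ∑ i ∈ Finset.Icc 1 (n - 2), entryDual k n i (i + 2) Y
      = ∑ a : Fin n, ∑ b : Fin n, (if b.val = a.val + 2 then 1 else 0) * Y a b := by
    simp only [hE]
    rw [Finset.sum_comm]
    refine Finset.sum_congr rfl fun a _ => ?_
    rw [Finset.sum_comm]
    refine Finset.sum_congr rfl fun b _ => ?_
    rw [← Finset.sum_mul]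
    congr 1
    split_ifs with h
    · rw [Finset.sum_eq_single (a.val + 1) (fun i _ hi => if_neg (by omega))
        (fun h' => absurd (Finset.mem_Icc.2 (by omega)) h')]
      exact if_pos (by omega)
    · exact Finset.sum_eq_zero fun i _ => if_neg (by omega)
  have hC : corootDual k n (n - 1) Y
      = ∑ a : Fin n, ∑ b : Fin n, (if a = b ∧ a.val + 1 ≠ n then 1 else 0) * Y a b := by
    rw [corootDual, LinearMap.sum_apply]
    simp only [hE]
    rw [Finset.sum_comm]
    refine Finset.sum_congr rfl fun a _ => ?_
    rw [Finset.sum_comm]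
    refine Finset.sum_congr rfl fun b _ => ?_
    rw [← Finset.sum_mul]
    congr 1
    split_ifs with h
    · rw [Finset.sum_eq_single (a.val + 1) (fun i _ hi => if_neg (by omega))
        (fun h' => absurd (Finset.mem_Icc.2 (by omega)) h')]
      exact if_pos ⟨rfl, by rw [h.1]⟩
    · refine Finset.sum_eq_zero fun i hi => if_neg fun h' => h ⟨Fin.ext (by omega), ?_⟩
      have := Finset.mem_Icc.1 hi
      omega
  have hT : ∑ a : Fin n, ∑ b : Fin n, (if a = b then 1 else 0) * Y a b = 0 := by
    have : ∑ a, Y a a = 0 := hY.1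
    simpa using this
  change u⁻¹ * (∑ i ∈ Finset.Icc 1 (n - 2), entryDual k n i (i + 2)) Y
    - t⁻¹ * entryDual k n n (n - 1) Y + t * entryDual k n (n - 1) n Y
    + 2 * corootDual k n (n - 1) Y = (frobMatrix' n u t * Y).trace
  have htr : (frobMatrix' n u t * Y).trace = (Y * frobMatrix' n u t).trace
      + 2 * ∑ a : Fin n, ∑ b : Fin n, (if a = b then 1 else 0) * Y a b := by
    rw [hT, mul_zero, add_zero, Matrix.trace_mul_comm]
  rw [LinearMap.sum_apply, hS, hC, hE, hE, htr]
  simp only [Matrix.trace, Matrix.diag_apply, Matrix.mul_apply, Finset.mul_sum,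
    ← Finset.sum_add_distrib, ← Finset.sum_sub_distrib]
  refine Finset.sum_congr rfl fun a _ => Finset.sum_congr rfl fun b _ => ?_
  simp only [frobMatrix', frobMatrix, Matrix.add_apply,
    Matrix.of_apply]
  have e1 : (if b.val + 2 = n ∧ a.val + 1 = n then t⁻¹ else 0)
      = t⁻¹ * if a.val + 1 = n ∧ b.val + 1 = n - 1 then 1 else 0 := by
    rw [mul_ite, mul_one, mul_zero]; exact if_congr (by omega) rfl rfl
  have e2 : (if b.val + 1 = n ∧ a.val + 2 = n then t else 0)
      = t * if a.val + 1 = n - 1 ∧ b.val + 1 = n then 1 else 0 := by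
    rw [mul_ite, mul_one, mul_zero]; exact if_congr (by omega) rfl rfl
  have e3 : (if b.val = a.val + 2 then u⁻¹ else 0)
      = u⁻¹ * if b.val = a.val + 2 then 1 else 0 := by
    rw [mul_ite, mul_one, mul_zero]
  have e4 : (if b.val + 1 = n ∧ a.val + 1 = n then 2 else 0)
      = 2 * (if a = b then 1 else 0) - 2 * (if a = b ∧ a.val + 1 ≠ n then (1 : k) else 0) := by
    simp only [Fin.ext_iff]
    by_cases h : a.val = b.val
    · by_cases h' : a.val + 1 = n
      · simp (disch := omega) only [if_pos, if_neg]; ring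
      · simp (disch := omega) only [if_pos, if_neg]; ring
    · simp (disch := omega) only [if_neg]; ring
  rw [e1, e2, e3, e4]
  ring

theorem isBlock_unipotent {n : ℕ} (hn : Odd n) (t : k) : IsBlock (n - 2) (unipotent n t).val := by
  intro j l h1 h2
  rw [unipotent_val, Matrix.add_apply, Matrix.smul_apply, isBlock_matE₂ hn j l h1 h2, smul_zero,
    Matrix.one_apply_ne (by rintro rfl; omega), add_zero]

theorem isBlock_unipotent_inv {n : ℕ} (hn : Odd n) (t : k) :
    IsBlock (n - 2) (unipotent n t)⁻¹.val := by
  intro j l h1 h2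
  rw [unipotent_inv_val, Matrix.sub_apply, Matrix.smul_apply, isBlock_matE₂ hn j l h1 h2, smul_zero,
    Matrix.one_apply_ne (by rintro rfl; omega), sub_zero]

theorem blockProj_mul_mul {n m : ℕ} {X : Mat k n} (hX : IsBlock m X) :
    blockProj k m n * X * blockProj k m n = blockProj k m n * X := by
  have hd : blockProj k m n = Matrix.diagonal fun a => if m ≤ a.val then 1 else 0 := by
    ext a b
    rw [blockProj, Matrix.of_apply, Matrix.diagonal_apply, ite_and]
    exact if_congr Fin.ext_iff.symm rfl rfl
  ext a b
  rw [hd, Matrix.mul_diagonal, Matrix.diagonal_mul]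
  by_cases h1 : m ≤ a.val
  · by_cases h2 : m ≤ b.val
    · rw [if_pos h2, mul_one]
    · rw [hX a b h1 (by omega)]; ring
  · rw [if_neg h1]; ring

/-- Pairing with the block projection gives the trace of the lower right block, which vanishes on
commutators of block triangular matrices. -/
theorem tracePair_blockProj_commutator {n m : ℕ} {X Y : Mat k n} (hX : IsBlock m X)
    (hY : IsBlock m Y) :
    tracePair (blockProj k m n * X - X * blockProj k m n) Y = 0 := by
  rw [tracePair_apply, sub_mul, Matrix.trace_sub, ← blockProj_mul_mul hX,
    Matrix.mul_assoc X, Matrix.trace_mul_comm X, ← blockProj_mul_mul hY,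
    Matrix.mul_assoc (blockProj k m n * X), Matrix.mul_assoc (blockProj k m n * Y),
    Matrix.trace_mul_comm (blockProj k m n * X), sub_self]

/-- At c = 0 the Yang–Baxter map is quadratic; the middle coefficient is its polarization. -/
theorem CYB_zero_add_smul {n : ℕ} (x y : k) (R S : Mat₂ k n) :
    CYB 0 (x • R + y • S) = x ^ 2 • CYB 0 R + (x * y) • (CYB 0 (R + S) - CYB 0 R - CYB 0 S)
      + y ^ 2 • CYB 0 S := by
  have h12 : leg₁₂ (x • R + y • S) = x • leg₁₂ R + y • leg₁₂ S := by
    ext p q; simp only [leg₁₂, Matrix.of_apply, Matrix.add_apply, Matrix.smul_apply]; split_ifs <;> simp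
  have h13 : leg₁₃ (x • R + y • S) = x • leg₁₃ R + y • leg₁₃ S := by
    ext p q; simp only [leg₁₃, Matrix.of_apply, Matrix.add_apply, Matrix.smul_apply]; split_ifs <;> simp
  have h23 : leg₂₃ (x • R + y • S) = x • leg₂₃ R + y • leg₂₃ S := by
    ext p q; simp only [leg₂₃, Matrix.of_apply, Matrix.add_apply, Matrix.smul_apply]; split_ifs <;> simp
  have h12' : leg₁₂ (R + S) = leg₁₂ R + leg₁₂ S := by
    ext p q; simp only [leg₁₂, Matrix.of_apply, Matrix.add_apply]; split_ifs <;> simp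
  have h13' : leg₁₃ (R + S) = leg₁₃ R + leg₁₃ S := by
    ext p q; simp only [leg₁₃, Matrix.of_apply, Matrix.add_apply]; split_ifs <;> simp
  have h23' : leg₂₃ (R + S) = leg₂₃ R + leg₂₃ S := by
    ext p q; simp only [leg₂₃, Matrix.of_apply, Matrix.add_apply]; split_ifs <;> simp
  simp only [CYB, h12, h13, h23, h12', h13', h23', lie_add, add_lie, smul_lie, lie_smul, zero_smul,
    sub_zero]
  module

section
variable [CharZero k]

theorem expAct_eq_glAct_unipotent (n : ℕ) (t : k) (R : Mat₂ k n) :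
    expAct (t • matE₂ k n) R = glAct (unipotent n t) R := by
  refine expAct_eq_glAct (isNilpotent_smul_matE₂ n t) _ ?_ R
  have h : (t • matE₂ k n) ^ 2 = 0 := by
    rw [pow_two, smul_mul_smul_comm, matE₂_mul_self, smul_zero]
  rw [IsNilpotent.exp_eq_sum h, unipotent_val]
  simp [Finset.sum_range_succ]

/-- Conjugation by 1 + tE₂, which preserves the parabolic, reduces this to `contract_frobMatrix`;
the block projection H that appears is invisible to functionals on the parabolic. -/
theorem contract_bCG {n : ℕ} (hn : Odd n) (hn3 : 3 ≤ n) {u t : k} (hu : u ≠ 0) (ht : t ≠ 0)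
    {X : Mat k n} (hX : X ∈ maxParabolic k (n - 2) n) :
    contract (bCG n u t) (tracePair (frobMatrix' n u t * X - X * frobMatrix' n u t)) = X := by
  set g := unipotent n t with hg
  set F := frobMatrix n u t with hF
  set H := blockProj k (n - 2) n with hH
  set F' := frobMatrix' n u t with hF'
  set Z := g⁻¹.val * X * g.val with hZ
  have hFg : F' * g.val = g.val * (F - H) := frobMatrix'_mul_unipotent hn hn3 u ht
  have hgi : g⁻¹.val * g.val = 1 := Units.inv_mul g
  have hig : g.val * g⁻¹.val = 1 := Units.mul_inv g
  have hFg' : g⁻¹.val * F' = (F - H) * g⁻¹.val := by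
    calc g⁻¹.val * F' = g⁻¹.val * (F' * g.val) * g⁻¹.val := by
          rw [mul_assoc, mul_assoc, hig, mul_one]
      _ = (F - H) * g⁻¹.val := by rw [hFg, ← mul_assoc, hgi, one_mul]
  have hZP : Z ∈ maxParabolic k (n - 2) n := by
    refine ⟨?_, ((isBlock_unipotent_inv hn t).mul hX.2).mul (isBlock_unipotent hn t)⟩
    rw [hZ, Matrix.trace_mul_comm, ← mul_assoc, hig, one_mul]
    exact hX.1
  have hconj : g⁻¹.val * (F' * X - X * F') * g.val = (F * Z - Z * F) - (H * Z - Z * H) := by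
    have h1 : g⁻¹.val * (F' * X) * g.val = (F - H) * Z := by
      rw [← mul_assoc, hFg', hZ]; simp only [mul_assoc]
    have h2 : g⁻¹.val * (X * F') * g.val = Z * (F - H) := by
      calc _ = g⁻¹.val * X * (F' * g.val) := by simp only [mul_assoc]
        _ = _ := by rw [hFg, hZ]; simp only [mul_assoc]
    rw [mul_sub, sub_mul, h1, h2, sub_mul, mul_sub]
    abel
  have hb : bCG n u t = glAct g (u • tenV₁ k n + t • tenV₂ k n) := by
    rw [← expAct_matE₂_combination hn, expAct_eq_glAct_unipotent]
  have hpar : IsParabolicTensor (n - 2) (u • tenV₁ k n + t • tenV₂ k n) :=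
    ((isParabolicTensor_tenV₁ hn).smul u).add ((isParabolicTensor_tenV₂ hn).smul t)
  rw [hb, contract_glAct, hconj, hpar.contract_congr (η := tracePair (F * Z - Z * F)),
    contract_frobMatrix hn hn3 hu ht hZP, hZ]
  · calc _ = (g.val * g⁻¹.val) * X * (g.val * g⁻¹.val) := by simp only [mul_assoc]
      _ = X := by rw [hig, one_mul, mul_one]
  · intro Y hY
    rw [tracePair_apply, sub_mul, Matrix.trace_sub, ← tracePair_apply, ← tracePair_apply,
      tracePair_blockProj_commutator hZP.2 hY.2, sub_zero]

theorem isFrobeniusFunctionalOf_bCG {n : ℕ} (hn : Odd n) (hn3 : 3 ≤ n) {u t : k} (hu : u ≠ 0)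
    (ht : t ≠ 0) :
    IsFrobeniusFunctionalOf (bCG n u t) (maxParabolic k (n - 2) n) (frobFunctional n u t) := by
  rw [frobFunctional_eq hn3]
  refine isFrobeniusFunctionalOf_of_contract (isParabolicTensor_bCG hn u t) _ fun X hX => ?_
  rw [tracePair_comp_ad]
  exact contract_bCG hn hn3 hu ht hX

theorem carrier_bCG {n : ℕ} (hn : Odd n) (hn3 : 3 ≤ n) {u t : k} (hu : u ≠ 0) (ht : t ≠ 0) :
    carrier (bCG n u t) = (maxParabolic k (n - 2) n).toSubmodule := by
  refine carrier_eq_of_contract (isParabolicTensor_bCG hn u t)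
    (tracePair (frobMatrix' n u t)) fun X hX => ?_
  rw [tracePair_comp_ad]
  exact contract_bCG hn hn3 hu ht hX

/- ### The classical Yang–Baxter equation for `b_CG` -/

theorem CYB_combination {n : ℕ} (hn : Odd n) (hn3 : 3 ≤ n) {u t : k} (hu : u ≠ 0) (ht : t ≠ 0) :
    CYB 0 (u • tenV₁ k n + t • tenV₂ k n) = 0 := by
  have hpar : IsParabolicTensor (n - 2) (u • tenV₁ k n + t • tenV₂ k n) :=
    ((isParabolicTensor_tenV₁ hn).smul u).add ((isParabolicTensor_tenV₂ hn).smul t)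
  refine CYB_eq_zero_of_isFrobenius hpar.skew (isFrobeniusFunctionalOf_of_contract hpar
    (tracePair (frobMatrix n u t)) fun X hX => ?_)
  rw [tracePair_comp_ad]
  exact contract_frobMatrix hn hn3 hu ht hX

/-- The quadratic expression x²A + xyM + y²B vanishes at (1,1), (1,-1) and (2,1), three independent
conditions on A, M, B. The rational coefficients below invert this system. -/
theorem CYB_tenV₁_tenV₂ {n : ℕ} (hn : Odd n) (hn3 : 3 ≤ n) :
    CYB 0 (tenV₁ k n) = 0 ∧ CYB 0 (tenV₂ k n) = 0 := by
  have h1 := CYB_combination (k := k) hn hn3 one_ne_zero one_ne_zero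
  have h2 := CYB_combination (k := k) hn hn3 one_ne_zero (neg_ne_zero.2 one_ne_zero)
  have h3 := CYB_combination (k := k) hn hn3 two_ne_zero one_ne_zero
  rw [CYB_zero_add_smul] at h1 h2 h3
  set A := CYB 0 (tenV₁ k n)
  set B := CYB 0 (tenV₂ k n)
  set M := CYB 0 (tenV₁ k n + tenV₂ k n) - A - B
  constructor
  · calc A = (-(1 / 2 : k)) • ((1 : k) ^ 2 • A + ((1 : k) * 1) • M + (1 : k) ^ 2 • B)
          + (1 / 6 : k) • ((1 : k) ^ 2 • A + ((1 : k) * -1) • M + (-1 : k) ^ 2 • B)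
          + (1 / 3 : k) • ((2 : k) ^ 2 • A + ((2 : k) * 1) • M + (1 : k) ^ 2 • B) := by module
      _ = 0 := by rw [h1, h2, h3]; simp
  · calc B = (1 : k) • ((1 : k) ^ 2 • A + ((1 : k) * 1) • M + (1 : k) ^ 2 • B)
          + (1 / 3 : k) • ((1 : k) ^ 2 • A + ((1 : k) * -1) • M + (-1 : k) ^ 2 • B)
          - (1 / 3 : k) • ((2 : k) ^ 2 • A + ((2 : k) * 1) • M + (1 : k) ^ 2 • B) := by module
      _ = 0 := by rw [h1, h2, h3]; simp

theorem CYB_bCG {n : ℕ} (hn : Odd n) (hn3 : 3 ≤ n) (u t : k) : CYB 0 (bCG n u t) = 0 := by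
  obtain ⟨h1, h2⟩ := CYB_tenV₁_tenV₂ (k := k) hn hn3
  by_cases hu : u = 0
  · have h : bCG n u t = (0 : k) • tenV₁ k n + t • tenV₂ k n := by rw [bCG_eq, hu]; module
    rw [h, CYB_zero_add_smul, h1, h2]; module
  by_cases ht : t = 0
  · have h : bCG n u t = u • tenV₁ k n + (0 : k) • tenV₂ k n := by rw [bCG_eq, ht]; module
    rw [h, CYB_zero_add_smul, h1, h2]; module
  exact CYB_eq_zero_of_isFrobenius (isParabolicTensor_bCG hn u t).skew
    (isFrobeniusFunctionalOf_bCG hn hn3 hu ht)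

theorem isTriangular_bCG {n : ℕ} (hn : Odd n) (hn3 : 3 ≤ n) (u t : k) :
    IsTriangular (bCG n u t) :=
  ⟨mem_slWedge (by omega) (isParabolicTensor_bCG hn u t).skew
    (isParabolicTensor_bCG hn u t).partialTrace_eq_zero, CYB_bCG hn hn3 u t⟩

end

end CremmerGervais

end

theorem mainTheorem1 {k : Type*} [Field k] [IsAlgClosed k] [CharZero k]
    (n : ℕ) (hn : Odd n) (hn3 : 3 ≤ n) :
    -- `E₁`, `E₂` act on truncated polynomials through the matrices used below
    ((∀ f ∈ CremmerGervais.truncPol k n, CremmerGervais.opE₁ f ∈ CremmerGervais.truncPol k n) ∧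
      (∀ f ∈ CremmerGervais.truncPol k n, CremmerGervais.opE₂ f ∈ CremmerGervais.truncPol k n) ∧
      CremmerGervais.truncMatrix n CremmerGervais.opE₁
        = CremmerGervais.coprod (CremmerGervais.matE₁ k n) ∧
      CremmerGervais.truncMatrix n CremmerGervais.opE₂
        = CremmerGervais.coprod (CremmerGervais.matE₂ k n)) ∧
    ∀ u t : k,
      -- `b_CG(u,t)` preserves truncated polynomials
      (∀ f ∈ CremmerGervais.truncPol k n,
        CremmerGervais.opB n u t f ∈ CremmerGervais.truncPol k n) ∧
      -- the exponentials are those of nilpotent operators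
      IsNilpotent (CremmerGervais.adAct (u • CremmerGervais.matE₁ k n)) ∧
      IsNilpotent (CremmerGervais.adAct (t • CremmerGervais.matE₂ k n)) ∧
      -- part 1
      CremmerGervais.expAct (t • CremmerGervais.matE₂ k n)
          (CremmerGervais.expAct (u • CremmerGervais.matE₁ k n) (CremmerGervais.rCG k (n - 2) n))
        = CremmerGervais.rCG k (n - 2) n + CremmerGervais.bCG n u t ∧
      CremmerGervais.IsTriangular (CremmerGervais.bCG n u t) ∧
      ((u, t) ≠ (0, 0) → ∃ hb : CremmerGervais.bCG n u t ≠ 0,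
        Projectivization.mk k (CremmerGervais.bCG n u t) hb
          ∈ CremmerGervais.orbitBoundary (CremmerGervais.rCG k (n - 2) n)) ∧
      -- parts 2 and 3
      (u ≠ 0 → t ≠ 0 →
        CremmerGervais.carrier (CremmerGervais.bCG n u t)
          = (CremmerGervais.maxParabolic k (n - 2) n).toSubmodule ∧
        CremmerGervais.IsFrobeniusFunctionalOf (CremmerGervais.bCG n u t)
          (CremmerGervais.maxParabolic k (n - 2) n) (CremmerGervais.frobFunctional n u t)) := by
  refine ⟨⟨CremmerGervais.preserves_opE₁ n, CremmerGervais.preserves_opE₂ hn,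
    CremmerGervais.truncMatrix_opE₁ n, CremmerGervais.truncMatrix_opE₂ n⟩, fun u t => ?_⟩
  exact ⟨CremmerGervais.preserves_opB hn u t,
    CremmerGervais.isNilpotent_adAct (CremmerGervais.isNilpotent_smul_matE₁ n u),
    CremmerGervais.isNilpotent_adAct (CremmerGervais.isNilpotent_smul_matE₂ n t),
    CremmerGervais.expAct_rCG hn hn3 u t, CremmerGervais.isTriangular_bCG hn hn3 u t,
    fun h => ⟨CremmerGervais.bCG_ne_zero hn3 h, CremmerGervais.mk_bCG_mem_orbitBoundary hn hn3 _⟩,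
    fun hu ht => ⟨CremmerGervais.carrier_bCG hn hn3 hu ht,
      CremmerGervais.isFrobeniusFunctionalOf_bCG hn hn3 hu ht⟩⟩
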